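/- Conventions. A graded manifold $\mathcal M=(M,\mathcal A)$ consists of a finite-dimensional, Hausdorff, second countable smooth manifold $M$ (boundary allowed) and a sheaf $\mathcal A$ of $\mathbb Z$-graded $\mathcal O_M$-algebras such that every point of $M$ has a neighbourhood $U$ on which $\mathcal A|_U$ is isomorphic, as a sheaf of graded $\mathcal O_U$-algebras, to the sheafification of $\mathcal O_U\otimes_{\mathbb R}S(V^\vee)$; here $V$ is a fixed finite-dimensional graded real vector space and $S(V^\vee)$ is the graded symmetric algebra of polynomial functions on $V$. It has positive amplitude if $V$ is concentrated in strictly positive degrees. Write $C^\infty(\mathcal M)=\mathcal A(M)$. A morphism $f:(M,\mathcal A)\to(N,\mathcal B)$ is a smooth map $M\to N$, also written $f$, together with a morphism $f^*\mathcal B=\mathcal O_M\otimes_{f^{-1}\mathcal O_N}f^{-1}\mathcal B\to\mathcal A$ of sheaves of graded $\mathcal O_M$-algebras. The product $\mathcal M\times[0,1]$ has base $M\times[0,1]$ and sheaf $\mathcal O_{M\times[0,1]}\otimes_{\mathrm{pr}_1^{-1}\mathcal O_M}\mathrm{pr}_1^{-1}\mathcal A$, and $\iota_t:\mathcal M\cong\mathcal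 M\times\{t\}\hookrightarrow\mathcal M\times[0,1]$ is the inclusion. A graded vector bundle $\mathcal E$ over $(M,\mathcal A)$ is a sheaf of graded $\mathcal A$-modules locally isomorphic to $\mathcal A\otimes_{\mathbb R}W$ for a fixed finite-dimensional graded vector space $W$; $\Gamma(\mathcal M;\mathcal E)$ denotes its global sections. The pullback of a graded vector bundle $\mathcal F$ over $(N,\mathcal B)$ along $f$ is $f^*\mathcal F=\mathcal A\otimes_{f^{-1}\mathcal B}f^{-1}\mathcal F$. Theorem. Let $\mathcal M$ and $\mathcal N$ be graded manifolds with bases $M$ and $N$. (1) Let $f:\mathcal M\times[0,1]\to\mathcal N$ be a morphism of graded manifolds and put $f_t=f\circ\iota_t:\mathcal M\to\mathcal N$. For every graded vector bundle $\mathcal F$ over $\mathcal N$ there is an isomorphism $f_0^*\mathcal F\cong f_1^*\mathcal F$ of graded vector bundles over $\mathcal M$. (2) Suppose that $\mathcal M$ has positive amplitude, and let $\pi:\mathcal M\to M$ be the projection onto the base. For every graded vector bundle $\mathcal E$ over $\mathcal M$ there is a graded vector bundle $E$ over $M$ such that $\mathcal E\cong\pi^*E$ as graded vector bundles over $\mathcal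 M$ and $$\Gamma(\mathcal M;\mathcal E)\cong C^\infty(\mathcal M)\otimes_{C^\infty(M)}\Gamma(M;E)$$ as graded $C^\infty(\mathcal M)$-modules. -/

import Mathlib

open scoped Manifold ContDiff TensorProduct
open TopologicalSpace

universe u

noncomputable section

set_option linter.unusedVariables false

namespace GradedGeometry

/-! ### The graded symmetric algebra

A finite-dimensional graded vector space `V` is given by a homogeneous basis `v₁, …, vₙ`, that is,
by the list of degrees `d : Fin n → ℤ` of the basis vectors. -/

section Sym

variable {n : ℕ} (d : Fin n → ℤ)

/-- The Koszul relations `ξᵢ ξⱼ = (-1)^(|ξᵢ||ξⱼ|) ξⱼ ξᵢ`. (The dual coordinate `ξᵢ` has degree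
`-dᵢ`, and `(-dᵢ)(-dⱼ) = dᵢ dⱼ`; over `ℝ` an odd `ξᵢ` therefore squares to zero.) -/
inductive SymRel : FreeAlgebra ℝ (Fin n) → FreeAlgebra ℝ (Fin n) → Prop
  | swap (i j : Fin n) :
      SymRel (FreeAlgebra.ι ℝ i * FreeAlgebra.ι ℝ j)
        ((((d i * d j).negOnePow : ℤˣ) : ℤ) • (FreeAlgebra.ι ℝ j * FreeAlgebra.ι ℝ i))

/-- The graded symmetric algebra `S(V^∨)`: polynomial functions on `V`. It is the algebra generated
by the dual coordinates `ξ₁, …, ξₙ` subject to graded commutativity. -/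
def Sym : Type := RingQuot (SymRel d)

instance : Ring (Sym d) := inferInstanceAs (Ring (RingQuot (SymRel d)))

instance : Algebra ℝ (Sym d) := inferInstanceAs (Algebra ℝ (RingQuot (SymRel d)))

/-- The linear coordinate `ξᵢ` on `V`; it has degree `-dᵢ`. -/
def Sym.coord (i : Fin n) : Sym d := RingQuot.mkAlgHom ℝ (SymRel d) (FreeAlgebra.ι ℝ i)

/-- The degree `k` part of `S(V^∨)`: the span of the monomials `ξ_{i₁} ⋯ ξ_{iₘ}` with
`-d_{i₁} - ⋯ - d_{iₘ} = k`. -/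
def Sym.gr (k : ℤ) : Submodule ℝ (Sym d) :=
  Submodule.span ℝ {s | ∃ l : List (Fin n), (l.map fun i => -d i).sum = k ∧
    s = (l.map (Sym.coord d)).prod}

theorem Sym.one_mem_gr : (1 : Sym d) ∈ Sym.gr d 0 :=
  Submodule.subset_span ⟨[], by simp, by simp⟩

theorem Sym.mul_mem_gr {i j : ℤ} {a b : Sym d} (ha : a ∈ Sym.gr d i) (hb : b ∈ Sym.gr d j) :
    a * b ∈ Sym.gr d (i + j) := by
  have h := Submodule.mul_mem_mul ha hb
  rw [Sym.gr, Sym.gr, Submodule.span_mul_span] at h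
  refine Submodule.span_mono ?_ h
  rintro _ ⟨_, ⟨l, hl, rfl⟩, _, ⟨l', hl', rfl⟩, rfl⟩
  exact ⟨l ++ l', by simp [hl, hl'], by simp⟩

theorem Sym.algebraMap_mem_gr (r : ℝ) : algebraMap ℝ (Sym d) r ∈ Sym.gr d 0 := by
  rw [Algebra.algebraMap_eq_smul_one]
  exact Submodule.smul_mem _ _ (Sym.one_mem_gr d)

/-- Evaluation of polynomial functions at the origin of `V`. -/
def Sym.eps : Sym d →ₐ[ℝ] ℝ :=
  RingQuot.liftAlgHom ℝ ⟨FreeAlgebra.lift ℝ (fun _ => (0 : ℝ)), by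
    rintro _ _ ⟨i, j⟩
    simp⟩

end Sym

/-! ### Smooth functions and the local model -/

section Smooth

variable {E : Type*} [NormedAddCommGroup E] [NormedSpace ℝ E] {H : Type*} [TopologicalSpace H]
  (I : ModelWithCorners ℝ E H) {M : Type u} [TopologicalSpace M] [ChartedSpace H M]
  {E' : Type*} [NormedAddCommGroup E'] [NormedSpace ℝ E'] {H' : Type*} [TopologicalSpace H']
  {J : ModelWithCorners ℝ E' H'} {N : Type u} [TopologicalSpace N] [ChartedSpace H' N]

/-- `C^∞(U)`, the ring of smooth real functions on an open set `U`. -/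
abbrev Smooth (U : Opens M) : Type u := C^∞⟮I, U; 𝓘(ℝ, ℝ), ℝ⟯

/-- Restriction of smooth functions. -/
abbrev Smooth.res {U V : Opens M} (h : U ≤ V) : Smooth I V →+* Smooth I U :=
  ContMDiffMap.restrictRingHom I 𝓘(ℝ, ℝ) ℝ h

variable {I}

/-- The open set `f⁻¹(V)`. -/
def pre (f : C^∞⟮I, M; J, N⟯) (V : Opens N) : Opens M :=
  ⟨f ⁻¹' V, V.isOpen.preimage f.contMDiff.continuous⟩

theorem pre_mono (f : C^∞⟮I, M; J, N⟯) {V V' : Opens N} (h : V ≤ V') : pre f V ≤ pre f V' :=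
  fun _ hx => h hx

/-- `g ↦ g ∘ f`, as a map `C^∞(V) → C^∞(W)` for open sets with `f(W) ⊆ V`. -/
def Smooth.comp (f : C^∞⟮I, M; J, N⟯) {V : Opens N} {W : Opens M} (h : W ≤ pre f V) :
    Smooth J V →+* Smooth I W where
  toFun g := ⟨fun x => g ⟨f x, h x.2⟩, g.contMDiff.comp (by
    rw [← ContMDiff.subtypeVal_comp_iff]
    exact f.contMDiff.comp contMDiff_subtype_val)⟩
  map_one' := rfl
  map_mul' _ _ := rfl
  map_zero' := rfl
  map_add' _ _ := rfl

variable (I) {n : ℕ} (d : Fin n → ℤ)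

/-- The map `C^∞(W) ⊗ S(V^∨) → (functions W → S(V^∨))`, `f ⊗ s ↦ (x ↦ f(x) s)`. -/
def polyEval (W : Opens M) : Smooth I W ⊗[ℝ] Sym d →ₐ[ℝ] (W → Sym d) :=
  Algebra.TensorProduct.lift
    (AlgHom.pi fun x =>
      (Algebra.ofId ℝ (Sym d)).comp ((Pi.evalAlgHom ℝ (fun _ : W => ℝ) x).comp
        (ContMDiffMap.coeFnAlgHom (I := I) (n := ∞) (N := W) (A := ℝ))))
    (AlgHom.pi fun _ => AlgHom.id ℝ (Sym d))
    (fun f s => funext fun x => Algebra.commutes (f x) s)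

theorem polyEval_tmul (W : Opens M) (f : Smooth I W) (s : Sym d) (x : W) :
    polyEval I d W (f ⊗ₜ s) x = f x • s := by
  rw [Algebra.smul_def]; rfl

variable {I} in
theorem exists_polyEval_comp (f : C^∞⟮I, M; J, N⟯) {V : Opens N} {W : Opens M} (h : W ≤ pre f V)
    (t : Smooth J V ⊗[ℝ] Sym d) :
    ∃ t' : Smooth I W ⊗[ℝ] Sym d,
      ∀ y : W, polyEval I d W t' y = polyEval J d V t ⟨f y, h y.2⟩ := by
  induction t using TensorProduct.induction_on with
  | zero => exact ⟨0, fun y => by simp⟩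
  | tmul g s => exact ⟨Smooth.comp f h g ⊗ₜ s, fun y => by
      rw [polyEval_tmul, polyEval_tmul]; rfl⟩
  | add a b ha hb =>
    obtain ⟨a', ha⟩ := ha
    obtain ⟨b', hb⟩ := hb
    exact ⟨a' + b', fun y => by simp [ha, hb]⟩

theorem exists_polyEval_res {U W : Opens M} (h : W ≤ U) (t : Smooth I U ⊗[ℝ] Sym d) :
    ∃ t' : Smooth I W ⊗[ℝ] Sym d,
      ∀ y : W, polyEval I d W t' y = polyEval I d U t ⟨y, h y.2⟩ :=
  exists_polyEval_comp d (ContMDiffMap.id : C^∞⟮I, M; I, M⟯) h t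

/-- Sections over `W` of the sheafification of `O_M ⊗ S(V^∨)`: the functions `W → S(V^∨)` which
locally lie in the image of (the injective map from) `C^∞ ⊗ S(V^∨)`. -/
def stdSections (W : Opens M) : Subring (W → Sym d) where
  carrier := {s | ∀ x ∈ W, ∃ (W' : Opens M) (h : W' ≤ W), x ∈ W' ∧
    ∃ t : Smooth I W' ⊗[ℝ] Sym d, ∀ y : W', s ⟨y, h y.2⟩ = polyEval I d W' t y}
  zero_mem' x hx := ⟨W, le_rfl, hx, 0, by simp⟩
  one_mem' x hx := ⟨W, le_rfl, hx, 1, by simp⟩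
  neg_mem' {s} hs x hx := by
    obtain ⟨W', h, hx', t, ht⟩ := hs x hx
    exact ⟨W', h, hx', -t, fun y => by simp [ht]⟩
  add_mem' {s s'} hs hs' x hx := by
    obtain ⟨W₁, h₁, hx₁, t₁, ht₁⟩ := hs x hx
    obtain ⟨W₂, h₂, hx₂, t₂, ht₂⟩ := hs' x hx
    obtain ⟨r₁, hr₁⟩ := exists_polyEval_res I d (inf_le_left : W₁ ⊓ W₂ ≤ W₁) t₁
    obtain ⟨r₂, hr₂⟩ := exists_polyEval_res I d (inf_le_right : W₁ ⊓ W₂ ≤ W₂) t₂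
    refine ⟨W₁ ⊓ W₂, inf_le_left.trans h₁, ⟨hx₁, hx₂⟩, r₁ + r₂, fun y => ?_⟩
    rw [map_add, Pi.add_apply, Pi.add_apply, hr₁, hr₂, ← ht₁, ← ht₂]
  mul_mem' {s s'} hs hs' x hx := by
    obtain ⟨W₁, h₁, hx₁, t₁, ht₁⟩ := hs x hx
    obtain ⟨W₂, h₂, hx₂, t₂, ht₂⟩ := hs' x hx
    obtain ⟨r₁, hr₁⟩ := exists_polyEval_res I d (inf_le_left : W₁ ⊓ W₂ ≤ W₁) t₁
    obtain ⟨r₂, hr₂⟩ := exists_polyEval_res I d (inf_le_right : W₁ ⊓ W₂ ≤ W₂) t₂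
    refine ⟨W₁ ⊓ W₂, inf_le_left.trans h₁, ⟨hx₁, hx₂⟩, r₁ * r₂, fun y => ?_⟩
    rw [map_mul, Pi.mul_apply, Pi.mul_apply, hr₁, hr₂, ← ht₁, ← ht₂]

variable {I d}

theorem mem_stdSections_of_locally {W : Opens M} {s : W → Sym d}
    (h : ∀ x ∈ W, ∃ (W' : Opens M) (h : W' ≤ W), x ∈ W' ∧
      (fun y : W' => s ⟨y, h y.2⟩) ∈ stdSections I d W') : s ∈ stdSections I d W := by
  intro x hx
  obtain ⟨W', h', hx', hs⟩ := h x hx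
  obtain ⟨W'', h'', hx'', t, ht⟩ := hs x hx'
  exact ⟨W'', h''.trans h', hx'', t, ht⟩

theorem comp_mem_stdSections (f : C^∞⟮I, M; J, N⟯) {V : Opens N} {W : Opens M} (h : W ≤ pre f V)
    {s : V → Sym d} (hs : s ∈ stdSections J d V) :
    (fun y : W => s ⟨f y, h y.2⟩) ∈ stdSections I d W := by
  intro x hx
  obtain ⟨V', h', hx', t, ht⟩ := hs (f x) (h hx)
  obtain ⟨t', ht'⟩ := exists_polyEval_comp d f (inf_le_right : W ⊓ pre f V' ≤ pre f V') t
  exact ⟨W ⊓ pre f V', inf_le_left, ⟨hx, hx'⟩, t', fun y => by rw [ht', ← ht]⟩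

theorem res_mem_stdSections {U W : Opens M} (h : W ≤ U) {s : U → Sym d}
    (hs : s ∈ stdSections I d U) : (fun y : W => s ⟨y, h y.2⟩) ∈ stdSections I d W :=
  comp_mem_stdSections (ContMDiffMap.id : C^∞⟮I, M; I, M⟯) h hs

theorem const_mem_stdSections (W : Opens M) (c : Sym d) :
    (fun _ : W => c) ∈ stdSections I d W :=
  fun x hx => ⟨W, le_rfl, hx, 1 ⊗ₜ c, fun y => by rw [polyEval_tmul]; simp⟩

theorem algebraMap_mem_stdSections {W : Opens M} (f : Smooth I W) :
    (fun x : W => algebraMap ℝ (Sym d) (f x)) ∈ stdSections I d W :=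
  fun x hx => ⟨W, le_rfl, hx, f ⊗ₜ 1, fun y => by
    rw [polyEval_tmul, ← Algebra.algebraMap_eq_smul_one]⟩

end Smooth

/-! ### Graded manifolds -/

section GradedManifold

variable {E : Type*} [NormedAddCommGroup E] [NormedSpace ℝ E] {H : Type*} [TopologicalSpace H]

/-- A sheaf `A` of (associative, unital) `O_M`-algebras on `M`, with subsheaves `A^k = gr k`,
`k ∈ ℤ`, of `O_M`-modules such that `1 ∈ A^0` and `A^i A^j ⊆ A^(i+j)`. For the sheaves of graded
manifolds below, `A` is locally the direct sum of the `A^k`, and graded commutative, because this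
holds for the local model. -/
structure GradedAlgebraSheaf (I : ModelWithCorners ℝ E H) (M : Type u) [TopologicalSpace M]
    [ChartedSpace H M] where
  /-- The sections over an open set. -/
  sec : Opens M → Type u
  [ring : ∀ U, Ring (sec U)]
  [algebra : ∀ U, Algebra (Smooth I U) (sec U)]
  /-- Restriction of sections. -/
  res : ∀ {U V : Opens M}, U ≤ V → sec V →+* sec U
  res_refl : ∀ {U : Opens M} (a : sec U), res le_rfl a = a
  res_res : ∀ {U V W : Opens M} (h : U ≤ V) (h' : V ≤ W) (a : sec W),
    res h (res h' a) = res (h.trans h') a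
  res_algebraMap : ∀ {U V : Opens M} (h : U ≤ V) (f : Smooth I V),
    res h (algebraMap (Smooth I V) (sec V) f) =
      algebraMap (Smooth I U) (sec U) (Smooth.res I h f)
  eq_of_locally : ∀ {U : Opens M} (a b : sec U),
    (∀ x ∈ U, ∃ (W : Opens M) (h : W ≤ U), x ∈ W ∧ res h a = res h b) → a = b
  glue : ∀ {ι : Type u} (W : ι → Opens M) (a : ∀ i, sec (W i)),
    (∀ i j, res (inf_le_left : W i ⊓ W j ≤ W i) (a i) =
      res (inf_le_right : W i ⊓ W j ≤ W j) (a j)) →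
    ∃ b : sec (⨆ i, W i), ∀ i, res (le_iSup W i) b = a i
  /-- The homogeneous sections of degree `k`. -/
  gr : ℤ → ∀ U, Submodule (Smooth I U) (sec U)
  one_mem_gr : ∀ U, (1 : sec U) ∈ gr 0 U
  mul_mem_gr : ∀ {i j : ℤ} {U : Opens M} {a b : sec U},
    a ∈ gr i U → b ∈ gr j U → a * b ∈ gr (i + j) U
  res_mem_gr : ∀ {k : ℤ} {U V : Opens M} (h : U ≤ V) {a : sec V},
    a ∈ gr k V → res h a ∈ gr k U
  gr_of_locally : ∀ {k : ℤ} {U : Opens M} (a : sec U),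
    (∀ x ∈ U, ∃ (W : Opens M) (h : W ≤ U), x ∈ W ∧ res h a ∈ gr k W) → a ∈ gr k U

attribute [instance] GradedAlgebraSheaf.ring GradedAlgebraSheaf.algebra

variable {I : ModelWithCorners ℝ E H} {M : Type u} [TopologicalSpace M] [ChartedSpace H M]

/-- An isomorphism, over an open set `U`, of the sheaf of graded `O_M`-algebras `A` with the
sheafification of `O_M ⊗ S(V^∨)`. -/
structure LocalTriv (A : GradedAlgebraSheaf I M) {n : ℕ} (d : Fin n → ℤ) where
  U : Opens M
  map : ∀ W : Opens M, W ≤ U → A.sec W ≃+* stdSections I d W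
  map_res : ∀ {W W' : Opens M} (h : W ≤ U) (h' : W' ≤ W) (a : A.sec W) (x : W'),
    (map W' (h'.trans h) (A.res h' a)).1 x = (map W h a).1 ⟨x, h' x.2⟩
  map_algebraMap : ∀ {W : Opens M} (h : W ≤ U) (f : Smooth I W) (x : W),
    (map W h (algebraMap _ _ f)).1 x = algebraMap ℝ (Sym d) (f x)
  mem_gr_iff : ∀ {W : Opens M} (h : W ≤ U) (k : ℤ) (a : A.sec W),
    a ∈ A.gr k W ↔ ∀ x, (map W h a).1 x ∈ Sym.gr d k

/-- A (finite-dimensional) graded manifold with base `M`: a sheaf of graded `O_M`-algebras which is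
locally isomorphic to the sheafification of `O_M ⊗ S(V^∨)`, for a fixed finite-dimensional graded
vector space `V`, given by the degrees `deg` of a homogeneous basis. -/
structure GradedManifold (I : ModelWithCorners ℝ E H) (M : Type u) [TopologicalSpace M]
    [ChartedSpace H M] extends GradedAlgebraSheaf I M where
  /-- The dimension of `V`. -/
  fibreDim : ℕ
  /-- The degrees of a homogeneous basis of `V`. -/
  deg : Fin fibreDim → ℤ
  exists_triv : ∀ x : M, ∃ τ : LocalTriv toGradedAlgebraSheaf deg, x ∈ τ.U

/-- `V` is concentrated in strictly positive degrees. -/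
def GradedManifold.PositiveAmplitude (X : GradedManifold I M) : Prop := ∀ i, 0 < X.deg i


/-! ### Local expressions and change of trivialisation -/

namespace LocalTriv

variable {A : GradedAlgebraSheaf I M} {n : ℕ} {d : Fin n → ℤ} (τ τ' τ'' : LocalTriv A d)

/-- The value in `S(V^∨)` at a point `x` of a section, in a local trivialisation around `x`. -/
def val {W : Opens M} {x : M} (hW : x ∈ W) (hx : x ∈ τ.U) : A.sec W →+* Sym d :=
  ((Pi.evalRingHom (fun _ : (W ⊓ τ.U : Opens M) => Sym d) ⟨x, hW, hx⟩).comp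
    (stdSections I d (W ⊓ τ.U)).subtype).comp
    ((τ.map (W ⊓ τ.U) inf_le_right : A.sec (W ⊓ τ.U) →+* stdSections I d (W ⊓ τ.U)).comp
      (A.res inf_le_left))

theorem val_eq {W W' : Opens M} (h : W' ≤ W) (h' : W' ≤ τ.U) {x : M} (hx : x ∈ W')
    (a : A.sec W) : τ.val (h hx) (h' hx) a = (τ.map W' h' (A.res h a)).1 ⟨x, hx⟩ := by
  have := τ.map_res (inf_le_right : W ⊓ τ.U ≤ τ.U) (le_inf h h') (A.res inf_le_left a) ⟨x, hx⟩
  rw [A.res_res] at this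
  exact this.symm

theorem val_res {W W' : Opens M} (h : W' ≤ W) {x : M} (hx : x ∈ W') (hx' : x ∈ τ.U)
    (a : A.sec W) : τ.val hx hx' (A.res h a) = τ.val (h hx) hx' a := by
  rw [τ.val_eq (W := W) (W' := W' ⊓ τ.U) (inf_le_left.trans h) inf_le_right ⟨hx, hx'⟩,
    τ.val_eq (W := W') (W' := W' ⊓ τ.U) inf_le_left inf_le_right ⟨hx, hx'⟩, A.res_res]

theorem val_algebraMap {W : Opens M} {x : M} (hW : x ∈ W) (hx : x ∈ τ.U) (f : Smooth I W) :
    τ.val hW hx (algebraMap _ _ f) = algebraMap ℝ (Sym d) (f ⟨x, hW⟩) := by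
  rw [τ.val_eq (W := W) (W' := W ⊓ τ.U) inf_le_left inf_le_right ⟨hW, hx⟩, A.res_algebraMap,
    τ.map_algebraMap]
  rfl

theorem val_symm {W : Opens M} (h : W ≤ τ.U) {x : M} (hW : x ∈ W) (s : stdSections I d W) :
    τ.val hW (h hW) ((τ.map W h).symm s) = s.1 ⟨x, hW⟩ := by
  rw [τ.val_eq le_rfl h hW, A.res_refl, RingEquiv.apply_symm_apply]

theorem ext_val {W : Opens M} (h : W ≤ τ.U) {a b : A.sec W}
    (H : ∀ (x : M) (hW : x ∈ W), τ.val hW (h hW) a = τ.val hW (h hW) b) : a = b := by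
  apply (τ.map W h).injective
  apply Subtype.ext
  funext ⟨x, hx⟩
  have := H x hx
  rwa [τ.val_eq le_rfl h hx, τ.val_eq le_rfl h hx, A.res_refl, A.res_refl] at this

theorem val_mem_stdSections {W : Opens M} (a : A.sec W) :
    (fun x : (W ⊓ τ.U : Opens M) => τ.val x.2.1 x.2.2 a) ∈ stdSections I d (W ⊓ τ.U) :=
  (τ.map (W ⊓ τ.U) inf_le_right (A.res inf_le_left a)).2

theorem val_mem_gr {W : Opens M} {x : M} (hW : x ∈ W) (hx : x ∈ τ.U) {k : ℤ} {a : A.sec W}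
    (ha : a ∈ A.gr k W) : τ.val hW hx a ∈ Sym.gr d k :=
  (τ.mem_gr_iff inf_le_right k _).1 (A.res_mem_gr inf_le_left ha) ⟨x, hW, hx⟩

/-- The section over `τ.U` which is constant, equal to `c`, in the trivialisation `τ`. -/
def const : Sym d →+* A.sec τ.U :=
  ((τ.map τ.U le_rfl).symm : stdSections I d τ.U →+* A.sec τ.U).comp
    ((Pi.constRingHom τ.U (Sym d)).codRestrict (stdSections I d τ.U)
      fun c => const_mem_stdSections τ.U c)

theorem val_const {x : M} (hx : x ∈ τ.U) (c : Sym d) : τ.val hx hx (τ.const c) = c :=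
  τ.val_symm le_rfl hx _

/-- The transition function from `τ` to `τ'` at `x`, an endomorphism of the algebra `S(V^∨)`. -/
def trans {x : M} (hx : x ∈ τ.U) (hx' : x ∈ τ'.U) : Sym d →+* Sym d :=
  (τ'.val hx hx').comp τ.const

theorem const_algebraMap (r : ℝ) :
    τ.const (algebraMap ℝ _ r) = algebraMap _ _ (algebraMap ℝ (Smooth I τ.U) r) := by
  refine τ.ext_val le_rfl fun x hx => ?_
  rw [τ.val_const, τ.val_algebraMap]
  rfl

theorem trans_algebraMap {x : M} (hx : x ∈ τ.U) (hx' : x ∈ τ'.U) (r : ℝ) :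
    τ.trans τ' hx hx' (algebraMap ℝ _ r) = algebraMap ℝ _ r := by
  rw [trans, RingHom.comp_apply, const_algebraMap, val_algebraMap]
  rfl

theorem trans_smul {x : M} (hx : x ∈ τ.U) (hx' : x ∈ τ'.U) (r : ℝ) (c : Sym d) :
    τ.trans τ' hx hx' (r • c) = r • τ.trans τ' hx hx' c := by
  rw [Algebra.smul_def, map_mul, trans_algebraMap, ← Algebra.smul_def]

theorem exists_val_eq_polyEval {W : Opens M} (h : W ≤ τ.U) (t : Smooth I W ⊗[ℝ] Sym d) :
    ∃ b : A.sec W, (∀ y (hy : y ∈ W), τ.val hy (h hy) b = polyEval I d W t ⟨y, hy⟩) ∧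
      ∀ y (hy : y ∈ W) (hy' : y ∈ τ'.U),
        τ'.val hy hy' b = τ.trans τ' (h hy) hy' (polyEval I d W t ⟨y, hy⟩) := by
  induction t using TensorProduct.induction_on with
  | zero => exact ⟨0, fun y hy => by simp, fun y hy hy' => by simp⟩
  | tmul f c =>
    refine ⟨algebraMap _ _ f * A.res h (τ.const c), fun y hy => ?_, fun y hy hy' => ?_⟩
    · rw [map_mul, val_algebraMap, val_res, val_const, polyEval_tmul, Algebra.smul_def]
    · rw [map_mul, val_algebraMap, val_res, polyEval_tmul, trans_smul, Algebra.smul_def]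
      rfl
  | add t t' ht ht' =>
    obtain ⟨b, hb, hb'⟩ := ht
    obtain ⟨c, hc, hc'⟩ := ht'
    exact ⟨b + c, fun y hy => by simp [hb, hc], fun y hy hy' => by simp [hb', hc']⟩

/-- Local expressions transform by the transition functions. -/
theorem val_eq_trans {W : Opens M} {x : M} (hW : x ∈ W) (hx : x ∈ τ.U) (hx' : x ∈ τ'.U)
    (a : A.sec W) : τ'.val hW hx' a = τ.trans τ' hx hx' (τ.val hW hx a) := by
  obtain ⟨W', h, hxW', t, ht⟩ := τ.val_mem_stdSections a x ⟨hW, hx⟩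
  obtain ⟨b, hb, hb'⟩ := τ.exists_val_eq_polyEval τ' (h.trans inf_le_right) t
  have hba : b = A.res (h.trans inf_le_left) a := by
    refine τ.ext_val (h.trans inf_le_right) fun y hy => ?_
    rw [hb, val_res]
    exact (ht ⟨y, hy⟩).symm
  have h1 := hb' x hxW' hx'
  have h2 := hb x hxW'
  rw [hba, val_res] at h1 h2
  rw [h1, ← h2]

theorem trans_self {x : M} (hx : x ∈ τ.U) (c : Sym d) : τ.trans τ hx hx c = c :=
  τ.val_const hx c

theorem trans_trans {x : M} (hx : x ∈ τ.U) (hx' : x ∈ τ'.U) (hx'' : x ∈ τ''.U) (c : Sym d) :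
    τ'.trans τ'' hx' hx'' (τ.trans τ' hx hx' c) = τ.trans τ'' hx hx'' c :=
  (τ'.val_eq_trans τ'' hx hx' hx'' (τ.const c)).symm

theorem trans_mem_gr {x : M} (hx : x ∈ τ.U) (hx' : x ∈ τ'.U) {k : ℤ} {c : Sym d}
    (hc : c ∈ Sym.gr d k) : τ.trans τ' hx hx' c ∈ Sym.gr d k := by
  refine τ'.val_mem_gr hx hx' ((τ.mem_gr_iff le_rfl k _).2 fun y => ?_)
  have := τ.val_const y.2 c
  rw [τ.val_eq le_rfl le_rfl y.2, A.res_refl] at this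
  rwa [this]

variable {E' : Type*} [NormedAddCommGroup E'] [NormedSpace ℝ E'] {H' : Type*}
  [TopologicalSpace H'] {J : ModelWithCorners ℝ E' H'} {P : Type u} [TopologicalSpace P]
  [ChartedSpace H' P] (h : C^∞⟮J, P; I, M⟯)

theorem trans_mem_stdSections {W : Opens P} (hW : W ≤ pre h τ.U) (hW' : W ≤ pre h τ'.U)
    {s : W → Sym d} (hs : s ∈ stdSections J d W) :
    (fun p : W => τ.trans τ' (hW p.2) (hW' p.2) (s p)) ∈ stdSections J d W := by
  refine mem_stdSections_of_locally fun x hx => ?_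
  obtain ⟨W', h', hx', t, ht⟩ := hs x hx
  refine ⟨W', h', hx', ?_⟩
  have key : ∀ t : Smooth J W' ⊗[ℝ] Sym d,
      (fun p : W' => τ.trans τ' (hW (h' p.2)) (hW' (h' p.2)) (polyEval J d W' t p)) ∈
        stdSections J d W' := by
    intro t
    induction t using TensorProduct.induction_on with
    | zero =>
      convert (stdSections J d W').zero_mem using 1
      funext p
      simp
    | tmul f c =>
      have hle : W' ≤ pre h (τ.U ⊓ τ'.U) := le_inf (h'.trans hW) (h'.trans hW')
      have h1 := comp_mem_stdSections h hle
        (τ'.val_mem_stdSections (τ.const c))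
      have h2 := (stdSections J d W').mul_mem (algebraMap_mem_stdSections (d := d) f) h1
      convert h2 using 1
      funext p
      exact (congrArg _ (polyEval_tmul J d W' f c p)).trans
        ((τ.trans_smul τ' _ _ _ _).trans (Algebra.smul_def _ _))
    | add a b ha hb =>
      convert (stdSections J d W').add_mem ha hb using 1
      funext p
      simp
  convert key t using 1
  funext p
  rw [ht]

end LocalTriv

namespace GradedManifold

variable (X : GradedManifold I M)

theorem ext_val {W : Opens M} {a b : X.sec W}
    (h : ∀ (τ : LocalTriv X.toGradedAlgebraSheaf X.deg) (x : M) (hW : x ∈ W) (hx : x ∈ τ.U),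
      τ.val hW hx a = τ.val hW hx b) : a = b := by
  refine X.eq_of_locally a b fun x hx => ?_
  obtain ⟨τ, hτ⟩ := X.exists_triv x
  refine ⟨W ⊓ τ.U, inf_le_left, ⟨hx, hτ⟩, τ.ext_val inf_le_right fun y hy => ?_⟩
  rw [τ.val_res, τ.val_res]
  exact h τ y hy.1 hy.2

theorem mem_gr_of_val {W : Opens M} {a : X.sec W} {k : ℤ}
    (h : ∀ (τ : LocalTriv X.toGradedAlgebraSheaf X.deg) (x : M) (hW : x ∈ W) (hx : x ∈ τ.U),
      τ.val hW hx a ∈ Sym.gr X.deg k) : a ∈ X.gr k W := by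
  refine X.gr_of_locally a fun x hx => ?_
  obtain ⟨τ, hτ⟩ := X.exists_triv x
  exact ⟨W ⊓ τ.U, inf_le_left, ⟨hx, hτ⟩,
    (τ.mem_gr_iff inf_le_right k _).2 fun y => h τ y y.2.1 y.2.2⟩

theorem exists_of_val {W : Opens M}
    (v : ∀ τ : LocalTriv X.toGradedAlgebraSheaf X.deg, stdSections I X.deg (W ⊓ τ.U))
    (hv : ∀ (τ τ' : LocalTriv X.toGradedAlgebraSheaf X.deg) (x : M) (hW : x ∈ W)
      (hx : x ∈ τ.U) (hx' : x ∈ τ'.U),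
      (v τ').1 ⟨x, hW, hx'⟩ = τ.trans τ' hx hx' ((v τ).1 ⟨x, hW, hx⟩)) :
    ∃ a : X.sec W, ∀ (τ : LocalTriv X.toGradedAlgebraSheaf X.deg) (x : M) (hW : x ∈ W)
      (hx : x ∈ τ.U), τ.val hW hx a = (v τ).1 ⟨x, hW, hx⟩ := by
  obtain ⟨b, hb⟩ := X.glue (fun τ : LocalTriv X.toGradedAlgebraSheaf X.deg => W ⊓ τ.U)
    (fun τ => (τ.map (W ⊓ τ.U) inf_le_right).symm (v τ)) (fun τ τ' => by
      refine τ'.ext_val (inf_le_right.trans inf_le_right) fun x hx => ?_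
      rw [τ'.val_res, τ'.val_res, τ'.val_symm inf_le_right hx.2,
        τ.val_eq_trans τ' hx.1 hx.1.2 hx.2.2, τ.val_symm inf_le_right hx.1]
      exact (hv τ τ' x hx.1.1 hx.1.2 hx.2.2).symm)
  have hW : W ≤ ⨆ τ : LocalTriv X.toGradedAlgebraSheaf X.deg, W ⊓ τ.U := fun x hx => by
    obtain ⟨τ, hτ⟩ := X.exists_triv x
    exact Opens.mem_iSup.2 ⟨τ, hx, hτ⟩
  refine ⟨X.res hW b, fun τ x hx hxτ => ?_⟩
  rw [τ.val_res]
  have h1 := τ.val_res (le_iSup (fun τ : LocalTriv X.toGradedAlgebraSheaf X.deg => W ⊓ τ.U) τ)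
    ⟨hx, hxτ⟩ hxτ b
  rw [hb τ, τ.val_symm inf_le_right ⟨hx, hxτ⟩] at h1
  exact h1.symm

end GradedManifold

/-! ### Base change of a graded manifold, products with a manifold -/

namespace GradedManifold

variable {E' : Type*} [NormedAddCommGroup E'] [NormedSpace ℝ E'] {H' : Type*}
  [TopologicalSpace H'] {J : ModelWithCorners ℝ E' H'} {P : Type u} [TopologicalSpace P]
  [ChartedSpace H' P] (X : GradedManifold I M) (h : C^∞⟮J, P; I, M⟯)

/-- The type of all local trivialisations of `X`. -/
abbrev Triv : Type u := LocalTriv X.toGradedAlgebraSheaf X.deg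

/-- Sections over `W` of the sheaf `O_P ⊗_{h⁻¹O_M} h⁻¹A` on `P`, in terms of local expressions: a
section is given by an `S(V^∨)`-valued function `s τ` on `W ∩ h⁻¹(U)` (a section of the
sheafification of `O_P ⊗ S(V^∨)`) for each local trivialisation `τ` of `A` over `U`, and these
local expressions are related by the transition functions of `A`. -/
def bcSections (W : Opens P) : Subring (∀ τ : X.Triv, stdSections J X.deg (W ⊓ pre h τ.U)) where
  carrier := {s | ∀ (τ τ' : X.Triv) (p : P) (hW : p ∈ W) (hx : h p ∈ τ.U) (hx' : h p ∈ τ'.U),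
    (s τ').1 ⟨p, hW, hx'⟩ = τ.trans τ' hx hx' ((s τ).1 ⟨p, hW, hx⟩)}
  zero_mem' τ τ' p hW hx hx' := (map_zero (τ.trans τ' hx hx')).symm
  one_mem' τ τ' p hW hx hx' := (map_one (τ.trans τ' hx hx')).symm
  neg_mem' {s} hs τ τ' p hW hx hx' := by
    have := hs τ τ' p hW hx hx'
    change -(s τ').1 _ = τ.trans τ' hx hx' (-(s τ).1 _)
    rw [this, map_neg]
  add_mem' {s t} hs ht τ τ' p hW hx hx' := by
    have h1 := hs τ τ' p hW hx hx'
    have h2 := ht τ τ' p hW hx hx'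
    change (s τ').1 _ + (t τ').1 _ = τ.trans τ' hx hx' ((s τ).1 _ + (t τ).1 _)
    rw [h1, h2, map_add]
  mul_mem' {s t} hs ht τ τ' p hW hx hx' := by
    have h1 := hs τ τ' p hW hx hx'
    have h2 := ht τ τ' p hW hx hx'
    change (s τ').1 _ * (t τ').1 _ = τ.trans τ' hx hx' ((s τ).1 _ * (t τ).1 _)
    rw [h1, h2, map_mul]

/-- The ring of sections over `W` of the base change. -/
def BCSec (W : Opens P) : Type u := X.bcSections h W

instance bcRing (W : Opens P) : Ring (X.BCSec h W) := inferInstanceAs (Ring (X.bcSections h W))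

/-- The value at `p` of the local expression of a section in the trivialisation `τ`. -/
def bcVal {W : Opens P} (τ : X.Triv) {p : P} (hW : p ∈ W) (hx : h p ∈ τ.U) :
    X.BCSec h W →+* Sym X.deg :=
  (Pi.evalRingHom (fun _ : (W ⊓ pre h τ.U : Opens P) => Sym X.deg) ⟨p, hW, hx⟩).comp
    ((stdSections J X.deg (W ⊓ pre h τ.U)).subtype.comp
      ((Pi.evalRingHom (fun τ : X.Triv => stdSections J X.deg (W ⊓ pre h τ.U)) τ).comp
        (X.bcSections h W).subtype))

variable {X h} in
theorem bcVal_ext {W : Opens P} {a b : X.BCSec h W}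
    (H : ∀ (τ : X.Triv) (p : P) (hW : p ∈ W) (hx : h p ∈ τ.U),
      X.bcVal h τ hW hx a = X.bcVal h τ hW hx b) : a = b := by
  apply Subtype.ext
  funext τ
  apply Subtype.ext
  funext ⟨p, hW, hx⟩
  exact H τ p hW hx

theorem bcVal_trans {W : Opens P} (τ τ' : X.Triv) {p : P} (hW : p ∈ W) (hx : h p ∈ τ.U)
    (hx' : h p ∈ τ'.U) (a : X.BCSec h W) :
    X.bcVal h τ' hW hx' a = τ.trans τ' hx hx' (X.bcVal h τ hW hx a) :=
  a.2 τ τ' p hW hx hx'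

/-- Smooth functions as sections of the base change. -/
def bcAlgebraMap (W : Opens P) : Smooth J W →+* X.BCSec h W where
  toFun f := ⟨fun τ => ⟨fun p => algebraMap ℝ (Sym X.deg) (f ⟨p, p.2.1⟩),
    res_mem_stdSections inf_le_left (algebraMap_mem_stdSections f)⟩,
    fun τ τ' p hW hx hx' => (τ.trans_algebraMap τ' hx hx' _).symm⟩
  map_one' := bcVal_ext fun _ _ _ _ => map_one (algebraMap ℝ (Sym X.deg))
  map_zero' := bcVal_ext fun _ _ _ _ => map_zero (algebraMap ℝ (Sym X.deg))
  map_mul' _ _ := bcVal_ext fun _ _ _ _ => map_mul (algebraMap ℝ (Sym X.deg)) _ _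
  map_add' _ _ := bcVal_ext fun _ _ _ _ => map_add (algebraMap ℝ (Sym X.deg)) _ _

instance bcAlgebra (W : Opens P) : Algebra (Smooth J W) (X.BCSec h W) :=
  (X.bcAlgebraMap h W).toAlgebra' fun f a => bcVal_ext fun τ p hW hx => by
    rw [RingHom.map_mul, RingHom.map_mul]
    exact Algebra.commutes (R := ℝ) (A := Sym X.deg) (f ⟨p, hW⟩) (X.bcVal h τ hW hx a)

theorem bcVal_algebraMap {W : Opens P} (τ : X.Triv) {p : P} (hW : p ∈ W) (hx : h p ∈ τ.U)
    (f : Smooth J W) : X.bcVal h τ hW hx (algebraMap _ _ f) =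
      algebraMap ℝ (Sym X.deg) (f ⟨p, hW⟩) := rfl

/-- Restriction of sections of the base change. -/
def bcRes {U V : Opens P} (hUV : U ≤ V) : X.BCSec h V →+* X.BCSec h U where
  toFun s := ⟨fun τ => ⟨fun p => (s.1 τ).1 ⟨p, hUV p.2.1, p.2.2⟩,
    res_mem_stdSections (inf_le_inf_right _ hUV) (s.1 τ).2⟩,
    fun τ τ' p hW hx hx' => s.2 τ τ' p (hUV hW) hx hx'⟩
  map_one' := rfl
  map_zero' := rfl
  map_mul' _ _ := rfl
  map_add' _ _ := rfl

theorem bcVal_res {U V : Opens P} (hUV : U ≤ V) (τ : X.Triv) {p : P} (hU : p ∈ U)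
    (hx : h p ∈ τ.U) (a : X.BCSec h V) :
    X.bcVal h τ hU hx (X.bcRes h hUV a) = X.bcVal h τ (hUV hU) hx a := rfl

/-- The sections of the base change of degree `k`: their local expressions have degree `k`. -/
def bcGr (k : ℤ) (W : Opens P) : Submodule (Smooth J W) (X.BCSec h W) where
  carrier := {s | ∀ (τ : X.Triv) (p : P) (hW : p ∈ W) (hx : h p ∈ τ.U),
    X.bcVal h τ hW hx s ∈ Sym.gr X.deg k}
  zero_mem' τ p hW hx := by
    rw [RingHom.map_zero]; exact Submodule.zero_mem _
  add_mem' {a b} ha hb τ p hW hx := by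
    rw [RingHom.map_add]; exact Submodule.add_mem _ (ha τ p hW hx) (hb τ p hW hx)
  smul_mem' f a ha τ p hW hx := by
    rw [Algebra.smul_def, RingHom.map_mul, bcVal_algebraMap, ← Algebra.smul_def]
    exact Submodule.smul_mem _ _ (ha τ p hW hx)

/-- The sheaf of graded algebras `O_P ⊗_{h⁻¹O_M} h⁻¹A` on `P`. -/
def bcSheaf : GradedAlgebraSheaf J P where
  sec W := X.BCSec h W
  res hUV := X.bcRes h hUV
  res_refl _ := rfl
  res_res _ _ _ := rfl
  res_algebraMap _ _ := rfl
  eq_of_locally {U} a b H := bcVal_ext fun τ p hW hx => by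
    obtain ⟨W, hWU, hp, hab⟩ := H p hW
    have := congrArg (X.bcVal h τ hp hx) hab
    rwa [bcVal_res, bcVal_res] at this
  glue {ι} W a hab := by
    have hidx : ∀ (p : P), p ∈ ⨆ i, W i → ∃ i, p ∈ W i := fun p hp => Opens.mem_iSup.1 hp
    choose idx hidx using hidx
    have hval : ∀ (i : ι) (τ : X.Triv) (p : P) (hp : p ∈ ⨆ i, W i) (hi : p ∈ W i)
        (hx : h p ∈ τ.U), X.bcVal h τ (hidx p hp) hx (a (idx p hp)) =
          X.bcVal h τ hi hx (a i) := fun i τ p hp hi hx => by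
      have := congrArg (X.bcVal h τ (show p ∈ W (idx p hp) ⊓ W i from ⟨hidx p hp, hi⟩) hx)
        (hab (idx p hp) i)
      rwa [bcVal_res, bcVal_res] at this
    refine ⟨⟨fun τ => ⟨fun p => X.bcVal h τ (hidx p p.2.1) p.2.2 (a (idx p p.2.1)), ?_⟩, ?_⟩, ?_⟩
    · refine mem_stdSections_of_locally fun p hp => ?_
      refine ⟨W (idx p hp.1) ⊓ pre h τ.U, inf_le_inf_right _ (le_iSup W _),
        ⟨hidx p hp.1, hp.2⟩, ?_⟩
      convert ((a (idx p hp.1)).1 τ).2 using 1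
      funext q
      exact hval _ τ q _ q.2.1 q.2.2
    · intro τ τ' p hW hx hx'
      exact X.bcVal_trans h τ τ' (hidx p hW) hx hx' _
    · intro i
      refine bcVal_ext fun τ p hW hx => ?_
      exact hval i τ p (le_iSup W i hW) hW hx
  gr k W := X.bcGr h k W
  one_mem_gr W τ p hW hx := by
    rw [RingHom.map_one]; exact Sym.one_mem_gr _
  mul_mem_gr ha hb τ p hW hx := by
    rw [RingHom.map_mul]; exact Sym.mul_mem_gr _ (ha τ p hW hx) (hb τ p hW hx)
  res_mem_gr hUV a ha τ p hW hx := ha τ p (hUV hW) hx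
  gr_of_locally a H τ p hW hx := by
    obtain ⟨W, hWU, hp, ha⟩ := H p hW
    exact ha τ p hp hx

/-- The local trivialisation of the base change induced by a local trivialisation of `X`. -/
def bcTriv (τ : X.Triv) : LocalTriv (X.bcSheaf h) X.deg where
  U := pre h τ.U
  map W hW :=
    { toFun := fun s => ⟨fun p => X.bcVal h τ p.2 (hW p.2) s,
        res_mem_stdSections (le_inf le_rfl hW) (s.1 τ).2⟩
      invFun := fun q => ⟨fun τ' => ⟨fun p => τ.trans τ' (hW p.2.1) p.2.2 (q.1 ⟨p, p.2.1⟩),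
          τ.trans_mem_stdSections τ' h (inf_le_left.trans hW) inf_le_right
            (res_mem_stdSections inf_le_left q.2)⟩,
        fun τ' τ'' p hp hx hx' => (τ.trans_trans τ' τ'' (hW hp) hx hx' _).symm⟩
      left_inv := fun s => bcVal_ext fun τ' p hp hx =>
        (X.bcVal_trans h τ τ' hp (hW hp) hx s).symm
      right_inv := fun q => Subtype.ext <| funext fun p => τ.trans_self (hW p.2) _
      map_mul' := fun s t => rfl
      map_add' := fun s t => rfl }
  map_res _ _ _ _ := rfl
  map_algebraMap _ _ _ := rfl
  mem_gr_iff {W} hW k a := by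
    refine ⟨fun ha p => ha τ p p.2 (hW p.2), fun ha τ' p hp hx => ?_⟩
    have h1 := τ.trans_mem_gr τ' (hW hp) hx (ha ⟨p, hp⟩)
    exact (X.bcVal_trans h τ τ' hp (hW hp) hx a).symm ▸ h1

/-- The base change `h^* X` of a graded manifold along a smooth map `h : P → M`, with base `P`. -/
def baseChange : GradedManifold J P where
  toGradedAlgebraSheaf := X.bcSheaf h
  fibreDim := X.fibreDim
  deg := X.deg
  exists_triv p := by
    obtain ⟨τ, hτ⟩ := X.exists_triv (h p)
    exact ⟨X.bcTriv h τ, hτ⟩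

end GradedManifold

/-- The product of a graded manifold with an ordinary manifold `Q`: it has base `M × Q`, and its
sheaf is `O_{M×Q} ⊗_{O_M} A`, which is locally the sheafification of `O_{M×Q} ⊗ S(V^∨)`. -/
def GradedManifold.prodManifold {E' : Type*} [NormedAddCommGroup E'] [NormedSpace ℝ E']
    {H' : Type*} [TopologicalSpace H'] (X : GradedManifold I M) (J : ModelWithCorners ℝ E' H')
    (Q : Type) [TopologicalSpace Q] [ChartedSpace H' Q] : GradedManifold (I.prod J) (M × Q) :=
  X.baseChange (ContMDiffMap.fst : C^∞⟮I.prod J, M × Q; I, M⟯)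

/-! ### Morphisms of graded manifolds -/

section Hom

variable {E' : Type*} [NormedAddCommGroup E'] [NormedSpace ℝ E'] {H' : Type*}
  [TopologicalSpace H'] {J : ModelWithCorners ℝ E' H'} {N : Type u} [TopologicalSpace N]
  [ChartedSpace H' N]
  {E'' : Type*} [NormedAddCommGroup E''] [NormedSpace ℝ E''] {H'' : Type*}
  [TopologicalSpace H''] {K : ModelWithCorners ℝ E'' H''} {P : Type u} [TopologicalSpace P]
  [ChartedSpace H'' P]

/-- A morphism of graded manifolds `(M, A) → (N, B)`: a smooth map `f : M → N` together with a
morphism `f^*B → A` of sheaves of graded `O_M`-algebras, where `f^*B = O_M ⊗_{f⁻¹O_N} f⁻¹B`; by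
adjunction the latter is a morphism `B → f_*A` of sheaves of graded algebras over `O_N → f_*O_M`. -/
structure Hom (X : GradedManifold I M) (Y : GradedManifold J N) where
  /-- The underlying smooth map. -/
  base : C^∞⟮I, M; J, N⟯
  /-- Pullback of functions. -/
  pull : ∀ V : Opens N, Y.sec V →+* X.sec (pre base V)
  pull_res : ∀ {V V' : Opens N} (h : V ≤ V') (b : Y.sec V'),
    pull V (Y.res h b) = X.res (pre_mono base h) (pull V' b)
  pull_algebraMap : ∀ {V : Opens N} (g : Smooth J V),
    pull V (algebraMap _ _ g) = algebraMap _ _ (Smooth.comp base le_rfl g)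
  pull_mem_gr : ∀ {k : ℤ} {V : Opens N} {b : Y.sec V}, b ∈ Y.gr k V →
    pull V b ∈ X.gr k (pre base V)

/-- Composition of morphisms of graded manifolds. -/
def Hom.comp {X : GradedManifold I M} {Y : GradedManifold J N} {Z : GradedManifold K P}
    (g : Hom Y Z) (f : Hom X Y) : Hom X Z where
  base := g.base.comp f.base
  pull V := (f.pull (pre g.base V)).comp (g.pull V)
  pull_res h b := (congrArg (f.pull _) (g.pull_res h b)).trans (f.pull_res _ _)
  pull_algebraMap b := (congrArg (f.pull _) (g.pull_algebraMap b)).trans (f.pull_algebraMap _)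
  pull_mem_gr hb := f.pull_mem_gr (g.pull_mem_gr hb)

theorem LocalTriv.trans_congr {A : GradedAlgebraSheaf I M} {n : ℕ} {d : Fin n → ℤ}
    (τ τ' : LocalTriv A d) {x y : M} (hxy : x = y) (hx : x ∈ τ.U) (hx' : x ∈ τ'.U)
    (hy : y ∈ τ.U) (hy' : y ∈ τ'.U) : τ.trans τ' hx hx' = τ.trans τ' hy hy' := by
  subst hxy
  rfl

section Slice

variable (X : GradedManifold I M) (h : C^∞⟮J, N; I, M⟯) (σ : C^∞⟮I, M; J, N⟯)
  (hσ : ∀ x, h (σ x) = x)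

theorem exists_slice (V : Opens N) (s : X.BCSec h V) :
    ∃ a : X.sec (pre σ V), ∀ (τ : X.Triv) (x : M) (hV : σ x ∈ V) (hx : x ∈ τ.U),
      τ.val (W := pre σ V) hV hx a = X.bcVal h τ hV (show h (σ x) ∈ τ.U by rwa [hσ x]) s := by
  have hle : ∀ τ : X.Triv, pre σ V ⊓ τ.U ≤ pre σ (V ⊓ pre h τ.U) := fun τ x hx =>
    ⟨hx.1, show h (σ x) ∈ τ.U by rw [hσ x]; exact hx.2⟩
  obtain ⟨a, ha⟩ := X.exists_of_val (W := pre σ V)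
    (fun τ => ⟨_, comp_mem_stdSections σ (hle τ) (s.1 τ).2⟩)
    (fun τ τ' x hV hx hx' => by
      have h1 : h (σ x) ∈ τ.U := by rwa [hσ x]
      have h2 : h (σ x) ∈ τ'.U := by rwa [hσ x]
      have := X.bcVal_trans h τ τ' (p := σ x) hV h1 h2 s
      rw [τ.trans_congr τ' (hσ x) h1 h2 hx hx'] at this
      exact this)
  exact ⟨a, fun τ x hV hx => ha τ x hV hx⟩

/-- Restriction of a section of the base change `h^* X` along a section `σ : M → N` of `h`: the
section of `X` whose local expressions are `x ↦ s(σ(x))`. -/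
def slice (V : Opens N) (s : X.BCSec h V) : X.sec (pre σ V) := (exists_slice X h σ hσ V s).choose

theorem slice_val (V : Opens N) (s : X.BCSec h V) (τ : X.Triv) {x : M} (hV : σ x ∈ V)
    (hx : x ∈ τ.U) : τ.val (W := pre σ V) hV hx (slice X h σ hσ V s) =
      X.bcVal h τ hV (show h (σ x) ∈ τ.U by rwa [hσ x]) s :=
  (exists_slice X h σ hσ V s).choose_spec τ x hV hx

/-- `slice` as a ring homomorphism. -/
def sliceRingHom (V : Opens N) : X.BCSec h V →+* X.sec (pre σ V) where
  toFun := slice X h σ hσ V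
  map_one' := X.ext_val fun τ x hV hx => by
    rw [slice_val X h σ hσ V _ τ hV hx, RingHom.map_one, RingHom.map_one]
  map_zero' := X.ext_val fun τ x hV hx => by
    rw [slice_val X h σ hσ V _ τ hV hx, RingHom.map_zero, RingHom.map_zero]
  map_mul' s t := X.ext_val fun τ x hV hx => by
    rw [slice_val X h σ hσ V _ τ hV hx, RingHom.map_mul, RingHom.map_mul,
      slice_val X h σ hσ V _ τ hV hx, slice_val X h σ hσ V _ τ hV hx]
  map_add' s t := X.ext_val fun τ x hV hx => by
    rw [slice_val X h σ hσ V _ τ hV hx, RingHom.map_add, RingHom.map_add,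
      slice_val X h σ hσ V _ τ hV hx, slice_val X h σ hσ V _ τ hV hx]

/-- For smooth maps `h : N → M` and `σ : M → N` with `h ∘ σ = id`, the morphism `X → h^* X` over
`σ` induced by the identity of `X`. -/
def sliceHom : Hom X (X.baseChange h) where
  base := σ
  pull V := sliceRingHom X h σ hσ V
  pull_res {V V'} hV b := X.ext_val fun τ x hx hxτ => by
    rw [τ.val_res]
    refine (slice_val X h σ hσ V _ τ hx hxτ).trans ?_
    exact (slice_val X h σ hσ V' b τ (hV hx) hxτ).symm
  pull_algebraMap {V} g := X.ext_val fun τ x hx hxτ => by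
    rw [τ.val_algebraMap]
    exact slice_val X h σ hσ V _ τ hx hxτ
  pull_mem_gr {k V b} hb := X.mem_gr_of_val fun τ x hx hxτ => by
    have h1 : h (σ x) ∈ τ.U := by rwa [hσ x]
    have h2 := hb τ (σ x) hx h1
    exact (slice_val X h σ hσ V b τ hx hxτ).symm ▸ h2

end Slice

/-- The product `X × [0,1]`. -/
abbrev GradedManifold.prodInterval (X : GradedManifold I M) :
    GradedManifold (I.prod (𝓡∂ 1)) (M × Set.Icc (0 : ℝ) 1) :=
  X.prodManifold (𝓡∂ 1) (Set.Icc (0 : ℝ) 1)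

/-- The inclusion `X ≅ X × {t} → X × [0,1]`. -/
def incl (X : GradedManifold I M) (t : Set.Icc (0 : ℝ) 1) : Hom X X.prodInterval :=
  sliceHom X (ContMDiffMap.fst : C^∞⟮I.prod (𝓡∂ 1), M × Set.Icc (0 : ℝ) 1; I, M⟯)
    ⟨fun x => (x, t), contMDiff_id.prodMk contMDiff_const⟩ fun _ => rfl

end Hom

/-! ### Ordinary manifolds as graded manifolds -/

section OfManifold

theorem Sym.eps_algebraMap {n : ℕ} (d : Fin n → ℤ) (r : ℝ) :
    Sym.eps d (algebraMap ℝ (Sym d) r) = r := (Sym.eps d).commutes r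

theorem Sym.algebraMap_eps (d : Fin 0 → ℤ) (s : Sym d) :
    algebraMap ℝ (Sym d) (Sym.eps d s) = s := by
  have : (Algebra.ofId ℝ (Sym d)).comp (Sym.eps d) = AlgHom.id ℝ (Sym d) := by
    apply RingQuot.ringQuot_ext'
    apply FreeAlgebra.hom_ext
    funext i
    exact i.elim0
  exact DFunLike.congr_fun this s

theorem Sym.gr_eq_bot (d : Fin 0 → ℤ) {k : ℤ} (hk : k ≠ 0) : Sym.gr d k = ⊥ := by
  rw [Sym.gr, Submodule.span_eq_bot]
  rintro _ ⟨l, hl, rfl⟩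
  obtain rfl : l = [] := List.eq_nil_iff_forall_not_mem.2 fun i => i.elim0
  exact absurd hl.symm (by simpa using hk)

theorem contMDiff_of_locally {U : Opens M} {F : U → ℝ}
    (H : ∀ x ∈ U, ∃ (W : Opens M) (h : W ≤ U), x ∈ W ∧
      ContMDiff I 𝓘(ℝ, ℝ) ∞ fun y : W => F ⟨y, h y.2⟩) : ContMDiff I 𝓘(ℝ, ℝ) ∞ F := by
  classical
  let G : M → ℝ := fun x => if hx : x ∈ U then F ⟨x, hx⟩ else 0
  have hG : ∀ x (hx : x ∈ U), G x = F ⟨x, hx⟩ := fun x hx => dif_pos hx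
  intro x
  obtain ⟨W, h, hx, hF⟩ := H x x.2
  have h1 : ContMDiffAt I 𝓘(ℝ, ℝ) ∞ G x := by
    have h2 := hF ⟨x, hx⟩
    rw [show (fun y : W => F ⟨y, h y.2⟩) = fun y : W => G y from
      funext fun y => (hG y (h y.2)).symm] at h2
    exact (contMDiffAt_subtype_iff (x := (⟨x, hx⟩ : W))).1 h2
  rw [show F = fun y : U => G y from funext fun y => (hG y y.2).symm]
  exact contMDiffAt_subtype_iff.2 h1

theorem eps_contMDiff {n : ℕ} {d : Fin n → ℤ} {W : Opens M} {s : W → Sym d}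
    (hs : s ∈ stdSections I d W) : ContMDiff I 𝓘(ℝ, ℝ) ∞ (fun x => Sym.eps d (s x)) := by
  refine contMDiff_of_locally fun x hx => ?_
  obtain ⟨W', h, hx, t, ht⟩ := hs x hx
  refine ⟨W', h, hx, ?_⟩
  have key : ∀ t : Smooth I W' ⊗[ℝ] Sym d,
      ContMDiff I 𝓘(ℝ, ℝ) ∞ fun y : W' => Sym.eps d (polyEval I d W' t y) := by
    intro t
    induction t using TensorProduct.induction_on with
    | zero => simpa using contMDiff_const
    | tmul f c =>
      simp only [polyEval_tmul, map_smul]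
      exact f.contMDiff.smul contMDiff_const
    | add a b ha hb =>
      simp only [map_add, Pi.add_apply]
      exact ha.add hb
  simp only [ht]
  exact key t

variable (I) in
/-- The grading of the smooth functions: all of them have degree zero. -/
def functionGr (k : ℤ) (U : Opens M) : Submodule (Smooth I U) (Smooth I U) :=
  if k = 0 then ⊤ else ⊥

theorem mem_functionGr_iff {W : Opens M} {d : Fin 0 → ℤ} (k : ℤ) (a : Smooth I W) :
    a ∈ functionGr I k W ↔ ∀ x, algebraMap ℝ (Sym d) (a x) ∈ Sym.gr d k := by
  by_cases hk : k = 0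
  · subst hk
    simp [functionGr, Sym.algebraMap_mem_gr]
  · rw [functionGr, if_neg hk, Submodule.mem_bot, Sym.gr_eq_bot _ hk]
    refine ⟨fun h x => by simp [h], fun h => ContMDiffMap.ext fun x => ?_⟩
    have h1 := congrArg (Sym.eps _) ((Submodule.mem_bot ℝ).1 (h x))
    rwa [Sym.eps_algebraMap, map_zero] at h1

theorem algebraMap_mem_gr (X : GradedManifold I M) {k : ℤ} {V : Opens M} {b : Smooth I V}
    (hb : b ∈ functionGr I k V) : algebraMap _ (X.sec V) b ∈ X.gr k V := by
  by_cases hk : k = 0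
  · subst hk
    rw [Algebra.algebraMap_eq_smul_one]
    exact (X.gr 0 V).smul_mem b (X.one_mem_gr V)
  · rw [functionGr, if_neg hk, Submodule.mem_bot] at hb
    rw [hb, RingHom.map_zero]
    exact Submodule.zero_mem _

variable (I M) in
/-- The sheaf of smooth functions, with all functions of degree zero. -/
def functionSheaf : GradedAlgebraSheaf I M where
  sec U := Smooth I U
  res h := Smooth.res I h
  res_refl _ := rfl
  res_res _ _ _ := rfl
  res_algebraMap _ _ := rfl
  eq_of_locally {U} a b H := by
    ext ⟨x, hx⟩
    obtain ⟨W, h, hxW, hab⟩ := H x hx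
    exact congrArg (fun f : Smooth I W => f ⟨x, hxW⟩) hab
  glue {ι} W a hab := by
    have hidx : ∀ (p : M), p ∈ ⨆ i, W i → ∃ i, p ∈ W i := fun p hp => Opens.mem_iSup.1 hp
    choose idx hidx using hidx
    have hval : ∀ (i : ι) (p : M) (hp : p ∈ ⨆ i, W i) (hi : p ∈ W i),
        a (idx p hp) ⟨p, hidx p hp⟩ = a i ⟨p, hi⟩ := fun i p hp hi =>
      congrArg (fun f : Smooth I (W (idx p hp) ⊓ W i) => f ⟨p, hidx p hp, hi⟩) (hab (idx p hp) i)
    refine ⟨⟨fun p => a (idx p p.2) ⟨p, hidx p p.2⟩, contMDiff_of_locally fun p hp => ?_⟩, ?_⟩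
    · refine ⟨W (idx p hp), le_iSup W _, hidx p hp, ?_⟩
      convert (a (idx p hp)).contMDiff using 1
      funext q
      exact hval _ q _ q.2
    · intro i
      ext p
      exact hval i p (le_iSup W i p.2) p.2
  gr k U := functionGr I k U
  one_mem_gr U := by simp [functionGr]
  mul_mem_gr {i j U a b} ha hb := by
    by_cases hi : i = 0
    · by_cases hj : j = 0
      · simp [functionGr, hi, hj]
      · rw [functionGr, if_neg hj, Submodule.mem_bot] at hb
        simp [hb]
    · rw [functionGr, if_neg hi, Submodule.mem_bot] at ha
      simp [ha]
  res_mem_gr {k U V} h {a} ha := by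
    by_cases hk : k = 0
    · simp [functionGr, hk]
    · rw [functionGr, if_neg hk, Submodule.mem_bot] at ha
      rw [ha, RingHom.map_zero]
      exact Submodule.zero_mem _
  gr_of_locally {k U} a H := by
    by_cases hk : k = 0
    · simp [functionGr, hk]
    · rw [functionGr, if_neg hk, Submodule.mem_bot]
      ext ⟨x, hx⟩
      obtain ⟨W, h, hxW, ha⟩ := H x hx
      rw [functionGr, if_neg hk, Submodule.mem_bot] at ha
      exact congrArg (fun f : Smooth I W => f ⟨x, hxW⟩) ha

variable (I M) in
/-- An ordinary manifold as a graded manifold (with `V = 0`). -/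
def ofManifold : GradedManifold I M where
  toGradedAlgebraSheaf := functionSheaf I M
  fibreDim := 0
  deg := Fin.elim0
  exists_triv x := ⟨
    { U := ⊤
      map := fun W _ =>
        { toFun := fun f => ⟨_, algebraMap_mem_stdSections f⟩
          invFun := fun s => ⟨_, eps_contMDiff s.2⟩
          left_inv := fun f => ContMDiffMap.ext fun x => Sym.eps_algebraMap _ _
          right_inv := fun s => Subtype.ext <| funext fun x => Sym.algebraMap_eps _ _
          map_mul' := fun f g => Subtype.ext <| funext fun x => map_mul (algebraMap ℝ _) _ _
          map_add' := fun f g => Subtype.ext <| funext fun x => map_add (algebraMap ℝ _) _ _ }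
      map_res := fun _ _ _ _ => rfl
      map_algebraMap := fun _ _ _ => rfl
      mem_gr_iff := fun _ k a => mem_functionGr_iff k a }, trivial⟩

/-- The projection of a graded manifold onto its base. -/
def proj (X : GradedManifold I M) : Hom X (ofManifold I M) where
  base := ContMDiffMap.id
  pull V := algebraMap (Smooth I V) (X.sec V)
  pull_res h b := (X.res_algebraMap h b).symm
  pull_algebraMap g := rfl
  pull_mem_gr hb := algebraMap_mem_gr X hb

end OfManifold

/-! ### Graded vector bundles -/

section Bundle

/-- A sheaf `F` of left `A`-modules with subsheaves `F^k = gr k` of abelian groups, `k ∈ ℤ`, such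
that `A^i F^j ⊆ F^(i+j)`. -/
structure GradedModuleSheaf (A : GradedAlgebraSheaf I M) where
  /-- The sections over an open set. -/
  sec : Opens M → Type u
  [addCommGroup : ∀ U, AddCommGroup (sec U)]
  [module : ∀ U, Module (A.sec U) (sec U)]
  /-- Restriction of sections. -/
  res : ∀ {U V : Opens M}, U ≤ V → sec V →+ sec U
  res_refl : ∀ {U : Opens M} (s : sec U), res le_rfl s = s
  res_res : ∀ {U V W : Opens M} (h : U ≤ V) (h' : V ≤ W) (s : sec W),
    res h (res h' s) = res (h.trans h') s
  res_smul : ∀ {U V : Opens M} (h : U ≤ V) (a : A.sec V) (s : sec V),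
    res h (a • s) = A.res h a • res h s
  eq_of_locally : ∀ {U : Opens M} (s t : sec U),
    (∀ x ∈ U, ∃ (W : Opens M) (h : W ≤ U), x ∈ W ∧ res h s = res h t) → s = t
  glue : ∀ {ι : Type u} (W : ι → Opens M) (s : ∀ i, sec (W i)),
    (∀ i j, res (inf_le_left : W i ⊓ W j ≤ W i) (s i) =
      res (inf_le_right : W i ⊓ W j ≤ W j) (s j)) →
    ∃ t : sec (⨆ i, W i), ∀ i, res (le_iSup W i) t = s i
  /-- The homogeneous sections of degree `k`. -/
  gr : ℤ → ∀ U, AddSubgroup (sec U)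
  smul_mem_gr : ∀ {i j : ℤ} {U : Opens M} {a : A.sec U} {s : sec U},
    a ∈ A.gr i U → s ∈ gr j U → a • s ∈ gr (i + j) U
  res_mem_gr : ∀ {k : ℤ} {U V : Opens M} (h : U ≤ V) {s : sec V},
    s ∈ gr k V → res h s ∈ gr k U
  gr_of_locally : ∀ {k : ℤ} {U : Opens M} (s : sec U),
    (∀ x ∈ U, ∃ (W : Opens M) (h : W ≤ U), x ∈ W ∧ res h s ∈ gr k W) → s ∈ gr k U

attribute [instance] GradedModuleSheaf.addCommGroup GradedModuleSheaf.module

/-- A homogeneous frame `e₁, …, eᵣ` of `F` over an open set `U`, with `|eᵢ| = dᵢ`; equivalently, an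
isomorphism over `U` of `F` with the free graded module `A ⊗ W`, where `W` is a graded vector space
with a homogeneous basis of degrees `d₁, …, dᵣ`. -/
structure LocalFrame {A : GradedAlgebraSheaf I M} (F : GradedModuleSheaf A) {r : ℕ}
    (d : Fin r → ℤ) where
  U : Opens M
  e : Fin r → F.sec U
  existsUnique : ∀ {W : Opens M} (h : W ≤ U) (s : F.sec W),
    ∃! c : Fin r → A.sec W, s = ∑ i, c i • F.res h (e i)
  mem_gr_iff : ∀ {W : Opens M} (h : W ≤ U) (k : ℤ) (c : Fin r → A.sec W),
    ∑ i, c i • F.res h (e i) ∈ F.gr k W ↔ ∀ i, c i ∈ A.gr (k - d i) W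

/-- A graded vector bundle (of finite rank) over a graded manifold `(M, A)`, as a locally free sheaf
of graded `A`-modules. The degrees `deg` are those of a homogeneous basis of the typical fibre. -/
structure GradedVectorBundle (X : GradedManifold I M) extends
    GradedModuleSheaf X.toGradedAlgebraSheaf where
  /-- The total rank. -/
  rank : ℕ
  /-- The degrees of a homogeneous basis of the typical fibre. -/
  deg : Fin rank → ℤ
  exists_frame : ∀ x : M, ∃ φ : LocalFrame toGradedModuleSheaf deg, x ∈ φ.U

/-- An isomorphism of graded vector bundles over the same graded manifold: a degree-preserving
isomorphism of sheaves of graded modules. -/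
structure GradedVectorBundle.Iso {X : GradedManifold I M} (F G : GradedVectorBundle X) where
  equiv : ∀ U : Opens M, F.sec U ≃ₗ[X.sec U] G.sec U
  equiv_res : ∀ {U V : Opens M} (h : U ≤ V) (s : F.sec V),
    equiv U (F.res h s) = G.res h (equiv V s)
  mem_gr_iff : ∀ (k : ℤ) {U : Opens M} (s : F.sec U), equiv U s ∈ G.gr k U ↔ s ∈ F.gr k U

theorem GradedAlgebraSheaf.exists_glue (A : GradedAlgebraSheaf I M) {ι : Type u} {U : Opens M}
    (W : ι → Opens M) (hW : ∀ i, W i ≤ U) (hU : U ≤ ⨆ i, W i) (a : ∀ i, A.sec (W i))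
    (hab : ∀ i j, A.res (inf_le_left : W i ⊓ W j ≤ W i) (a i) =
      A.res (inf_le_right : W i ⊓ W j ≤ W j) (a j)) :
    ∃ b : A.sec U, ∀ i, A.res (hW i) b = a i := by
  obtain ⟨b, hb⟩ := A.glue W a hab
  exact ⟨A.res hU b, fun i => by rw [A.res_res, ← hb i]⟩

namespace LocalFrame

variable {A : GradedAlgebraSheaf I M} {F : GradedModuleSheaf A} {r : ℕ} {d : Fin r → ℤ}
  (φ ψ χ : LocalFrame F d)

/-- The coefficients of a section with respect to a frame. -/
def coord {W : Opens M} (h : W ≤ φ.U) (s : F.sec W) : Fin r → A.sec W :=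
  (φ.existsUnique h s).choose

theorem coord_spec {W : Opens M} (h : W ≤ φ.U) (s : F.sec W) :
    s = ∑ i, φ.coord h s i • F.res h (φ.e i) := (φ.existsUnique h s).choose_spec.1

theorem coord_unique {W : Opens M} (h : W ≤ φ.U) {s : F.sec W} {c : Fin r → A.sec W}
    (hc : s = ∑ i, c i • F.res h (φ.e i)) : φ.coord h s = c :=
  ((φ.existsUnique h s).choose_spec.2 c hc).symm

theorem coord_res {W W' : Opens M} (h' : W' ≤ W) (h : W ≤ φ.U) (s : F.sec W) (i : Fin r) :
    φ.coord (h'.trans h) (F.res h' s) i = A.res h' (φ.coord h s i) := by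
  refine congrFun (φ.coord_unique (c := fun i => A.res h' (φ.coord h s i)) (h'.trans h) ?_) i
  conv_lhs => rw [φ.coord_spec h s]
  rw [map_sum]
  exact Finset.sum_congr rfl fun i _ => by rw [F.res_smul, F.res_res]

/-- The transition matrix: `φᵢ = ∑ⱼ gᵢⱼ ψⱼ` on the overlap of the domains of two frames. -/
def trans (i j : Fin r) : A.sec (φ.U ⊓ ψ.U) :=
  ψ.coord inf_le_right (F.res inf_le_left (φ.e i)) j

theorem e_mem_gr (i : Fin r) : φ.e i ∈ F.gr (d i) φ.U := by
  classical
  have := (φ.mem_gr_iff le_rfl (d i) (Pi.single i 1)).2 fun j => by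
    rcases eq_or_ne j i with rfl | hj
    · simpa using A.one_mem_gr φ.U
    · rw [Pi.single_eq_of_ne hj]
      exact Submodule.zero_mem _
  rw [Finset.sum_eq_single i (fun j _ hj => by rw [Pi.single_eq_of_ne hj, zero_smul])
    (fun h => absurd (Finset.mem_univ i) h), Pi.single_eq_same, one_smul, F.res_refl] at this
  exact this

theorem trans_mem_gr (i j : Fin r) : φ.trans ψ i j ∈ A.gr (d i - d j) (φ.U ⊓ ψ.U) := by
  refine (ψ.mem_gr_iff inf_le_right (d i) (φ.trans ψ i)).1 ?_ j
  have := ψ.coord_spec inf_le_right (F.res (inf_le_left : φ.U ⊓ ψ.U ≤ φ.U) (φ.e i))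
  exact this ▸ F.res_mem_gr _ (φ.e_mem_gr i)

theorem res_e_eq {W : Opens M} (h : W ≤ φ.U ⊓ ψ.U) (i : Fin r) :
    F.res (h.trans inf_le_left) (φ.e i) =
      ∑ j, A.res h (φ.trans ψ i j) • F.res (h.trans inf_le_right) (ψ.e j) := by
  have := congrArg (F.res h)
    (ψ.coord_spec inf_le_right (F.res (inf_le_left : φ.U ⊓ ψ.U ≤ φ.U) (φ.e i)))
  rw [F.res_res, map_sum] at this
  rw [this]
  exact Finset.sum_congr rfl fun j _ => by rw [F.res_smul, F.res_res]; rfl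

theorem trans_trans {W : Opens M} (h1 : W ≤ φ.U ⊓ ψ.U) (h2 : W ≤ ψ.U ⊓ χ.U)
    (h3 : W ≤ φ.U ⊓ χ.U) (i k : Fin r) :
    A.res h3 (φ.trans χ i k) = ∑ j, A.res h1 (φ.trans ψ i j) * A.res h2 (ψ.trans χ j k) := by
  have e1 := χ.coord_unique (h3.trans inf_le_right) (φ.res_e_eq χ h3 i)
  have e2 := χ.coord_unique (h3.trans inf_le_right)
    (s := F.res (h3.trans inf_le_left) (φ.e i))
    (c := fun k => ∑ j, A.res h1 (φ.trans ψ i j) * A.res h2 (ψ.trans χ j k)) (by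
      rw [φ.res_e_eq ψ h1 i]
      simp only [Finset.sum_smul]
      rw [Finset.sum_comm]
      refine Finset.sum_congr rfl fun j _ => ?_
      rw [ψ.res_e_eq χ h2 j, Finset.smul_sum]
      exact Finset.sum_congr rfl fun k _ => by rw [mul_smul])
  exact congrFun (e1.symm.trans e2) k

theorem trans_self (i j : Fin r) : φ.trans φ i j = if i = j then 1 else 0 := by
  refine congrFun (φ.coord_unique (c := fun j => if i = j then 1 else 0) inf_le_right ?_) j
  simp [ite_smul]

end LocalFrame

end Bundle

/-! ### Pullback of graded vector bundles -/

section Pullback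

variable {E' : Type*} [NormedAddCommGroup E'] [NormedSpace ℝ E'] {H' : Type*}
  [TopologicalSpace H'] {J : ModelWithCorners ℝ E' H'} {N : Type u} [TopologicalSpace N]
  [ChartedSpace H' N] {X : GradedManifold I M} {Y : GradedManifold J N} (f : Hom X Y)

/-- Pullback of functions from `V` to `W`, where `f(W) ⊆ V`. -/
def Hom.pullTo {V : Opens N} {W : Opens M} (h : W ≤ pre f.base V) : Y.sec V →+* X.sec W :=
  (X.res h).comp (f.pull V)

theorem Hom.pullTo_res {V V' : Opens N} {W : Opens M} (h : W ≤ pre f.base V) (h' : V ≤ V')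
    (b : Y.sec V') : f.pullTo h (Y.res h' b) = f.pullTo (h.trans (pre_mono f.base h')) b := by
  simp only [Hom.pullTo, RingHom.comp_apply, f.pull_res, X.res_res]

theorem Hom.res_pullTo {V : Opens N} {W W' : Opens M} (h : W ≤ pre f.base V) (h' : W' ≤ W)
    (b : Y.sec V) : X.res h' (f.pullTo h b) = f.pullTo (h'.trans h) b := by
  simp only [Hom.pullTo, RingHom.comp_apply, X.res_res]

theorem Hom.pullTo_mem_gr {V : Opens N} {W : Opens M} (h : W ≤ pre f.base V) {k : ℤ}
    {b : Y.sec V} (hb : b ∈ Y.gr k V) : f.pullTo h b ∈ X.gr k W :=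
  X.res_mem_gr h (f.pull_mem_gr hb)

variable (F : GradedVectorBundle Y)

/-- The type of all local frames of `F`. -/
abbrev GradedVectorBundle.Frame : Type u := LocalFrame F.toGradedModuleSheaf F.deg

/-- Sections over `U` of the pullback `f^*F`. A section is given by its coefficients `c φ` with
respect to the pulled back frame `f^*φ` over `U ∩ f⁻¹(V)`, for each local frame `φ` of `F` over `V`;
if `φᵢ = ∑ⱼ gᵢⱼ ψⱼ`, then the coefficients transform as `(c ψ)ⱼ = ∑ᵢ (c φ)ᵢ f^*(gᵢⱼ)`. -/
def pbSections (U : Opens M) :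
    AddSubgroup (∀ φ : F.Frame, Fin F.rank → X.sec (U ⊓ pre f.base φ.U)) where
  carrier := {c | ∀ (φ ψ : F.Frame) (j : Fin F.rank),
    X.res (inf_le_inf_left U (pre_mono f.base (inf_le_right : φ.U ⊓ ψ.U ≤ ψ.U))) (c ψ j) =
      ∑ i, X.res (inf_le_inf_left U (pre_mono f.base (inf_le_left : φ.U ⊓ ψ.U ≤ φ.U))) (c φ i) *
        f.pullTo (inf_le_right : U ⊓ pre f.base (φ.U ⊓ ψ.U) ≤ _) (φ.trans ψ i j)}
  zero_mem' φ ψ j := by simp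
  add_mem' {a b} ha hb φ ψ j := by
    simp only [Pi.add_apply, map_add, add_mul, Finset.sum_add_distrib, ha φ ψ j, hb φ ψ j]
  neg_mem' {a} ha φ ψ j := by
    simp only [Pi.neg_apply, map_neg, neg_mul, Finset.sum_neg_distrib, ha φ ψ j]

/-- The group of sections over `U` of the pullback `f^*F`. -/
def PBSec (U : Opens M) : Type u := pbSections f F U

instance (U : Opens M) : AddCommGroup (PBSec f F U) :=
  inferInstanceAs (AddCommGroup (pbSections f F U))

variable {f F} in
/-- The coefficients of a section of `f^*F`, over a smaller open set. -/
def pbCoef {U W : Opens M} (φ : F.Frame) (hU : W ≤ U) (hφ : W ≤ pre f.base φ.U)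
    (i : Fin F.rank) : PBSec f F U →+ X.sec W where
  toFun c := X.res (le_inf hU hφ) (c.1 φ i)
  map_zero' := map_zero (X.res (le_inf hU hφ))
  map_add' _ _ := map_add (X.res (le_inf hU hφ)) _ _

variable {f F} in
theorem pbCoef_ext {U : Opens M} {a b : PBSec f F U}
    (H : ∀ (φ : F.Frame) (i : Fin F.rank),
      pbCoef φ inf_le_left (inf_le_right : U ⊓ pre f.base φ.U ≤ _) i a =
        pbCoef φ inf_le_left (inf_le_right : U ⊓ pre f.base φ.U ≤ _) i b) : a = b := by
  apply Subtype.ext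
  funext φ i
  have := H φ i
  change X.res le_rfl (a.1 φ i) = X.res le_rfl (b.1 φ i) at this
  rwa [X.res_refl, X.res_refl] at this

variable {f F} in
theorem res_pbCoef {U W W' : Opens M} (φ : F.Frame) (hU : W ≤ U) (hφ : W ≤ pre f.base φ.U)
    (h : W' ≤ W) (i : Fin F.rank) (c : PBSec f F U) :
    X.res h (pbCoef φ hU hφ i c) = pbCoef φ (h.trans hU) (h.trans hφ) i c :=
  X.res_res _ _ _

variable {f F} in
theorem pbCoef_trans {U W : Opens M} (φ ψ : F.Frame) (hU : W ≤ U) (hφ : W ≤ pre f.base φ.U)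
    (hψ : W ≤ pre f.base ψ.U) (h : W ≤ pre f.base (φ.U ⊓ ψ.U)) (j : Fin F.rank)
    (c : PBSec f F U) :
    pbCoef ψ hU hψ j c = ∑ i, pbCoef φ hU hφ i c * f.pullTo h (φ.trans ψ i j) := by
  have := congrArg (X.res (le_inf hU h)) (c.2 φ ψ j)
  rw [X.res_res, map_sum] at this
  refine Eq.trans this (Finset.sum_congr rfl fun i _ => ?_)
  rw [map_mul, X.res_res, f.res_pullTo]
  rfl

instance pbModule (U : Opens M) : Module (X.sec U) (PBSec f F U) where
  smul a c := ⟨fun φ i => X.res inf_le_left a * c.1 φ i, fun φ ψ j => by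
    simp only [map_mul, X.res_res, c.2 φ ψ j, Finset.mul_sum, mul_assoc]⟩
  one_smul c := Subtype.ext <| funext fun φ => funext fun i => by
    change X.res _ 1 * c.1 φ i = c.1 φ i
    rw [map_one, one_mul]
  mul_smul a b c := Subtype.ext <| funext fun φ => funext fun i => by
    change X.res _ (a * b) * c.1 φ i = X.res _ a * (X.res _ b * c.1 φ i)
    rw [map_mul, mul_assoc]
  smul_zero a := Subtype.ext <| funext fun φ => funext fun i => mul_zero (X.res inf_le_left a)
  smul_add a b c := Subtype.ext <| funext fun φ => funext fun i =>
    mul_add (X.res inf_le_left a) (b.1 φ i) (c.1 φ i)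
  add_smul a b c := Subtype.ext <| funext fun φ => funext fun i => by
    change X.res _ (a + b) * c.1 φ i = X.res _ a * c.1 φ i + X.res _ b * c.1 φ i
    rw [map_add, add_mul]
  zero_smul c := Subtype.ext <| funext fun φ => funext fun i => by
    change X.res _ 0 * c.1 φ i = 0
    rw [map_zero, zero_mul]

variable {f F} in
theorem pbCoef_smul {U W : Opens M} (φ : F.Frame) (hU : W ≤ U) (hφ : W ≤ pre f.base φ.U)
    (i : Fin F.rank) (a : X.sec U) (c : PBSec f F U) :
    pbCoef φ hU hφ i (a • c) = X.res hU a * pbCoef φ hU hφ i c := by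
  change X.res _ (X.res _ a * c.1 φ i) = X.res _ a * X.res _ (c.1 φ i)
  rw [map_mul, X.res_res]

/-- Restriction of sections of the pullback. -/
def pbRes {U V : Opens M} (h : U ≤ V) : PBSec f F V →+ PBSec f F U where
  toFun c := ⟨fun φ i => pbCoef φ (inf_le_left.trans h) inf_le_right i c, fun φ ψ j => by
    simp only [res_pbCoef]
    exact pbCoef_trans φ ψ _ _ _ inf_le_right j c⟩
  map_zero' := Subtype.ext <| funext fun φ => funext fun i => map_zero (pbCoef φ _ _ i)
  map_add' a b := Subtype.ext <| funext fun φ => funext fun i => map_add (pbCoef φ _ _ i) a b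

variable {f F} in
theorem pbCoef_res {U V W : Opens M} (h : U ≤ V) (φ : F.Frame) (hU : W ≤ U)
    (hφ : W ≤ pre f.base φ.U) (i : Fin F.rank) (c : PBSec f F V) :
    pbCoef φ hU hφ i (pbRes f F h c) = pbCoef φ (hU.trans h) hφ i c :=
  res_pbCoef φ _ _ _ i c

/-- The homogeneous sections of degree `k` of the pullback: the `i`-th coefficient with respect to
a frame with degrees `d₁, …, dᵣ` has degree `k - dᵢ`. -/
def pbGr (k : ℤ) (U : Opens M) : AddSubgroup (PBSec f F U) where
  carrier := {c | ∀ (φ : F.Frame) (i : Fin F.rank),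
    pbCoef φ inf_le_left (inf_le_right : U ⊓ pre f.base φ.U ≤ _) i c ∈ X.gr (k - F.deg i) _}
  zero_mem' φ i := by rw [map_zero]; exact Submodule.zero_mem _
  add_mem' {a b} ha hb φ i := by rw [map_add]; exact Submodule.add_mem _ (ha φ i) (hb φ i)
  neg_mem' {a} ha φ i := by rw [map_neg]; exact Submodule.neg_mem _ (ha φ i)

variable {f F} in
theorem pbCoef_mem_gr {k : ℤ} {U W : Opens M} {c : PBSec f F U} (hc : c ∈ pbGr f F k U)
    (φ : F.Frame) (hU : W ≤ U) (hφ : W ≤ pre f.base φ.U) (i : Fin F.rank) :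
    pbCoef φ hU hφ i c ∈ X.gr (k - F.deg i) W := by
  have := X.res_mem_gr (le_inf hU hφ) (hc φ i)
  rwa [res_pbCoef] at this

/-- The pullback `f^*F` as a sheaf of graded modules. -/
def pbSheaf : GradedModuleSheaf X.toGradedAlgebraSheaf where
  sec U := PBSec f F U
  res h := pbRes f F h
  res_refl c := pbCoef_ext fun φ i => pbCoef_res _ _ _ _ _ _
  res_res h h' c := pbCoef_ext fun φ i => by
    rw [pbCoef_res, pbCoef_res, pbCoef_res]
  res_smul h a c := pbCoef_ext fun φ i => by
    rw [pbCoef_res, pbCoef_smul, pbCoef_smul, pbCoef_res, X.res_res]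
  eq_of_locally {U} s t H := pbCoef_ext fun φ i => by
    refine X.eq_of_locally _ _ fun x hx => ?_
    obtain ⟨W, h, hxW, hst⟩ := H x hx.1
    refine ⟨W ⊓ pre f.base φ.U, inf_le_inf_right _ h, ⟨hxW, hx.2⟩, ?_⟩
    have := congrArg (pbCoef φ inf_le_left (inf_le_right : W ⊓ pre f.base φ.U ≤ _) i) hst
    rw [pbCoef_res, pbCoef_res] at this
    rw [res_pbCoef, res_pbCoef]
    exact this
  glue {ι} W s hs := by
    have hU : ∀ φ : F.Frame, (⨆ i, W i) ⊓ pre f.base φ.U ≤ ⨆ i, W i ⊓ pre f.base φ.U :=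
      fun φ x hx => by
        obtain ⟨i, hi⟩ := Opens.mem_iSup.1 hx.1
        exact Opens.mem_iSup.2 ⟨i, hi, hx.2⟩
    have key : ∀ (φ : F.Frame) (k : Fin F.rank),
        ∃ b : X.sec ((⨆ i, W i) ⊓ pre f.base φ.U), ∀ i,
          X.res (inf_le_inf_right _ (le_iSup W i)) b =
            pbCoef φ inf_le_left (inf_le_right : W i ⊓ pre f.base φ.U ≤ _) k (s i) := by
      intro φ k
      refine X.exists_glue (fun i => W i ⊓ pre f.base φ.U) _ (hU φ) _ fun i j => ?_
      rw [res_pbCoef, res_pbCoef]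
      have := congrArg (pbCoef φ
        (le_inf (inf_le_left.trans inf_le_left) (inf_le_right.trans inf_le_left) :
          (W i ⊓ pre f.base φ.U) ⊓ (W j ⊓ pre f.base φ.U) ≤ W i ⊓ W j)
        (inf_le_left.trans inf_le_right) k) (hs i j)
      rwa [pbCoef_res, pbCoef_res] at this
    choose b hb using key
    have hb' : ∀ (φ : F.Frame) (k : Fin F.rank) (i : ι) (W' : Opens M) (h : W' ≤ W i)
        (h' : W' ≤ pre f.base φ.U), X.res (le_inf (h.trans (le_iSup W i)) h') (b φ k) =
          pbCoef φ h h' k (s i) := by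
      intro φ k i W' h h'
      have := congrArg (X.res (le_inf h h')) (hb φ k i)
      rwa [X.res_res, res_pbCoef] at this
    refine ⟨⟨b, fun φ ψ j => ?_⟩, fun i => pbCoef_ext fun φ k => ?_⟩
    · refine X.eq_of_locally _ _ fun x hx => ?_
      obtain ⟨i, hi⟩ := Opens.mem_iSup.1 hx.1
      refine ⟨W i ⊓ pre f.base (φ.U ⊓ ψ.U), inf_le_inf_right _ (le_iSup W i), ⟨hi, hx.2⟩, ?_⟩
      rw [X.res_res, hb' ψ j i _ inf_le_left (inf_le_right.trans (pre_mono _ inf_le_right)),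
        map_sum, pbCoef_trans φ ψ inf_le_left (inf_le_right.trans (pre_mono _ inf_le_left))
          (inf_le_right.trans (pre_mono _ inf_le_right)) inf_le_right]
      refine Finset.sum_congr rfl fun k _ => ?_
      rw [map_mul, X.res_res, hb' φ k i _ inf_le_left
        (inf_le_right.trans (pre_mono _ inf_le_left)), f.res_pullTo]
    · exact (pbCoef_res (le_iSup W i) φ _ _ k _).trans (hb' φ k i _ inf_le_left inf_le_right)
  gr k U := pbGr f F k U
  smul_mem_gr {i j U a s} ha hs φ k := by
    rw [pbCoef_smul, add_sub_assoc]
    exact X.mul_mem_gr (X.res_mem_gr _ ha) (hs φ k)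
  res_mem_gr {k U V} h {s} hs φ i := by
    rw [pbCoef_res]
    exact pbCoef_mem_gr hs φ _ _ i
  gr_of_locally {k U} s H φ i := by
    refine X.gr_of_locally _ fun x hx => ?_
    obtain ⟨W, h, hxW, hs⟩ := H x hx.1
    refine ⟨W ⊓ pre f.base φ.U, inf_le_inf_right _ h, ⟨hxW, hx.2⟩, ?_⟩
    have := pbCoef_mem_gr hs φ inf_le_left (inf_le_right : W ⊓ pre f.base φ.U ≤ _) i
    rw [pbCoef_res] at this
    rwa [res_pbCoef]

/-- The sections `f^*φᵢ` of the pullback, for a local frame `φ`. -/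
def pbFrameSec (φ : F.Frame) (i : Fin F.rank) : PBSec f F (pre f.base φ.U) :=
  ⟨fun ψ j => f.pullTo (V := φ.U ⊓ ψ.U) (fun _ hx => hx) (φ.trans ψ i j), fun ψ χ k => by
    have h3 : pre f.base φ.U ⊓ pre f.base (ψ.U ⊓ χ.U) ≤ pre f.base (φ.U ⊓ ψ.U ⊓ χ.U) :=
      fun x hx => ⟨⟨hx.1, hx.2.1⟩, hx.2.2⟩
    have := congrArg (f.pullTo h3) (φ.trans_trans ψ χ inf_le_left
      (le_inf (inf_le_left.trans inf_le_right) inf_le_right)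
      (le_inf (inf_le_left.trans inf_le_left) inf_le_right) i k)
    simp only [map_sum, map_mul, f.pullTo_res] at this
    exact (f.res_pullTo _ _ _).trans (this.trans (Finset.sum_congr rfl fun j _ =>
      congrArg (· * _) (f.res_pullTo _ _ _).symm))⟩

variable {f F} in
theorem pbCoef_frameSec {W : Opens M} (φ ψ : F.Frame) (hφ : W ≤ pre f.base φ.U)
    (hψ : W ≤ pre f.base ψ.U) (h : W ≤ pre f.base (φ.U ⊓ ψ.U)) (i j : Fin F.rank) :
    pbCoef ψ hφ hψ j (pbFrameSec f F φ i) = f.pullTo h (φ.trans ψ i j) :=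
  f.res_pullTo _ _ _

variable {f F} in
theorem pbCoef_sum {W W' : Opens M} (φ ψ : F.Frame) (hW : W ≤ pre f.base φ.U) (h' : W' ≤ W)
    (hψ : W' ≤ pre f.base ψ.U) (h : W' ≤ pre f.base (φ.U ⊓ ψ.U)) (c : Fin F.rank → X.sec W)
    (j : Fin F.rank) :
    pbCoef ψ h' hψ j (∑ i, c i • pbRes f F hW (pbFrameSec f F φ i)) =
      ∑ i, X.res h' (c i) * f.pullTo h (φ.trans ψ i j) := by
  rw [map_sum]
  exact Finset.sum_congr rfl fun i _ => by
    rw [pbCoef_smul, pbCoef_res, pbCoef_frameSec]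

variable {f F} in
theorem pbCoef_sum_self {W : Opens M} (φ : F.Frame) (hW : W ≤ pre f.base φ.U)
    (c : Fin F.rank → X.sec W) (j : Fin F.rank) :
    pbCoef φ le_rfl hW j (∑ i, c i • pbRes f F hW (pbFrameSec f F φ i)) = c j := by
  rw [pbCoef_sum φ φ hW le_rfl hW (fun x hx => ⟨hW hx, hW hx⟩), Finset.sum_eq_single j]
  · rw [φ.trans_self, if_pos rfl, map_one, mul_one, X.res_refl]
  · intro i _ hij
    rw [φ.trans_self, if_neg hij, map_zero, mul_zero]
  · exact fun h => absurd (Finset.mem_univ j) h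

/-- The local frame of `f^*F` induced by a local frame of `F`. -/
def pbFrame (φ : F.Frame) : LocalFrame (pbSheaf f F) F.deg where
  U := pre f.base φ.U
  e := pbFrameSec f F φ
  existsUnique {W} hW s := by
    refine ⟨fun i => pbCoef φ le_rfl hW i s, pbCoef_ext fun ψ j => ?_, fun c hc => funext fun j => ?_⟩
    · have hle : W ⊓ pre f.base ψ.U ≤ pre f.base (φ.U ⊓ ψ.U) := fun x hx => ⟨hW hx.1, hx.2⟩
      refine Eq.trans ?_ (pbCoef_sum φ ψ hW inf_le_left inf_le_right hle _ j).symm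
      refine (pbCoef_trans φ ψ inf_le_left (inf_le_left.trans hW) inf_le_right hle j s).trans ?_
      exact Finset.sum_congr rfl fun i _ => congrArg (· * _) (res_pbCoef φ _ _ _ i s).symm
    · have := congrArg (pbCoef φ le_rfl hW j) hc
      exact ((this.trans (pbCoef_sum_self φ hW c j))).symm
  mem_gr_iff {W} hW k c := by
    refine ⟨fun h j => ?_, fun h ψ j => ?_⟩
    · have := pbCoef_mem_gr h φ le_rfl hW j
      have h2 := pbCoef_sum_self φ hW c j
      exact h2 ▸ this
    · have hle : W ⊓ pre f.base ψ.U ≤ pre f.base (φ.U ⊓ ψ.U) := fun x hx => ⟨hW hx.1, hx.2⟩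
      have h2 := pbCoef_sum φ ψ hW inf_le_left inf_le_right hle c j
      refine h2.symm ▸ Submodule.sum_mem _ fun i _ => ?_
      have h3 := X.mul_mem_gr (X.res_mem_gr (inf_le_left : W ⊓ pre f.base ψ.U ≤ W) (h i))
        (f.pullTo_mem_gr hle (φ.trans_mem_gr ψ i j))
      rwa [sub_add_sub_cancel] at h3

/-- The pullback `f^*F` of a graded vector bundle along a morphism of graded manifolds. -/
def pullback : GradedVectorBundle X where
  toGradedModuleSheaf := pbSheaf f F
  rank := F.rank
  deg := F.deg
  exists_frame x := by
    obtain ⟨φ, hφ⟩ := F.exists_frame (f.base x)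
    exact ⟨pbFrame f F φ, hφ⟩

end Pullback

/-- Sections of a bundle over an ordinary manifold form a module over the smooth functions. -/
instance (F : GradedVectorBundle (ofManifold I M)) (U : Opens M) :
    Module (Smooth I U) (F.sec U) :=
  inferInstanceAs (Module ((ofManifold I M).sec U) (F.sec U))

end GradedManifold

end GradedGeometry

end

/-!
**Homotopy invariance.** In arbitrary amplitude there may be coordinates of degree zero and of both
signs, and no parallel transport is used. The argument is the one from topology, with local frames
instead of bundle charts. A smooth function `ψ : M → [0,1]` has a graph, a morphism
`X → X × [0,1]` (`graphHom`), along which `f^*F` can be pulled back; the constant functions `0` and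
`1` give the two bundles to be compared. If two functions differ only inside an open set which both
graphs map to the domain of a single frame of `F`, then matching this frame with itself over that
set, and all frames with themselves where the functions agree, is compatible on overlaps and gives
an isomorphism (`exists_iso_of_frame`). It is the identity wherever the two functions agree, so that
infinitely many such isomorphisms can be composed as soon as they are locally finite
(`exists_iso_limit`). Partial sums of a partition of unity then reduce the comparison of two
functions to functions that differ in a small open set only (`GraphIso.of_local`). The compactness
of `[0,1]` provides, near each point of `M`, a mesh such that all short enough steps stay in the
domain of one frame (`exists_uniform_frames`), and finitely many steps lead from `0` to `1`.

**Bundles in positive amplitude.** Coordinate functions have negative degrees, hence `S(V^∨)`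
vanishes in positive degrees and consists of constants in degree zero. Thus setting the coordinates
to zero is independent of the trivialisation and defines an inclusion `zeroHom` of the base; the
bundle `F₀` is the restriction of `F` along it. Let `g_{φψ}` be the transition matrices of `F`, and
`G_{φψ}` those of `F₀`, which are the degree zero parts. With a partition of unity `ρ`, the matrices
`K_φ = ∑ₐ ρₐ G_{φa} g_{aφ}` satisfy `K_φ g_{φψ} = G_{φψ} K_ψ` by the cocycle identities, and their
degree zero part is the identity. Hence `1 - K_φ` is strictly triangular with respect to the degrees
of the frame, thus nilpotent, and `K_φ` is invertible (`exists_inverse_of_unipotent`). In the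
frames changed by `K_φ` the bundle `F` has the transition matrices `G_{φψ}` of `π^*F₀`
(`exists_adaptedFrames`).

**Global sections.** An ordinary graded vector bundle `F₀` on a possibly non-compact base has
finitely many homogeneous global sections `s_j` and homogeneous dual forms `T_j` with
`u = ∑ j, T_j(u) s_j` (`SmoothCocycle.exists_dualBasis`). The number of sections which are needed
over a compact set is bounded by the dimension, by a count of dimensions as in Whitney's embedding
theorem, and three such families suffice for all the annuli of a compact exhaustion. Both `s_j` and
`T_j` extend to `π^*F₀`, so that `t ↦ ∑ j, T_j(t) ⊗ s_j` is an inverse of the canonical map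
`C^∞(X) ⊗ Γ(F₀) → Γ(π^*F₀)` (`exists_tensorEquiv`), and it preserves degrees.
-/

namespace GradedGeometry

/-! ### Gluing isomorphisms from local frames -/

section Glue

variable {E : Type*} [NormedAddCommGroup E] [NormedSpace ℝ E] {H : Type*} [TopologicalSpace H]
  {I : ModelWithCorners ℝ E H} {M : Type u} [TopologicalSpace M] [ChartedSpace H M]

theorem GradedModuleSheaf.exists_glue {A : GradedAlgebraSheaf I M} (F : GradedModuleSheaf A)
    {ι : Type u} {U : Opens M}
    (W : ι → Opens M) (hW : ∀ i, W i ≤ U) (hU : U ≤ ⨆ i, W i) (s : ∀ i, F.sec (W i))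
    (hs : ∀ i j, F.res (inf_le_left : W i ⊓ W j ≤ W i) (s i) =
      F.res (inf_le_right : W i ⊓ W j ≤ W j) (s j)) :
    ∃ t : F.sec U, ∀ i, F.res (hW i) t = s i := by
  obtain ⟨t, ht⟩ := F.glue W s hs
  exact ⟨F.res hU t, fun i => by rw [F.res_res, ← ht i]⟩

namespace LocalFrame

variable {A : GradedAlgebraSheaf I M} {F G : GradedModuleSheaf A} {r : ℕ} {d : Fin r → ℤ}

/-- The section over `W` with the given coefficients in a frame. -/
noncomputable def lin (φ : LocalFrame F d) {W : Opens M} (h : W ≤ φ.U) (c : Fin r → A.sec W) :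
    F.sec W :=
  ∑ i, c i • F.res h (φ.e i)

theorem lin_coord (φ : LocalFrame F d) {W : Opens M} (h : W ≤ φ.U) (s : F.sec W) :
    φ.lin h (φ.coord h s) = s := (φ.coord_spec h s).symm

theorem coord_lin (φ : LocalFrame F d) {W : Opens M} (h : W ≤ φ.U) (c : Fin r → A.sec W) :
    φ.coord h (φ.lin h c) = c := φ.coord_unique h rfl

theorem lin_injective (φ : LocalFrame F d) {W : Opens M} (h : W ≤ φ.U) :
    Function.Injective (φ.lin h) := fun c c' hc => by
  rw [← φ.coord_lin h c, hc, φ.coord_lin]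

theorem res_lin (φ : LocalFrame F d) {W W' : Opens M} (h : W ≤ φ.U) (h' : W' ≤ W)
    (c : Fin r → A.sec W) :
    F.res h' (φ.lin h c) = φ.lin (h'.trans h) fun i => A.res h' (c i) := by
  rw [lin, lin, map_sum]
  exact Finset.sum_congr rfl fun i _ => by rw [F.res_smul, F.res_res]

theorem lin_add (φ : LocalFrame F d) {W : Opens M} (h : W ≤ φ.U) (c c' : Fin r → A.sec W) :
    φ.lin h (c + c') = φ.lin h c + φ.lin h c' := by
  simp only [lin, Pi.add_apply, add_smul, Finset.sum_add_distrib]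

theorem lin_smul (φ : LocalFrame F d) {W : Opens M} (h : W ≤ φ.U) (a : A.sec W)
    (c : Fin r → A.sec W) : φ.lin h (a • c) = a • φ.lin h c := by
  simp only [lin, Pi.smul_apply, smul_eq_mul, mul_smul, Finset.smul_sum]

theorem coord_add (φ : LocalFrame F d) {W : Opens M} (h : W ≤ φ.U) (s t : F.sec W) :
    φ.coord h (s + t) = φ.coord h s + φ.coord h t :=
  φ.lin_injective h (by rw [lin_add, lin_coord, lin_coord, lin_coord])

theorem coord_smul (φ : LocalFrame F d) {W : Opens M} (h : W ≤ φ.U) (a : A.sec W) (s : F.sec W) :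
    φ.coord h (a • s) = a • φ.coord h s :=
  φ.lin_injective h (by rw [lin_smul, lin_coord, lin_coord])

theorem mem_gr_iff_coord (φ : LocalFrame F d) {W : Opens M} (h : W ≤ φ.U) (k : ℤ) (s : F.sec W) :
    s ∈ F.gr k W ↔ ∀ i, φ.coord h s i ∈ A.gr (k - d i) W := by
  rw [← φ.mem_gr_iff h k (φ.coord h s), ← φ.coord_spec h s]

/-- Change of frame, in terms of the coefficients of a section. -/
theorem lin_eq_lin_iff (φ ψ : LocalFrame F d) {W : Opens M} (h : W ≤ φ.U ⊓ ψ.U)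
    (c c' : Fin r → A.sec W) :
    φ.lin (h.trans inf_le_left) c = ψ.lin (h.trans inf_le_right) c' ↔
      ∀ j, c' j = ∑ i, c i * A.res h (φ.trans ψ i j) := by
  have key : φ.lin (h.trans inf_le_left) c = ψ.lin (h.trans inf_le_right)
      fun j => ∑ i, c i * A.res h (φ.trans ψ i j) := by
    simp only [lin, Finset.sum_smul]
    rw [Finset.sum_comm]
    refine Finset.sum_congr rfl fun i _ => ?_
    rw [φ.res_e_eq ψ h i, Finset.smul_sum]
    exact Finset.sum_congr rfl fun j _ => by rw [mul_smul]
  rw [key, (ψ.lin_injective _).eq_iff, funext_iff]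
  exact forall_congr' fun j => eq_comm

end LocalFrame

/-- The relation between sections of two sheaves with matched local frames which expresses that the
sections have the same coefficients in all of the matched frames. -/
def SameCoeffs {A : GradedAlgebraSheaf I M} {F G : GradedModuleSheaf A} {r : ℕ} {d : Fin r → ℤ}
    {ι : Type u} (φ : ι → LocalFrame F d) (ψ : ι → LocalFrame G d) (U : ι → Opens M)
    (hφ : ∀ a, U a ≤ (φ a).U) (hψ : ∀ a, U a ≤ (ψ a).U) {W : Opens M}
    (s : F.sec W) (t : G.sec W) : Prop :=
  ∀ (a : ι) (W' : Opens M) (hW : W' ≤ W) (h : W' ≤ U a) (c : Fin r → A.sec W'),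
    F.res hW s = (φ a).lin (h.trans (hφ a)) c ↔ G.res hW t = (ψ a).lin (h.trans (hψ a)) c

section SameCoeffs

variable {A : GradedAlgebraSheaf I M} {F G : GradedModuleSheaf A} {r : ℕ} {d : Fin r → ℤ}
    {ι : Type u} {φ : ι → LocalFrame F d} {ψ : ι → LocalFrame G d} {U : ι → Opens M}
    {hφ : ∀ a, U a ≤ (φ a).U} {hψ : ∀ a, U a ≤ (ψ a).U}

theorem SameCoeffs.symm {W : Opens M} {s : F.sec W} {t : G.sec W}
    (h : SameCoeffs φ ψ U hφ hψ s t) : SameCoeffs ψ φ U hψ hφ t s :=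
  fun a W' hW hU c => (h a W' hW hU c).symm

theorem SameCoeffs.lin_coord {W W' : Opens M} {s : F.sec W} {t : G.sec W}
    (h : SameCoeffs φ ψ U hφ hψ s t) (a : ι) (hW : W' ≤ W) (hU : W' ≤ U a) :
    G.res hW t = (ψ a).lin (hU.trans (hψ a)) ((φ a).coord (hU.trans (hφ a)) (F.res hW s)) :=
  (h a W' hW hU _).1 ((φ a).lin_coord _ _).symm

theorem SameCoeffs.eq (hU : ∀ x, ∃ a, x ∈ U a) {W : Opens M} {s : F.sec W} {t t' : G.sec W}
    (h : SameCoeffs φ ψ U hφ hψ s t) (h' : SameCoeffs φ ψ U hφ hψ s t') : t = t' := by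
  refine G.eq_of_locally _ _ fun x hx => ?_
  obtain ⟨a, ha⟩ := hU x
  refine ⟨W ⊓ U a, inf_le_left, ⟨hx, ha⟩, ?_⟩
  rw [h.lin_coord a inf_le_left inf_le_right, h'.lin_coord a inf_le_left inf_le_right]

/-- To check that two sections have the same coefficients, one frame around each point is enough,
because the matched frames satisfy the same relations. -/
theorem SameCoeffs.of_locally
    (hab : ∀ (a b : ι) (W : Opens M) (ha : W ≤ U a) (hb : W ≤ U b) (c c' : Fin r → A.sec W),
      (φ a).lin (ha.trans (hφ a)) c = (φ b).lin (hb.trans (hφ b)) c' ↔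
        (ψ a).lin (ha.trans (hψ a)) c = (ψ b).lin (hb.trans (hψ b)) c')
    {W : Opens M} {s : F.sec W} {t : G.sec W}
    (h : ∀ x ∈ W, ∃ (a : ι) (W' : Opens M) (hW : W' ≤ W) (hU : W' ≤ U a)
      (c : Fin r → A.sec W'), x ∈ W' ∧ F.res hW s = (φ a).lin (hU.trans (hφ a)) c ∧
        G.res hW t = (ψ a).lin (hU.trans (hψ a)) c) : SameCoeffs φ ψ U hφ hψ s t := by
  intro b W' hW hUb c'
  constructor
  · intro hs
    refine G.eq_of_locally _ _ fun x hx => ?_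
    obtain ⟨a, W₁, hW₁, hUa, c, hx₁, h1, h2⟩ := h x (hW hx)
    refine ⟨W' ⊓ W₁, inf_le_left, ⟨hx, hx₁⟩, ?_⟩
    have e1 := congrArg (F.res (inf_le_left : W' ⊓ W₁ ≤ W')) hs
    have e2 := congrArg (F.res (inf_le_right : W' ⊓ W₁ ≤ W₁)) h1
    have e3 := congrArg (G.res (inf_le_right : W' ⊓ W₁ ≤ W₁)) h2
    rw [F.res_res, LocalFrame.res_lin] at e1 e2
    rw [G.res_res, LocalFrame.res_lin] at e3
    rw [G.res_res, LocalFrame.res_lin, e3]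
    exact (hab a b (W' ⊓ W₁) (inf_le_right.trans hUa) (inf_le_left.trans hUb) _ _).1
      (e2.symm.trans e1)
  · intro hs
    refine F.eq_of_locally _ _ fun x hx => ?_
    obtain ⟨a, W₁, hW₁, hUa, c, hx₁, h1, h2⟩ := h x (hW hx)
    refine ⟨W' ⊓ W₁, inf_le_left, ⟨hx, hx₁⟩, ?_⟩
    have e1 := congrArg (G.res (inf_le_left : W' ⊓ W₁ ≤ W')) hs
    have e2 := congrArg (F.res (inf_le_right : W' ⊓ W₁ ≤ W₁)) h1
    have e3 := congrArg (G.res (inf_le_right : W' ⊓ W₁ ≤ W₁)) h2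
    rw [G.res_res, LocalFrame.res_lin] at e1 e3
    rw [F.res_res, LocalFrame.res_lin] at e2
    rw [F.res_res, LocalFrame.res_lin, e2]
    exact (hab a b (W' ⊓ W₁) (inf_le_right.trans hUa) (inf_le_left.trans hUb) _ _).2
      (e3.symm.trans e1)

/-- The local sections of `G` with the coefficients of `s` glue, because the matched frames satisfy
the same relations. -/
theorem exists_sameCoeffs (hU : ∀ x, ∃ a, x ∈ U a)
    (hab : ∀ (a b : ι) (W : Opens M) (ha : W ≤ U a) (hb : W ≤ U b) (c c' : Fin r → A.sec W),
      (φ a).lin (ha.trans (hφ a)) c = (φ b).lin (hb.trans (hφ b)) c' ↔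
        (ψ a).lin (ha.trans (hψ a)) c = (ψ b).lin (hb.trans (hψ b)) c')
    {W : Opens M} (s : F.sec W) : ∃ t : G.sec W, SameCoeffs φ ψ U hφ hψ s t := by
  obtain ⟨t, ht⟩ := G.exists_glue (fun a => W ⊓ U a) (fun a => inf_le_left)
    (fun x hx => by
      obtain ⟨a, ha⟩ := hU x
      exact Opens.mem_iSup.2 ⟨a, hx, ha⟩)
    (fun a => (ψ a).lin (inf_le_right.trans (hψ a))
      ((φ a).coord (inf_le_right.trans (hφ a)) (F.res (inf_le_left : W ⊓ U a ≤ W) s)))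
    (fun a b => by
      rw [LocalFrame.res_lin, LocalFrame.res_lin]
      refine (hab a b _ (inf_le_left.trans inf_le_right) (inf_le_right.trans inf_le_right) _ _).1 ?_
      rw [← LocalFrame.res_lin _ (inf_le_right.trans (hφ a)),
        ← LocalFrame.res_lin _ (inf_le_right.trans (hφ b)), LocalFrame.lin_coord,
        LocalFrame.lin_coord, F.res_res, F.res_res])
  refine ⟨t, SameCoeffs.of_locally hab fun x hx => ?_⟩
  obtain ⟨a, ha⟩ := hU x
  exact ⟨a, W ⊓ U a, inf_le_left, inf_le_right, _, ⟨hx, ha⟩, ((φ a).lin_coord _ _).symm, ht a⟩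

end SameCoeffs

/-- Two graded vector bundles are isomorphic if they have local frames, over the same open cover,
which satisfy the same relations on overlaps. -/
theorem GradedVectorBundle.exists_iso {X : GradedManifold I M} {F G : GradedVectorBundle X} {r : ℕ}
    {d : Fin r → ℤ} {ι : Type u} (φ : ι → LocalFrame F.toGradedModuleSheaf d)
    (ψ : ι → LocalFrame G.toGradedModuleSheaf d) (U : ι → Opens M)
    (hφ : ∀ a, U a ≤ (φ a).U) (hψ : ∀ a, U a ≤ (ψ a).U) (hU : ∀ x, ∃ a, x ∈ U a)
    (hab : ∀ (a b : ι) (W : Opens M) (ha : W ≤ U a) (hb : W ≤ U b) (c c' : Fin r → X.sec W),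
      (φ a).lin (ha.trans (hφ a)) c = (φ b).lin (hb.trans (hφ b)) c' ↔
        (ψ a).lin (ha.trans (hψ a)) c = (ψ b).lin (hb.trans (hψ b)) c') :
    ∃ T : GradedVectorBundle.Iso F G, ∀ (a : ι) (W : Opens M) (h : W ≤ U a)
      (c : Fin r → X.sec W),
      T.equiv W ((φ a).lin (h.trans (hφ a)) c) = (ψ a).lin (h.trans (hψ a)) c := by
  have hba : ∀ (a b : ι) (W : Opens M) (ha : W ≤ U a) (hb : W ≤ U b) (c c' : Fin r → X.sec W),
      (ψ a).lin (ha.trans (hψ a)) c = (ψ b).lin (hb.trans (hψ b)) c' ↔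
        (φ a).lin (ha.trans (hφ a)) c = (φ b).lin (hb.trans (hφ b)) c' :=
    fun a b W ha hb c c' => (hab a b W ha hb c c').symm
  choose T hT using fun (W : Opens M) (s : F.sec W) =>
    exists_sameCoeffs (hφ := hφ) (hψ := hψ) hU hab s
  choose S hS using fun (W : Opens M) (t : G.sec W) =>
    exists_sameCoeffs (hφ := hψ) (hψ := hφ) hU hba t
  have hT' : ∀ {W : Opens M} {s : F.sec W} {t : G.sec W}, SameCoeffs φ ψ U hφ hψ s t → T W s = t :=
    fun h => (hT _ _).eq hU h
  have hgr : ∀ (k : ℤ) {W : Opens M} (s : F.sec W), T W s ∈ G.gr k W ↔ s ∈ F.gr k W := by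
    intro k W s
    have aux : ∀ a, (F.res (inf_le_left : W ⊓ U a ≤ W) s ∈ F.gr k (W ⊓ U a) ↔
        G.res (inf_le_left : W ⊓ U a ≤ W) (T W s) ∈ G.gr k (W ⊓ U a)) := fun a => by
      rw [(hT W s).lin_coord a inf_le_left inf_le_right,
        (φ a).mem_gr_iff_coord (inf_le_right.trans (hφ a)),
        (ψ a).mem_gr_iff_coord (inf_le_right.trans (hψ a)), LocalFrame.coord_lin]
    constructor
    · refine fun h => F.gr_of_locally _ fun x hx => ?_
      obtain ⟨a, ha⟩ := hU x
      exact ⟨W ⊓ U a, inf_le_left, ⟨hx, ha⟩, (aux a).2 (G.res_mem_gr _ h)⟩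
    · refine fun h => G.gr_of_locally _ fun x hx => ?_
      obtain ⟨a, ha⟩ := hU x
      exact ⟨W ⊓ U a, inf_le_left, ⟨hx, ha⟩, (aux a).1 (F.res_mem_gr _ h)⟩
  refine ⟨{
    equiv := fun W =>
      { toFun := T W
        invFun := S W
        left_inv := fun s => (hS W (T W s)).eq hU (hT W s).symm
        right_inv := fun t => hT' (hS W t).symm
        map_add' := fun s t => hT' <| SameCoeffs.of_locally hab fun x hx => by
          obtain ⟨a, ha⟩ := hU x
          refine ⟨a, W ⊓ U a, inf_le_left, inf_le_right,
            (φ a).coord (inf_le_right.trans (hφ a)) (F.res inf_le_left s) +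
              (φ a).coord (inf_le_right.trans (hφ a)) (F.res inf_le_left t), ⟨hx, ha⟩, ?_, ?_⟩
          · rw [LocalFrame.lin_add, LocalFrame.lin_coord, LocalFrame.lin_coord, map_add]
          · rw [LocalFrame.lin_add, map_add, (hT W s).lin_coord a inf_le_left inf_le_right,
              (hT W t).lin_coord a inf_le_left inf_le_right]
        map_smul' := fun b s => hT' <| SameCoeffs.of_locally hab fun x hx => by
          obtain ⟨a, ha⟩ := hU x
          refine ⟨a, W ⊓ U a, inf_le_left, inf_le_right,
            X.res (inf_le_left : W ⊓ U a ≤ W) b •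
              (φ a).coord (inf_le_right.trans (hφ a)) (F.res inf_le_left s),
            ⟨hx, ha⟩, ?_, ?_⟩
          · rw [LocalFrame.lin_smul, LocalFrame.lin_coord, F.res_smul]
          · rw [LocalFrame.lin_smul, RingHom.id_apply, G.res_smul,
              (hT W s).lin_coord a inf_le_left inf_le_right] }
    equiv_res := fun {W W'} h s => hT' fun a W₁ hW₁ hU c => by
      rw [F.res_res, G.res_res]
      exact hT W' s a W₁ _ hU c
    mem_gr_iff := fun k W s => hgr k s }, fun a W h c => ?_⟩
  exact hT' <| SameCoeffs.of_locally hab fun x hx => ⟨a, W, le_rfl, h, c, hx, by rw [F.res_refl],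
    by rw [G.res_refl]⟩

/-- The composition of isomorphisms of graded vector bundles. -/
noncomputable def GradedVectorBundle.Iso.trans {X : GradedManifold I M}
    {F G K : GradedVectorBundle X} (T : Iso F G) (S : Iso G K) : Iso F K where
  equiv U := (T.equiv U).trans (S.equiv U)
  equiv_res h s := by
    rw [LinearEquiv.trans_apply, T.equiv_res, S.equiv_res]; rfl
  mem_gr_iff k U s := by rw [LinearEquiv.trans_apply, S.mem_gr_iff, T.mem_gr_iff]

theorem GradedVectorBundle.Iso.equiv_lin {X : GradedManifold I M} {F G : GradedVectorBundle X}
    (T : Iso F G) {r : ℕ} {d : Fin r → ℤ} (φ : LocalFrame F.toGradedModuleSheaf d) {W : Opens M}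
    (h : W ≤ φ.U) (c : Fin r → X.sec W) :
    T.equiv W (φ.lin h c) = ∑ i, c i • G.res h (T.equiv φ.U (φ.e i)) := by
  rw [LocalFrame.lin, map_sum]
  exact Finset.sum_congr rfl fun i _ => by rw [map_smul, T.equiv_res]

/-- The image of a local frame under an isomorphism. -/
noncomputable def LocalFrame.map {X : GradedManifold I M} {F G : GradedVectorBundle X}
    {r : ℕ} {d : Fin r → ℤ} (φ : LocalFrame F.toGradedModuleSheaf d)
    (T : GradedVectorBundle.Iso F G) : LocalFrame G.toGradedModuleSheaf d where
  U := φ.U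
  e i := T.equiv φ.U (φ.e i)
  existsUnique {W} h s := by
    simp only [← T.equiv_lin φ h]
    refine ⟨φ.coord h ((T.equiv W).symm s), ?_, fun c hc => ?_⟩
    · change s = T.equiv W (φ.lin h _)
      rw [φ.lin_coord, LinearEquiv.apply_symm_apply]
    · change s = T.equiv W (φ.lin h c) at hc
      rw [hc, LinearEquiv.symm_apply_apply, φ.coord_lin]
  mem_gr_iff {W} h k c := by
    rw [← T.equiv_lin φ h, T.mem_gr_iff]
    exact φ.mem_gr_iff h k c

theorem LocalFrame.map_lin {X : GradedManifold I M} {F G : GradedVectorBundle X}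
    {r : ℕ} {d : Fin r → ℤ} (φ : LocalFrame F.toGradedModuleSheaf d)
    (T : GradedVectorBundle.Iso F G) {W : Opens M} (h : W ≤ φ.U) (c : Fin r → X.sec W) :
    (φ.map T).lin h c = T.equiv W (φ.lin h c) := (T.equiv_lin φ h c).symm

/-- The inverse of an isomorphism of graded vector bundles. -/
noncomputable def GradedVectorBundle.Iso.symm {X : GradedManifold I M}
    {F G : GradedVectorBundle X} (T : Iso F G) : Iso G F where
  equiv U := (T.equiv U).symm
  equiv_res {U V} h s := by
    rw [LinearEquiv.symm_apply_eq, T.equiv_res, LinearEquiv.apply_symm_apply]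
  mem_gr_iff k U s := by rw [← T.mem_gr_iff, LinearEquiv.apply_symm_apply]

end Glue

/-! ### Frames of pullback bundles -/

section Pull

variable {E : Type*} [NormedAddCommGroup E] [NormedSpace ℝ E] {H : Type*} [TopologicalSpace H]
  {I : ModelWithCorners ℝ E H} {M : Type u} [TopologicalSpace M] [ChartedSpace H M]
  {E' : Type*} [NormedAddCommGroup E'] [NormedSpace ℝ E'] {H' : Type*}
  [TopologicalSpace H'] {J : ModelWithCorners ℝ E' H'} {N : Type u} [TopologicalSpace N]
  [ChartedSpace H' N] {X : GradedManifold I M} {Y : GradedManifold J N}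

/-- The section of `f^*F` over `W` with the given coefficients in the frame `f^*φ`. -/
noncomputable def pbLin (f : Hom X Y) (F : GradedVectorBundle Y) (φ : F.Frame) {W : Opens M}
    (h : W ≤ pre f.base φ.U) (c : Fin F.rank → X.sec W) : (pullback f F).sec W :=
  (pbFrame f F φ).lin h c

theorem pbLin_injective (f : Hom X Y) (F : GradedVectorBundle Y) (φ : F.Frame) {W : Opens M}
    (h : W ≤ pre f.base φ.U) : Function.Injective (pbLin f F φ h) :=
  (pbFrame f F φ).lin_injective h

theorem exists_eq_pbLin (f : Hom X Y) (F : GradedVectorBundle Y) (φ : F.Frame) {W : Opens M}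
    (h : W ≤ pre f.base φ.U) (s : (pullback f F).sec W) : ∃ c, s = pbLin f F φ h c :=
  ((pbFrame f F φ).existsUnique h s).exists

theorem pbCoef_pbLin (f : Hom X Y) (F : GradedVectorBundle Y) (φ ψ : F.Frame) {W : Opens M}
    (hφ : W ≤ pre f.base φ.U) (hψ : W ≤ pre f.base ψ.U) (h : W ≤ pre f.base (φ.U ⊓ ψ.U))
    (c : Fin F.rank → X.sec W) (j : Fin F.rank) :
    pbCoef ψ le_rfl hψ j (pbLin f F φ hφ c : PBSec f F W) =
      ∑ i, c i * f.pullTo h (φ.trans ψ i j) :=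
  (pbCoef_sum φ ψ hφ le_rfl hψ h c j).trans
    (Finset.sum_congr rfl fun i _ => by rw [X.res_refl])

theorem pbCoef_pbLin_self (f : Hom X Y) (F : GradedVectorBundle Y) (φ : F.Frame) {W : Opens M}
    (hφ : W ≤ pre f.base φ.U) (c : Fin F.rank → X.sec W) (j : Fin F.rank) :
    pbCoef φ le_rfl hφ j (pbLin f F φ hφ c : PBSec f F W) = c j :=
  pbCoef_sum_self φ hφ c j

/-- Two frames of `f^*F` are related by the pullbacks of the transition functions of `F`. -/
theorem pbLin_eq_iff (f : Hom X Y) (F : GradedVectorBundle Y) (φ ψ : F.Frame) {W : Opens M}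
    (hφ : W ≤ pre f.base φ.U) (hψ : W ≤ pre f.base ψ.U) (h : W ≤ pre f.base (φ.U ⊓ ψ.U))
    (c c' : Fin F.rank → X.sec W) :
    pbLin f F φ hφ c = pbLin f F ψ hψ c' ↔
      ∀ j, c' j = ∑ i, c i * f.pullTo h (φ.trans ψ i j) := by
  constructor
  · intro hc j
    rw [← pbCoef_pbLin f F φ ψ hφ hψ h, hc, pbCoef_pbLin_self]
  · intro hc
    obtain ⟨b, hb⟩ := exists_eq_pbLin f F ψ hψ (pbLin f F φ hφ c)
    rw [hb]
    congr 1
    funext j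
    rw [hc j, ← pbCoef_pbLin f F φ ψ hφ hψ h, hb, pbCoef_pbLin_self]

/-- Two morphisms agree over an open set `W`, on the base and on functions. -/
def Hom.AgreeOn (f g : Hom X Y) (W : Opens M) : Prop :=
  (∀ x ∈ W, f.base x = g.base x) ∧
    ∀ (V : Opens N) (W' : Opens M) (hW : W' ≤ W) (h : W' ≤ pre f.base V) (h' : W' ≤ pre g.base V)
      (b : Y.sec V), f.pullTo h b = g.pullTo h' b

theorem Hom.AgreeOn.le_pre {f g : Hom X Y} {W W' : Opens M} (h : f.AgreeOn g W) (hW : W' ≤ W)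
    {V : Opens N} (hV : W' ≤ pre f.base V) : W' ≤ pre g.base V := fun x hx => by
  have := hV hx
  change f.base x ∈ V at this
  rwa [h.1 x (hW hx)] at this

theorem Hom.AgreeOn.symm {f g : Hom X Y} {W : Opens M} (h : f.AgreeOn g W) : g.AgreeOn f W :=
  ⟨fun x hx => (h.1 x hx).symm, fun V W' hW h1 h2 b => (h.2 V W' hW h2 h1 b).symm⟩

theorem Hom.AgreeOn.pbLin_eq_iff {f g : Hom X Y} {W' W : Opens M} (hfg : f.AgreeOn g W')
    (hW : W ≤ W') (F : GradedVectorBundle Y) (φ ψ : F.Frame)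
    (hφ : W ≤ pre f.base φ.U) (hψ : W ≤ pre f.base ψ.U) (hφ' : W ≤ pre g.base φ.U)
    (hψ' : W ≤ pre g.base ψ.U) (c c' : Fin F.rank → X.sec W) :
    pbLin f F φ hφ c = pbLin f F ψ hψ c' ↔ pbLin g F φ hφ' c = pbLin g F ψ hψ' c' := by
  have h1 : W ≤ pre f.base (φ.U ⊓ ψ.U) := fun x hx => ⟨hφ hx, hψ hx⟩
  have h2 : W ≤ pre g.base (φ.U ⊓ ψ.U) := fun x hx => ⟨hφ' hx, hψ' hx⟩
  rw [GradedGeometry.pbLin_eq_iff f F φ ψ hφ hψ h1, GradedGeometry.pbLin_eq_iff g F φ ψ hφ' hψ' h2]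
  refine forall_congr' fun j => ?_
  simp only [hfg.2 _ W hW h1 h2]

/-- An isomorphism `f^*F ≅ g^*F` is the identity over an open set on which `f` and `g` agree: it
matches the frames induced by the local frames of `F`. -/
def IsIdOn {f g : Hom X Y} {F : GradedVectorBundle Y}
    (T : GradedVectorBundle.Iso (pullback f F) (pullback g F)) (W : Opens M) : Prop :=
  ∀ (φ : F.Frame) (W' : Opens M) (hW : W' ≤ W) (h : W' ≤ pre f.base φ.U)
    (h' : W' ≤ pre g.base φ.U) (c : Fin F.rank → X.sec W'),
    T.equiv W' (pbLin f F φ h c) = pbLin g F φ h' c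

/-- If `f` and `g` agree over an open set `O`, and if both map the open set `U` to the domain of one
frame of `F`, then matching of frames is an isomorphism `f^*F ≅ g^*F`, provided that `O` and `U`
cover `M`. -/
theorem exists_iso_of_frame (f g : Hom X Y) (F : GradedVectorBundle Y) (O U : Opens M)
    (hOU : ∀ x, x ∈ O ∨ x ∈ U) (hO : f.AgreeOn g O) (φ₀ : F.Frame) (hf : U ≤ pre f.base φ₀.U)
    (hg : U ≤ pre g.base φ₀.U) :
    ∃ T : GradedVectorBundle.Iso (pullback f F) (pullback g F),
      ∀ W, f.AgreeOn g W → IsIdOn T W := by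
  -- The matched frames: `none` stands for `φ₀` over `U`, and `some (φ, W)` for an arbitrary frame
  -- `φ` over an open set `W` on which `f` and `g` agree.
  let ι : Type u := Option {p : F.Frame × Opens M // f.AgreeOn g p.2}
  let fr : ι → F.Frame := fun a => a.elim φ₀ fun p => p.1.1
  let V : ι → Opens M := fun a => a.elim U fun p =>
    p.1.2 ⊓ (pre f.base p.1.1.U ⊓ pre g.base p.1.1.U)
  have hVf : ∀ a, V a ≤ pre f.base (fr a).U := by
    rintro (_ | p)
    · exact hf
    · exact inf_le_right.trans inf_le_left
  have hVg : ∀ a, V a ≤ pre g.base (fr a).U := by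
    rintro (_ | p)
    · exact hg
    · exact inf_le_right.trans inf_le_right
  obtain ⟨T, hT⟩ := GradedVectorBundle.exists_iso (F := pullback f F) (G := pullback g F)
    (fun a => pbFrame f F (fr a)) (fun a => pbFrame g F (fr a)) V hVf hVg
    (fun x => by
      rcases hOU x with hx | hx
      · obtain ⟨φ, hφ⟩ := F.exists_frame (f.base x)
        refine ⟨some ⟨(φ, O), hO⟩, hx, hφ, ?_⟩
        change g.base x ∈ φ.U
        rwa [← hO.1 x hx]
      · exact ⟨none, hx⟩)
    (fun a b W ha hb c c' => by
      rcases a with _ | p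
      · rcases b with _ | q
        · exact ((pbLin_injective f F φ₀ (ha.trans hf)).eq_iff).trans
            ((pbLin_injective g F φ₀ (ha.trans hg)).eq_iff).symm
        · exact q.2.pbLin_eq_iff (hb.trans inf_le_left) F _ _ (ha.trans (hVf _))
            (hb.trans (hVf (some q))) (ha.trans (hVg _)) (hb.trans (hVg (some q))) c c'
      · exact p.2.pbLin_eq_iff (ha.trans inf_le_left) F _ _ (ha.trans (hVf (some p)))
          (hb.trans (hVf _)) (ha.trans (hVg (some p))) (hb.trans (hVg _)) c c')
  refine ⟨T, fun W hW φ W' hW' h h' c => ?_⟩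
  exact hT (some ⟨(φ, W), hW⟩) W' (le_inf hW' (le_inf h h')) c

end Pull

/-! ### Infinite composition of isomorphisms of pullbacks -/

section Limit

variable {E : Type*} [NormedAddCommGroup E] [NormedSpace ℝ E] {H : Type*} [TopologicalSpace H]
  {I : ModelWithCorners ℝ E H} {M : Type u} [TopologicalSpace M] [ChartedSpace H M]
  {E' : Type*} [NormedAddCommGroup E'] [NormedSpace ℝ E'] {H' : Type*}
  [TopologicalSpace H'] {J : ModelWithCorners ℝ E' H'} {N : Type u} [TopologicalSpace N]
  [ChartedSpace H' N] {X : GradedManifold I M} {Y : GradedManifold J N}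

/-- The identity isomorphism. -/
noncomputable def GradedVectorBundle.Iso.refl (F : GradedVectorBundle X) : Iso F F where
  equiv U := LinearEquiv.refl _ _
  equiv_res h s := rfl
  mem_gr_iff k U s := Iff.rfl

/-- Over an open set `W`, the isomorphisms `T k : g_k^*F ≅ g_{k+1}^*F` with `k ≥ K` are the
identity, and the `g_k` with `k ≥ K` agree with the limit `g'`. -/
def StationaryOn {g : ℕ → Hom X Y} (g' : Hom X Y) {F : GradedVectorBundle Y}
    (T : ∀ k, GradedVectorBundle.Iso (pullback (g k) F) (pullback (g (k + 1)) F)) (K : ℕ)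
    (W : Opens M) : Prop :=
  ∀ k, K ≤ k → (g k).AgreeOn g' W ∧ IsIdOn (T k) W

/-- If the isomorphisms `g_k^*F ≅ g_{k+1}^*F` are locally the identity for large `k`, then their
infinite composition is an isomorphism from `g_0^*F` to the pullback along the limit. -/
theorem exists_iso_limit {g : ℕ → Hom X Y} (g' : Hom X Y) {F : GradedVectorBundle Y}
    (T : ∀ k, GradedVectorBundle.Iso (pullback (g k) F) (pullback (g (k + 1)) F))
    (hT : ∀ x, ∃ (W : Opens M) (K : ℕ), x ∈ W ∧ StationaryOn g' T K W) :
    ∃ T' : GradedVectorBundle.Iso (pullback (g 0) F) (pullback g' F),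
      ∀ W, StationaryOn g' T 0 W → IsIdOn T' W := by
  let S : ∀ k, GradedVectorBundle.Iso (pullback (g 0) F) (pullback (g k) F) := fun k =>
    Nat.rec (GradedVectorBundle.Iso.refl _) (fun k S => S.trans (T k)) k
  have hS : ∀ k U (s : (pullback (g 0) F).sec U),
      (S (k + 1)).equiv U s = (T k).equiv U ((S k).equiv U s) := fun _ _ _ => rfl
  -- The frame `φ` over a set on which everything is stationary from `K` on: on the limit it is the
  -- frame `φ` of `g'^*F`, on `g_0^*F` the one which `S K` takes to the frame `φ` of `g_K^*F`.
  let ι : Type u := {p : F.Frame × Opens M × ULift.{u} ℕ // StationaryOn g' T p.2.2.down p.2.1}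
  let K : ι → ℕ := fun a => a.1.2.2.down
  let V : ι → Opens M := fun a => a.1.2.1 ⊓ pre g'.base a.1.1.U
  have hV' : ∀ a : ι, V a ≤ pre g'.base a.1.1.U := fun a => inf_le_right
  have hV : ∀ (a : ι) (k : ℕ), K a ≤ k → V a ≤ pre (g k).base a.1.1.U := fun a k hk =>
    (a.2 k hk).1.symm.le_pre inf_le_left (hV' a)
  have key : ∀ (a : ι) (k : ℕ) (hk : K a ≤ k) (W : Opens M) (hW : W ≤ V a)
      (c : Fin F.rank → X.sec W),
      (S k).equiv W ((S (K a)).symm.equiv W (pbLin (g (K a)) F a.1.1 (hW.trans (hV a _ le_rfl)) c))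
        = pbLin (g k) F a.1.1 (hW.trans (hV a k hk)) c := by
    intro a k hk W hW c
    induction k, hk using Nat.le_induction with
    | base => exact LinearEquiv.apply_symm_apply _ _
    | succ k hk ih =>
      rw [hS, ih]
      exact (a.2 k hk).2 _ W (hW.trans inf_le_left) _ _ c
  obtain ⟨T', hT'⟩ := GradedVectorBundle.exists_iso (F := pullback (g 0) F) (G := pullback g' F)
    (fun a : ι => LocalFrame.map (F := pullback (g (K a)) F) (pbFrame (g (K a)) F a.1.1)
      (S (K a)).symm) (fun a => pbFrame g' F a.1.1) V
    (fun a => hV a _ le_rfl) hV'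
    (fun x => by
      obtain ⟨W, k, hx, hW⟩ := hT x
      obtain ⟨φ, hφ⟩ := F.exists_frame (g'.base x)
      exact ⟨⟨(φ, W, ⟨k⟩), hW⟩, hx, hφ⟩)
    (fun a b W ha hb c c' => by
      have e1 := key a (max (K a) (K b)) (le_max_left _ _) W ha c
      have e2 := key b (max (K a) (K b)) (le_max_right _ _) W hb c'
      have l1 := LocalFrame.map_lin (F := pullback (g (K a)) F) (pbFrame (g (K a)) F a.1.1)
        (S (K a)).symm (ha.trans (hV a _ le_rfl)) c
      have l2 := LocalFrame.map_lin (F := pullback (g (K b)) F) (pbFrame (g (K b)) F b.1.1)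
        (S (K b)).symm (hb.trans (hV b _ le_rfl)) c'
      refine (Iff.of_eq (congrArg₂ Eq l1 l2)).trans ?_
      change (S (K a)).symm.equiv W (pbLin (g (K a)) F a.1.1 (ha.trans (hV a _ le_rfl)) c) =
        (S (K b)).symm.equiv W (pbLin (g (K b)) F b.1.1 (hb.trans (hV b _ le_rfl)) c') ↔ _
      refine Iff.trans ?_ ((a.2 _ (le_max_left (K a) (K b))).1.pbLin_eq_iff (ha.trans inf_le_left) F
        a.1.1 b.1.1 (ha.trans (hV a _ (le_max_left _ _))) (hb.trans (hV b _ (le_max_right _ _)))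
        (ha.trans (hV' a)) (hb.trans (hV' b)) c c')
      rw [← e1, ← e2, ((S (max (K a) (K b))).equiv W).injective.eq_iff])
  refine ⟨T', fun W hW φ W' hW' h h' c => ?_⟩
  exact (congrArg (T'.equiv W') (LocalFrame.map_lin (F := pullback (g 0) F) (pbFrame (g 0) F φ)
    (S 0).symm h c).symm).trans (hT' ⟨(φ, W, ⟨0⟩), hW⟩ W' (le_inf hW' h') c)

end Limit

/-! ### Graphs of functions with values in the unit interval -/

section Graph

variable {E : Type*} [NormedAddCommGroup E] [NormedSpace ℝ E] {H : Type*} [TopologicalSpace H]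
  {I : ModelWithCorners ℝ E H} {M : Type u} [TopologicalSpace M] [ChartedSpace H M]
  {E' : Type*} [NormedAddCommGroup E'] [NormedSpace ℝ E'] {H' : Type*}
  [TopologicalSpace H'] {J : ModelWithCorners ℝ E' H'} {N : Type u} [TopologicalSpace N]
  [ChartedSpace H' N] {X : GradedManifold I M} {Y : GradedManifold J N}

/-- The morphism `X → X × [0,1]` with components the identity and a smooth function. For a constant
function `t` it is the inclusion of `X × {t}`. -/
noncomputable def graphHom (X : GradedManifold I M) (ψ : C^∞⟮I, M; 𝓡∂ 1, Set.Icc (0 : ℝ) 1⟯) :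
    Hom X X.prodInterval :=
  sliceHom X (ContMDiffMap.fst : C^∞⟮I.prod (𝓡∂ 1), M × Set.Icc (0 : ℝ) 1; I, M⟯)
    ⟨fun x => (x, ψ x), contMDiff_id.prodMk ψ.contMDiff⟩ fun _ => rfl

theorem bcVal_congr {P : Type u} [TopologicalSpace P] [ChartedSpace H' P]
    (X : GradedManifold I M) (h : C^∞⟮J, P; I, M⟯) {W : Opens P}
    (τ : X.Triv) {p q : P} (hpq : p = q) (hp : p ∈ W) (hx : h p ∈ τ.U) (hq : q ∈ W)
    (hy : h q ∈ τ.U) (s : X.BCSec h W) : X.bcVal h τ hp hx s = X.bcVal h τ hq hy s := by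
  subst hpq
  rfl

/-- Pulling back along the graph of `ψ` is evaluation at the points `(x, ψ x)`. -/
theorem graphHom_val (X : GradedManifold I M) (ψ : C^∞⟮I, M; 𝓡∂ 1, Set.Icc (0 : ℝ) 1⟯)
    {V : Opens (M × Set.Icc (0 : ℝ) 1)} (s : X.prodInterval.sec V) (τ : X.Triv) {x : M}
    (hV : (x, ψ x) ∈ V) (hx : x ∈ τ.U) :
    τ.val (W := pre (graphHom X ψ).base V) hV hx ((graphHom X ψ).pull V s) =
      X.bcVal (ContMDiffMap.fst : C^∞⟮I.prod (𝓡∂ 1), M × Set.Icc (0 : ℝ) 1; I, M⟯) τ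
        (p := (x, ψ x)) hV hx s :=
  slice_val X _ _ (fun _ => rfl) V s τ hV hx

/-- The restriction of a homotopy to the graph of `ψ` depends locally on `ψ`. -/
theorem agreeOn_graphHom (f : Hom X.prodInterval Y)
    {ψ ψ' : C^∞⟮I, M; 𝓡∂ 1, Set.Icc (0 : ℝ) 1⟯} {W : Opens M} (h : ∀ x ∈ W, ψ x = ψ' x) :
    (f.comp (graphHom X ψ)).AgreeOn (f.comp (graphHom X ψ')) W := by
  refine ⟨fun x hx => ?_, fun V W' hW h1 h2 b => X.ext_val fun τ x hx hxτ => ?_⟩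
  · change f.base (x, ψ x) = f.base (x, ψ' x)
    rw [h x hx]
  · refine (τ.val_res h1 hx hxτ _).trans (Eq.trans ?_ (τ.val_res h2 hx hxτ _).symm)
    refine (graphHom_val X ψ (f.pull V b) τ (h1 hx) hxτ).trans
      (Eq.trans ?_ (graphHom_val X ψ' (f.pull V b) τ (h2 hx) hxτ).symm)
    exact bcVal_congr X _ τ (by rw [h x (hW hx)]) _ _ _ _ _

/-- The pullbacks of `F` along the graphs of `ψ` and `ψ'` are isomorphic, by an isomorphism which is
the identity wherever `ψ` and `ψ'` coincide. -/
def GraphIso (f : Hom X.prodInterval Y) (F : GradedVectorBundle Y)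
    (ψ ψ' : C^∞⟮I, M; 𝓡∂ 1, Set.Icc (0 : ℝ) 1⟯) : Prop :=
  ∃ T : GradedVectorBundle.Iso (pullback (f.comp (graphHom X ψ)) F)
    (pullback (f.comp (graphHom X ψ')) F),
    ∀ W : Opens M, (∀ x ∈ W, ψ x = ψ' x) → IsIdOn T W

theorem GraphIso.refl (f : Hom X.prodInterval Y) (F : GradedVectorBundle Y)
    (ψ : C^∞⟮I, M; 𝓡∂ 1, Set.Icc (0 : ℝ) 1⟯) : GraphIso f F ψ ψ :=
  ⟨GradedVectorBundle.Iso.refl _, fun _ _ _ _ _ _ _ _ => rfl⟩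

/-- The basic case: `ψ` and `ψ'` differ only inside an open set `U` over which both graphs are
mapped to the domain of a single frame of `F`. -/
theorem GraphIso.of_frame (f : Hom X.prodInterval Y) (F : GradedVectorBundle Y)
    {ψ ψ' : C^∞⟮I, M; 𝓡∂ 1, Set.Icc (0 : ℝ) 1⟯} {Z : Set M} (hZ : IsClosed Z) (U : Opens M)
    (hZU : Z ⊆ U) (h : ∀ x ∉ Z, ψ x = ψ' x) (φ₀ : F.Frame)
    (hφ : ∀ x ∈ U, f.base (x, ψ x) ∈ φ₀.U) (hφ' : ∀ x ∈ U, f.base (x, ψ' x) ∈ φ₀.U) :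
    GraphIso f F ψ ψ' := by
  obtain ⟨T, hT⟩ := exists_iso_of_frame (f.comp (graphHom X ψ)) (f.comp (graphHom X ψ')) F
    ⟨Zᶜ, hZ.isOpen_compl⟩ U
    (fun x => (em (x ∈ Z)).elim (fun hx => Or.inr (hZU hx)) fun hx => Or.inl hx)
    (agreeOn_graphHom f h) φ₀ hφ hφ'
  exact ⟨T, fun W hW => hT W (agreeOn_graphHom f hW)⟩

/-- Passage to the limit along a locally stationary sequence of functions. By `hconst`, the points
where the first function agrees with the limit are never moved, so that all of the isomorphisms are
the identity there. -/
theorem GraphIso.of_seq (f : Hom X.prodInterval Y) (F : GradedVectorBundle Y)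
    (Ψ : ℕ → C^∞⟮I, M; 𝓡∂ 1, Set.Icc (0 : ℝ) 1⟯) (ψ' : C^∞⟮I, M; 𝓡∂ 1, Set.Icc (0 : ℝ) 1⟯)
    (hΨ : ∀ k, GraphIso f F (Ψ k) (Ψ (k + 1)))
    (hlim : ∀ x, ∃ (W : Opens M) (K : ℕ), x ∈ W ∧ ∀ k, K ≤ k → ∀ y ∈ W, Ψ k y = ψ' y)
    (hconst : ∀ x, Ψ 0 x = ψ' x → ∀ k, Ψ k x = ψ' x) : GraphIso f F (Ψ 0) ψ' := by
  choose T hT using hΨ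
  have key : ∀ (W : Opens M) (K : ℕ), (∀ k, K ≤ k → ∀ y ∈ W, Ψ k y = ψ' y) →
      StationaryOn (f.comp (graphHom X ψ')) T K W := fun W K h k hk =>
    ⟨agreeOn_graphHom f (h k hk), hT k W fun x hx => by
      rw [h k hk x hx, h (k + 1) (hk.trans (Nat.le_succ k)) x hx]⟩
  obtain ⟨T', hT'⟩ := exists_iso_limit (f.comp (graphHom X ψ')) T (fun x => by
    obtain ⟨W, K, hx, h⟩ := hlim x
    exact ⟨W, K, hx, key W K h⟩)
  exact ⟨T', fun W hW => hT' W (key W 0 fun k _ y hy => hconst y (hW y hy) k)⟩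

/-- Interpolation between two functions with values in the unit interval. -/
theorem exists_interp (ψ ψ' : C^∞⟮I, M; 𝓡∂ 1, Set.Icc (0 : ℝ) 1⟯) {s : M → ℝ}
    (hs : ContMDiff I 𝓘(ℝ, ℝ) ∞ s) (hs' : ∀ x, s x ∈ Set.Icc (0 : ℝ) 1) :
    ∃ χ : C^∞⟮I, M; 𝓡∂ 1, Set.Icc (0 : ℝ) 1⟯,
      ∀ x, (χ x : ℝ) = ψ x + s x * ((ψ' x : ℝ) - ψ x) := by
  have hv : ∀ x, (ψ x : ℝ) + s x * ((ψ' x : ℝ) - ψ x) ∈ Set.Icc (0 : ℝ) 1 := fun x => by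
    obtain ⟨h1, h2⟩ := hs' x
    obtain ⟨h3, h4⟩ := (ψ x).2
    obtain ⟨h5, h6⟩ := (ψ' x).2
    constructor <;> nlinarith
  have hsm : ContMDiff I 𝓘(ℝ, ℝ) ∞ fun x => (ψ x : ℝ) + s x * ((ψ' x : ℝ) - ψ x) := by
    have h1 : ContMDiff I 𝓘(ℝ, ℝ) ∞ fun x => (ψ x : ℝ) :=
      contMDiff_subtypeVal_Icc.comp ψ.contMDiff
    have h2 : ContMDiff I 𝓘(ℝ, ℝ) ∞ fun x => (ψ' x : ℝ) :=
      contMDiff_subtypeVal_Icc.comp ψ'.contMDiff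
    exact h1.add (hs.mul (h2.sub h1))
  refine ⟨⟨fun x => Set.projIcc (0 : ℝ) 1 zero_le_one
    ((ψ x : ℝ) + s x * ((ψ' x : ℝ) - ψ x)), ?_⟩, fun x => ?_⟩
  · exact (contMDiffOn_projIcc (x := (0 : ℝ)) (y := 1) (n := ∞)).comp_contMDiff hsm hv
  · change ((Set.projIcc (0 : ℝ) 1 zero_le_one _ : Set.Icc (0 : ℝ) 1) : ℝ) = _
    rw [Set.projIcc_of_mem zero_le_one (hv x)]

/-- The values of `χ` lie between those of `ψ` and `ψ'`. -/
def IsBetween (ψ ψ' χ : C^∞⟮I, M; 𝓡∂ 1, Set.Icc (0 : ℝ) 1⟯) : Prop :=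
  ∀ x, ∃ s ∈ Set.Icc (0 : ℝ) 1, (χ x : ℝ) = ψ x + s * ((ψ' x : ℝ) - ψ x)

theorem IsBetween.eq {ψ ψ' χ : C^∞⟮I, M; 𝓡∂ 1, Set.Icc (0 : ℝ) 1⟯} (h : IsBetween ψ ψ' χ) {x : M}
    (hx : ψ x = ψ' x) : χ x = ψ x := by
  obtain ⟨s, -, hs⟩ := h x
  apply Subtype.ext
  rw [hs, hx, sub_self, mul_zero, add_zero]

theorem IsBetween.abs_sub_le {ψ ψ' χ : C^∞⟮I, M; 𝓡∂ 1, Set.Icc (0 : ℝ) 1⟯}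
    (h : IsBetween ψ ψ' χ) (x : M) : |(χ x : ℝ) - ψ x| ≤ |(ψ' x : ℝ) - ψ x| := by
  obtain ⟨s, ⟨h0, h1⟩, hs⟩ := h x
  rw [hs, add_sub_cancel_left, abs_mul, abs_of_nonneg h0]
  exact mul_le_of_le_one_left (abs_nonneg _) h1

theorem sum_range_le_one (ρ : SmoothPartitionOfUnity ℕ I M Set.univ) (k : ℕ) (x : M) :
    ∑ i ∈ Finset.range k, ρ i x ≤ 1 := by
  classical
  have hfin : (Function.support fun i => ρ i x).Finite := ρ.locallyFinite.point_finite x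
  rw [← ρ.sum_eq_one (Set.mem_univ x), finsum_eq_sum_of_support_subset (fun i => ρ i x)
    (s := hfin.toFinset ∪ Finset.range k) (by
      intro i hi
      simp only [Finset.coe_union, Set.mem_union]
      exact Or.inl (hfin.mem_toFinset.2 hi))]
  exact Finset.sum_le_sum_of_subset_of_nonneg Finset.subset_union_right
    fun i _ _ => ρ.nonneg i x

section Fine

variable [FiniteDimensional ℝ E] [IsManifold I ∞ M] [T2Space M] [SecondCountableTopology M]

/-- Local-to-global principle: it suffices to treat pairs of functions which differ only inside a
small open set. -/
theorem GraphIso.of_local [SigmaCompactSpace M] (f : Hom X.prodInterval Y)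
    (F : GradedVectorBundle Y)
    (ψ ψ' : C^∞⟮I, M; 𝓡∂ 1, Set.Icc (0 : ℝ) 1⟯)
    (hloc : ∀ x, ∃ V : Opens M, x ∈ V ∧ ∀ χ χ', IsBetween ψ ψ' χ → IsBetween ψ ψ' χ' →
      (∃ Z : Set M, IsClosed Z ∧ Z ⊆ V ∧ ∀ y ∉ Z, χ y = χ' y) → GraphIso f F χ χ') :
    GraphIso f F ψ ψ' := by
  rcases isEmpty_or_nonempty M with hM | hM
  · obtain rfl : ψ = ψ' := ContMDiffMap.ext fun x => (hM.false x).elim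
    exact GraphIso.refl f F ψ
  choose V hxV hV using hloc
  obtain ⟨t, htc, ht⟩ := TopologicalSpace.countable_cover_nhds
    fun x => (V x).isOpen.mem_nhds (hxV x)
  have htne : t.Nonempty := by
    by_contra hne
    rw [Set.not_nonempty_iff_eq_empty.1 hne] at ht
    simp only [Set.mem_empty_iff_false, Set.iUnion_of_empty, Set.iUnion_empty] at ht
    exact Set.empty_ne_univ ht
  obtain ⟨e, rfl⟩ := htc.exists_eq_range htne
  obtain ⟨ρ, hρ⟩ := SmoothPartitionOfUnity.exists_isSubordinate I (isClosed_univ (X := M))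
    (fun k => (V (e k) : Set M)) (fun k => (V (e k)).isOpen) (by rw [← ht]; simp)
  have hs : ∀ k, ContMDiff I 𝓘(ℝ, ℝ) ∞ fun x => ∑ i ∈ Finset.range k, ρ i x := fun k =>
    contMDiff_finsetSum fun i _ => (ρ i).contMDiff
  have hs' : ∀ k x, ∑ i ∈ Finset.range k, ρ i x ∈ Set.Icc (0 : ℝ) 1 := fun k x =>
    ⟨Finset.sum_nonneg fun i _ => ρ.nonneg i x, sum_range_le_one ρ k x⟩
  -- The `k`-th function `ψ + (ρ₀ + … + ρ_{k-1}) (ψ' - ψ)` differs from the next one only inside the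
  -- support of `ρ_k`.
  choose Ψ hΨ using fun k => exists_interp ψ ψ' (hs k) (hs' k)
  have hbet : ∀ k, IsBetween ψ ψ' (Ψ k) := fun k x => ⟨_, hs' k x, hΨ k x⟩
  have h0 : Ψ 0 = ψ := ContMDiffMap.ext fun x => Subtype.ext (by rw [hΨ]; simp)
  have := GraphIso.of_seq f F Ψ ψ' (fun k => ?_) (fun x => ?_) (fun x hx k => ?_)
  · rwa [h0] at this
  · refine hV (e k) _ _ (hbet k) (hbet (k + 1)) ⟨tsupport (ρ k), isClosed_tsupport _, hρ k,
      fun y hy => Subtype.ext ?_⟩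
    rw [hΨ, hΨ, Finset.sum_range_succ, image_eq_zero_of_notMem_tsupport hy, add_zero]
  · obtain ⟨W, hW, hfin⟩ := ρ.locallyFinite x
    obtain ⟨W', hW', hW'o, hxW'⟩ := mem_nhds_iff.1 hW
    obtain ⟨K, hK⟩ := hfin.bddAbove
    refine ⟨⟨W', hW'o⟩, K + 1, hxW', fun k hk y hy => Subtype.ext ?_⟩
    rw [hΨ, ← finsum_eq_sum_of_support_subset, ρ.sum_eq_one (Set.mem_univ y), one_mul,
      add_sub_cancel]
    intro i hi
    have : i ≤ K := hK ⟨y, hi, hW' hy⟩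
    simpa using by omega
  · rw [h0] at hx
    rw [(hbet k).eq hx, hx]

end Fine

/-- Every point of `M` has a neighbourhood `U` such that `U × J` is mapped to the domain of a frame
for all short enough subintervals `J` of the unit interval. -/
theorem exists_uniform_frames (f : Hom X.prodInterval Y) (F : GradedVectorBundle Y) (x : M) :
    ∃ U : Opens M, x ∈ U ∧ ∃ ε > 0, ∀ t : Set.Icc (0 : ℝ) 1, ∃ φ : F.Frame,
      ∀ y ∈ U, ∀ s : Set.Icc (0 : ℝ) 1, |(s : ℝ) - t| < ε → f.base (y, s) ∈ φ.U := by
  have h1 : ∀ t : Set.Icc (0 : ℝ) 1, ∃ (φ : F.Frame) (U : Opens M) (ε : ℝ), x ∈ U ∧ 0 < ε ∧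
      ∀ y ∈ U, ∀ s : Set.Icc (0 : ℝ) 1, |(s : ℝ) - t| < 2 * ε → f.base (y, s) ∈ φ.U := by
    intro t
    obtain ⟨φ, hφ⟩ := F.exists_frame (f.base (x, t))
    have h2 : (pre f.base φ.U : Set (M × Set.Icc (0 : ℝ) 1)) ∈ nhds (x, t) :=
      (pre f.base φ.U).isOpen.mem_nhds hφ
    obtain ⟨U, hU, V, hV, hUV⟩ := mem_nhds_prod_iff.1 h2
    obtain ⟨U', hU', hU'o, hxU'⟩ := mem_nhds_iff.1 hU
    obtain ⟨ε, hε, hεV⟩ := Metric.mem_nhds_iff.1 hV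
    refine ⟨φ, ⟨U', hU'o⟩, ε / 2, hxU', by positivity, fun y hy s hs => ?_⟩
    refine hUV ⟨hU' hy, hεV ?_⟩
    rw [Metric.mem_ball, Subtype.dist_eq, Real.dist_eq]
    linarith
  choose φ U ε hxU hε hφ using h1
  obtain ⟨T, -, hT⟩ := (isCompact_univ (X := Set.Icc (0 : ℝ) 1)).elim_nhds_subcover
    (fun t => Metric.ball t (ε t)) (fun t _ => Metric.ball_mem_nhds t (hε t))
  have hmin : ∀ T : Finset (Set.Icc (0 : ℝ) 1), ∃ δ > 0, ∀ t ∈ T, δ ≤ ε t := by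
    classical
    intro T
    induction T using Finset.induction_on with
    | empty => exact ⟨1, one_pos, by simp⟩
    | insert a T _ ih =>
      obtain ⟨δ, hδ, h⟩ := ih
      refine ⟨min δ (ε a), lt_min hδ (hε a), fun t ht => ?_⟩
      rcases Finset.mem_insert.1 ht with rfl | ht
      · exact min_le_right _ _
      · exact (min_le_left _ _).trans (h t ht)
  obtain ⟨δ, hδ, hδT⟩ := hmin T
  refine ⟨⟨⋂ t ∈ T, (U t : Set M), isOpen_biInter_finset fun t _ => (U t).isOpen⟩,
    Set.mem_iInter₂.2 fun t _ => hxU t, δ, hδ, fun t => ?_⟩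
  obtain ⟨t₀, ht₀, ht⟩ := Set.mem_iUnion₂.1 (hT (Set.mem_univ t))
  refine ⟨φ t₀, fun y hy s hs => hφ t₀ y (Set.mem_iInter₂.1 hy t₀ ht₀) s ?_⟩
  rw [Metric.mem_ball, Subtype.dist_eq, Real.dist_eq] at ht
  have := hδT t₀ ht₀
  have h3 := abs_sub_le (s : ℝ) t t₀
  linarith

variable [FiniteDimensional ℝ E] [IsManifold I ∞ M] [T2Space M] [SecondCountableTopology M]
  [SigmaCompactSpace M]

/-- The pullbacks of `F` along any two graphs are isomorphic. Near a point of `M`, one function is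
moved to the other in so many steps that each step is local in the unit interval, too. -/
theorem graphIso (f : Hom X.prodInterval Y) (F : GradedVectorBundle Y)
    (ψ ψ' : C^∞⟮I, M; 𝓡∂ 1, Set.Icc (0 : ℝ) 1⟯) : GraphIso f F ψ ψ' := by
  refine GraphIso.of_local f F ψ ψ' fun x => ?_
  obtain ⟨U, hxU, ε, hε, hU⟩ := exists_uniform_frames f F x
  refine ⟨U, hxU, fun χ χ' _ _ ⟨Z, hZ, hZU, hχ⟩ => ?_⟩
  obtain ⟨n, hn⟩ := exists_nat_gt (2 / ε)
  -- Move from `χ` to `χ'` in `n` steps, each of which changes the values by at most `1 / n`.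
  have hn0 : (0 : ℝ) < n := lt_trans (by positivity) hn
  have hn1 : 1 / (n : ℝ) < ε / 2 := by
    rw [div_lt_iff₀ hε] at hn
    rw [div_lt_iff₀ hn0]
    linarith
  let a : ℕ → ℝ := fun k => (min k n : ℕ) / n
  have ha : ∀ k, a k ∈ Set.Icc (0 : ℝ) 1 := fun k => by
    refine ⟨by positivity, (div_le_one hn0).2 ?_⟩
    exact_mod_cast min_le_right k n
  have ha' : ∀ k, |a (k + 1) - a k| ≤ 1 / n := fun k => by
    change |((min (k + 1) n : ℕ) : ℝ) / n - ((min k n : ℕ) : ℝ) / n| ≤ 1 / n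
    rw [← sub_div, abs_div, abs_of_pos hn0]
    gcongr
    rcases le_total n k with h | h
    · rw [min_eq_right h, min_eq_right (h.trans (Nat.le_succ k)), sub_self, abs_zero]
      exact zero_le_one
    · rcases h.eq_or_lt with rfl | h
      · simp
      · rw [min_eq_left h.le, min_eq_left (Nat.succ_le_of_lt h)]
        simp
  choose Ψ hΨ using fun k => exists_interp χ χ' (contMDiff_const (c := a k)) fun _ => ha k
  have h0 : Ψ 0 = χ := ContMDiffMap.ext fun x => Subtype.ext (by rw [hΨ]; simp [a])
  have heq : ∀ k y, χ y = χ' y → Ψ k y = χ y := fun k y h => Subtype.ext (by rw [hΨ, h]; simp)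
  have := GraphIso.of_seq f F Ψ χ' (fun k => ?_) (fun x => ?_) (fun x hx k => ?_)
  · rwa [h0] at this
  · refine GraphIso.of_local f F _ _ fun y => ?_
    by_cases hy : y ∈ Z
    · obtain ⟨φ, hφ⟩ := hU (Ψ k y)
      have hopen : IsOpen {z | |(Ψ k z : ℝ) - Ψ k y| < ε / 2} := by
        have hc : Continuous fun z => (Ψ k z : ℝ) :=
          continuous_subtype_val.comp (Ψ k).contMDiff.continuous
        exact isOpen_lt (hc.sub continuous_const).abs continuous_const
      let V : Opens M := U ⊓ ⟨_, hopen⟩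
      refine ⟨V, ⟨hZU hy, by simpa using hε⟩, ?_⟩
      rintro ξ ξ' hξ hξ' ⟨Z', hZ', hZV, h⟩
      have hstep : ∀ z, |(Ψ (k + 1) z : ℝ) - Ψ k z| ≤ 1 / n := fun z => by
        rw [hΨ, hΨ, show (χ z : ℝ) + a (k + 1) * ((χ' z : ℝ) - χ z) -
          (χ z + a k * ((χ' z : ℝ) - χ z)) = (a (k + 1) - a k) * ((χ' z : ℝ) - χ z) by ring,
          abs_mul]
        have h1 : |(χ' z : ℝ) - χ z| ≤ 1 := by
          obtain ⟨h3, h4⟩ := (χ z).2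
          obtain ⟨h5, h6⟩ := (χ' z).2
          rw [abs_le]
          constructor <;> linarith
        calc _ ≤ (1 / (n : ℝ)) * 1 := mul_le_mul (ha' k) h1 (abs_nonneg _) (by positivity)
          _ = _ := mul_one _
      have hclose : ∀ ζ, IsBetween (Ψ k) (Ψ (k + 1)) ζ → ∀ z ∈ V, f.base (z, ζ z) ∈ φ.U := by
        intro ζ hζ z hz
        refine hφ z hz.1 (ζ z) ?_
        have h1 := hζ.abs_sub_le z
        have h2 := hstep z
        have h3 : |(Ψ k z : ℝ) - Ψ k y| < ε / 2 := hz.2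
        have h4 := abs_sub_le (ζ z : ℝ) (Ψ k z) (Ψ k y)
        linarith
      exact GraphIso.of_frame f F hZ' V hZV h φ (hclose ξ hξ) (hclose ξ' hξ')
    · refine ⟨⟨Zᶜ, hZ.isOpen_compl⟩, hy, ?_⟩
      rintro ξ ξ' hξ hξ' ⟨Z', hZ', hZV, h⟩
      obtain rfl : ξ = ξ' := ContMDiffMap.ext fun z => by
        by_cases hz : z ∈ Z'
        · have hz' := hχ z (hZV hz)
          have h1 : Ψ k z = Ψ (k + 1) z := by rw [heq k z hz', heq (k + 1) z hz']
          rw [hξ.eq h1, hξ'.eq h1]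
        · exact h z hz
      exact GraphIso.refl f F ξ
  · refine ⟨⊤, n, trivial, fun k hk y _ => Subtype.ext ?_⟩
    rw [hΨ]
    simp only [a]
    rw [min_eq_right hk, div_self hn0.ne']
    ring
  · rw [h0] at hx
    rw [heq k x hx, hx]

/-- The two ends of a homotopy of morphisms of graded manifolds have isomorphic pullbacks. -/
theorem nonempty_iso_pullback_incl (f : Hom X.prodInterval Y) (F : GradedVectorBundle Y) :
    Nonempty (GradedVectorBundle.Iso (pullback (f.comp (incl X 0)) F)
      (pullback (f.comp (incl X 1)) F)) :=
  (graphIso f F ⟨fun _ => 0, contMDiff_const⟩ ⟨fun _ => 1, contMDiff_const⟩).nonempty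

end Graph

/-! ### Global sections of an ordinary vector bundle -/

section Cocycle

open Matrix

/-- A smooth real vector bundle of rank `r` on `M`, given by a smooth cocycle on an open cover. The
matrices `G a b x` are meaningful for `x ∈ U a ∩ U b` only. -/
structure SmoothCocycle {E : Type*} [NormedAddCommGroup E] [NormedSpace ℝ E] {H : Type*}
    [TopologicalSpace H] (I : ModelWithCorners ℝ E H) (M : Type u) [TopologicalSpace M]
    [ChartedSpace H M] (ι : Type u) (r : ℕ) where
  U : ι → Opens M
  cover : ∀ x, ∃ a, x ∈ U a
  G : ι → ι → M → Matrix (Fin r) (Fin r) ℝ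
  smooth : ∀ a b i j, ContMDiffOn I 𝓘(ℝ, ℝ) ∞ (fun x => G a b x i j) (U a ⊓ U b : Opens M)
  self : ∀ {a x}, x ∈ U a → G a a x = 1
  mul : ∀ {a b c x}, x ∈ U a → x ∈ U b → x ∈ U c → G a b x * G b c x = G a c x

namespace SmoothCocycle

variable {E : Type*} [NormedAddCommGroup E] [NormedSpace ℝ E] {H : Type*} [TopologicalSpace H]
  {I : ModelWithCorners ℝ E H} {M : Type u} [TopologicalSpace M] [ChartedSpace H M]
  {ι : Type u} {r : ℕ} (C : SmoothCocycle I M ι r)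

/-- A global section, given by its coefficients in each of the frames of the cocycle. -/
structure IsSection (s : ι → M → Fin r → ℝ) : Prop where
  smooth : ∀ a i, ContMDiffOn I 𝓘(ℝ, ℝ) ∞ (fun x => s a x i) (C.U a)
  trans : ∀ {a b x}, x ∈ C.U a → x ∈ C.U b → s b x = s a x ᵥ* C.G a b x

/-- A family of sections spans the fibre at `x`; equivalently, no covector but zero vanishes on all
the sections. -/
def Spans {κ : Type*} (s : κ → ι → M → Fin r → ℝ) (x : M) : Prop :=
  ∀ a, x ∈ C.U a → ∀ α : Fin r → ℝ, (∀ j, s j a x ⬝ᵥ α = 0) → α = 0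

variable {C}

theorem Spans.of_index {κ : Type*} {s : κ → ι → M → Fin r → ℝ} (hs : ∀ j, C.IsSection (s j))
    {x : M} {a : ι} (ha : x ∈ C.U a) (h : ∀ α : Fin r → ℝ, (∀ j, s j a x ⬝ᵥ α = 0) → α = 0) :
    C.Spans s x := by
  intro b hb α hα
  have h1 : C.G a b x *ᵥ α = 0 := h _ fun j => by
    rw [dotProduct_mulVec, ← (hs j).trans ha hb, hα j]
  have h2 := congrArg (C.G b a x *ᵥ ·) h1
  simpa only [mulVec_mulVec, C.mul hb ha hb, C.self hb, one_mulVec, mulVec_zero] using h2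

theorem Spans.mono {κ κ' : Type*} {s : κ → ι → M → Fin r → ℝ} {s' : κ' → ι → M → Fin r → ℝ} {x : M}
    (h : C.Spans s x) (hs : ∀ j, ∃ j', s j = s' j') : C.Spans s' x := fun a ha α hα =>
  h a ha α fun j => by
    obtain ⟨j', hj⟩ := hs j
    rw [hj]
    exact hα j'

theorem isSection_zero : C.IsSection 0 where
  smooth a i := contMDiffOn_const
  trans _ _ := (zero_vecMul (C.G _ _ _)).symm

theorem IsSection.sub_smul {s t : ι → M → Fin r → ℝ} (hs : C.IsSection s) (ht : C.IsSection t)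
    (c : ℝ) : C.IsSection fun a x => s a x - c • t a x where
  smooth a i := (hs.smooth a i).sub (contMDiffOn_const.mul (ht.smooth a i))
  trans ha hb := by rw [hs.trans ha hb, ht.trans ha hb, sub_vecMul, smul_vecMul]

section Fine

variable [FiniteDimensional ℝ E] [IsManifold I ∞ M]

/-- Cutting off the vectors of a local frame gives global sections which span near a point. -/
theorem exists_spans_nhds [T2Space M] (x : M) : ∃ s : Fin r → ι → M → Fin r → ℝ,
    (∀ i, C.IsSection (s i)) ∧ ∃ V ∈ nhds x, ∀ y ∈ V, C.Spans s y := by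
  classical
  obtain ⟨a, ha⟩ := C.cover x
  obtain ⟨f, -, hf⟩ := (SmoothBumpFunction.nhds_basis_tsupport (I := I) x).mem_iff.1
    ((C.U a).isOpen.mem_nhds ha)
  let s : Fin r → ι → M → Fin r → ℝ := fun i b y k =>
    if y ∈ C.U a then f y * C.G a b y i k else 0
  have hs : ∀ i, C.IsSection (s i) := fun i => by
    refine ⟨fun b k y hy => ContMDiffAt.contMDiffWithinAt ?_, fun {b c y} hb hc => ?_⟩
    · by_cases hya : y ∈ C.U a
      · have h1 : ContMDiffAt I 𝓘(ℝ, ℝ) ∞ (fun z => f z * C.G a b z i k) y :=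
          f.contMDiff.contMDiffAt.mul ((C.smooth a b i k).contMDiffAt
            ((C.U a ⊓ C.U b).isOpen.mem_nhds ⟨hya, hy⟩))
        refine h1.congr_of_eventuallyEq ?_
        filter_upwards [(C.U a).isOpen.mem_nhds hya] with z hz
        exact if_pos hz
      · have h1 : y ∉ tsupport f := fun h => hya (hf h)
        refine (contMDiffAt_const (c := (0 : ℝ))).congr_of_eventuallyEq ?_
        filter_upwards [(isClosed_tsupport f).isOpen_compl.mem_nhds h1] with z hz
        simp only [s]
        rw [image_eq_zero_of_notMem_tsupport hz, zero_mul, ite_self]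
    · funext l
      simp only [s, vecMul, dotProduct]
      split_ifs with hya
      · rw [← C.mul hya hb hc, Matrix.mul_apply, Finset.mul_sum]
        exact Finset.sum_congr rfl fun k _ => (mul_assoc _ _ _).symm
      · simp
  refine ⟨s, hs, {y | f y = 1} ∩ C.U a,
    Filter.inter_mem f.eventuallyEq_one ((C.U a).isOpen.mem_nhds ha), fun y hy => ?_⟩
  refine Spans.of_index hs hy.2 fun α hα => funext fun i => ?_
  have h1 := hα i
  have h2 : y ∈ C.U a := hy.2
  have h3 : f y = 1 := hy.1
  simpa [s, dotProduct, h2, h3, C.self h2, Matrix.one_apply] using h1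

/-- Over a compact set, a vector bundle is spanned by finitely many global sections. -/
theorem exists_finset_spans [T2Space M] {K : Set M} (hK : IsCompact K) :
    ∃ (n : ℕ) (s : Fin n → ι → M → Fin r → ℝ), (∀ i, C.IsSection (s i)) ∧
      ∀ y ∈ K, C.Spans s y := by
  refine hK.induction_on (p := fun K => ∃ (n : ℕ) (s : Fin n → ι → M → Fin r → ℝ),
    (∀ i, C.IsSection (s i)) ∧ ∀ y ∈ K, C.Spans s y) ?_ ?_ ?_ ?_
  · exact ⟨0, Fin.elim0, fun i => i.elim0, fun y hy => hy.elim⟩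
  · rintro K K' h ⟨n, s, hs, h'⟩
    exact ⟨n, s, hs, fun y hy => h' y (h hy)⟩
  · rintro K K' ⟨n, s, hs, h⟩ ⟨n', s', hs', h'⟩
    refine ⟨n + n', Fin.append s s', fun i => ?_, fun y hy => ?_⟩
    · refine Fin.addCases (fun i => ?_) (fun i => ?_) i
      · rw [Fin.append_left]; exact hs i
      · rw [Fin.append_right]; exact hs' i
    · rcases hy with hy | hy
      · exact (h y hy).mono fun j => ⟨Fin.castAdd n' j, (Fin.append_left _ _ _).symm⟩
      · exact (h' y hy).mono fun j => ⟨Fin.natAdd n j, (Fin.append_right _ _ _).symm⟩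
  · intro x _
    obtain ⟨s, hs, V, hV, h⟩ := exists_spans_nhds (C := C) x
    exact ⟨V, mem_nhdsWithin_of_mem_nhds hV, r, s, hs, h⟩

/-- Among more than `dim M + r + 1` spanning sections, one can be disposed of, after subtracting
generic multiples of it from the others: the multiples to be avoided are parametrised by the points
of the dual bundle, the dimension of which is `dim M + r`. -/
theorem exists_spans_of_succ [SecondCountableTopology M] {n : ℕ} (hn : Module.finrank ℝ E + r < n)
    (K : Set M) (s : Fin (n + 1) → ι → M → Fin r → ℝ) (hs : ∀ i, C.IsSection (s i))
    (h : ∀ y ∈ K, C.Spans s y) :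
    ∃ t : Fin n → ι → M → Fin r → ℝ, (∀ i, C.IsSection (t i)) ∧ ∀ y ∈ K, C.Spans t y := by
  choose a ha using C.cover
  have hball : ∀ x : M, ∃ δ > 0, Metric.ball (extChartAt I x x) δ ∩ Set.range I ⊆
      (extChartAt I x).target ∩ (extChartAt I x).symm ⁻¹' (C.U (a x) : Set M) := by
    intro x
    refine Metric.mem_nhdsWithin_iff.1 (Filter.inter_mem (extChartAt_target_mem_nhdsWithin x) ?_)
    refine mem_nhdsWithin_of_mem_nhds ((continuousAt_extChartAt_symm x).preimage_mem_nhds ?_)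
    rw [extChartAt_to_inv]
    exact (C.U (a x)).isOpen.mem_nhds (ha x)
  choose δ hδ hball using hball
  -- The domains are convex, which allows for boundaries: Hausdorff dimension is not increased by
  -- maps that are `C^1` on a convex set.
  let D : M → Set E := fun x => Metric.ball (extChartAt I x x) (δ x) ∩ Set.range I
  have hD : ∀ x, Convex ℝ (D x) := fun x => (convex_ball _ _).inter I.convex_range
  let f : M → E × (Fin r → ℝ) → Fin n → ℝ := fun x p j =>
    s j.castSucc (a x) ((extChartAt I x).symm p.1) ⬝ᵥ p.2
  have hf : ∀ x, ContDiffOn ℝ 1 (f x) (D x ×ˢ Set.univ) := by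
    intro x
    refine contDiffOn_pi.2 fun j => ?_
    refine ContDiffOn.sum fun i _ => ContDiffOn.mul ?_ ?_
    · have h1 : ContMDiffOn 𝓘(ℝ, E) 𝓘(ℝ, ℝ) ∞
          (fun z => s j.castSucc (a x) ((extChartAt I x).symm z) i) (D x) :=
        ((hs j.castSucc).smooth (a x) i).comp
          ((contMDiffOn_extChartAt_symm x).mono fun z hz => (hball x hz).1)
          fun z hz => (hball x hz).2
      have h2 : ContDiffOn ℝ 1 (fun z => s j.castSucc (a x) ((extChartAt I x).symm z) i) (D x) :=
        (contMDiffOn_iff_contDiffOn.1 h1).of_le (by exact_mod_cast le_top)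
      exact h2.comp contDiff_fst.contDiffOn fun p hp => hp.1
    · exact ((contDiff_apply ℝ ℝ i).comp contDiff_snd).contDiffOn
  have hnhds : ∀ x : M, {y | y ∈ (extChartAt I x).source ∧ extChartAt I x y ∈
      Metric.ball (extChartAt I x x) (δ x)} ∈ nhds x := fun x =>
    Filter.inter_mem (extChartAt_source_mem_nhds x)
      ((continuousAt_extChartAt x).preimage_mem_nhds (Metric.ball_mem_nhds _ (hδ x)))
  obtain ⟨t, htc, ht⟩ := TopologicalSpace.countable_cover_nhds hnhds
  have hdim : dimH (⋃ x ∈ t, f x '' (D x ×ˢ Set.univ)) < Module.finrank ℝ (Fin n → ℝ) := by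
    rw [dimH_bUnion htc]
    refine lt_of_le_of_lt (b := ((Module.finrank ℝ E + r : ℕ) : ENNReal)) ?_ ?_
    · refine iSup₂_le fun x _ => ?_
      refine ((hf x).dimH_image_le ((hD x).prod convex_univ) subset_rfl).trans ?_
      refine (dimH_mono (Set.subset_univ _)).trans ?_
      rw [Real.dimH_univ_eq_finrank, Module.finrank_prod, Module.finrank_fin_fun]
    · rw [Module.finrank_fin_fun]
      exact_mod_cast hn
  obtain ⟨c, hc⟩ := (dense_compl_of_dimH_lt_finrank hdim).nonempty
  have ht' : ∀ j, C.IsSection fun b y => s j.castSucc b y - c j • s (Fin.last n) b y :=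
    fun j => (hs _).sub_smul (hs _) _
  refine ⟨fun j b y => s j.castSucc b y - c j • s (Fin.last n) b y, ht', fun y hy => ?_⟩
  obtain ⟨x, hxt, hys, hyb⟩ : ∃ x ∈ t, y ∈ (extChartAt I x).source ∧ extChartAt I x y ∈
      Metric.ball (extChartAt I x x) (δ x) := by
    have := Set.mem_univ y
    rw [← ht] at this
    obtain ⟨x, hx, h1, h2⟩ := Set.mem_iUnion₂.1 this
    exact ⟨x, hx, h1, h2⟩
  have hyD : extChartAt I x y ∈ D x := ⟨hyb, by
    rw [extChartAt_coe]; exact Set.mem_range_self _⟩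
  have hya : y ∈ C.U (a x) := by
    have := (hball x hyD).2
    rwa [Set.mem_preimage, (extChartAt I x).left_inv hys] at this
  refine Spans.of_index ht' hya fun α hα => ?_
  have hα' : ∀ j : Fin n, s j.castSucc (a x) y ⬝ᵥ α = c j * (s (Fin.last n) (a x) y ⬝ᵥ α) :=
    fun j => by
      have := hα j
      rwa [sub_dotProduct, smul_dotProduct, smul_eq_mul, sub_eq_zero] at this
  -- If the last section does not vanish on the covector `α`, rescale `α` so that its value is one:
  -- then `c` is the image of `(y, α)` under `f x`.
  by_cases hβ : s (Fin.last n) (a x) y ⬝ᵥ α = 0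
  · refine h y hy (a x) hya α fun j => ?_
    refine Fin.lastCases hβ (fun j => ?_) j
    rw [hα' j, hβ, mul_zero]
  · refine absurd ?_ hc
    refine Set.mem_iUnion₂.2 ⟨x, hxt, (extChartAt I x y,
      (s (Fin.last n) (a x) y ⬝ᵥ α)⁻¹ • α), ⟨hyD, trivial⟩, funext fun j => ?_⟩
    simp only [f]
    rw [(extChartAt I x).left_inv hys, dotProduct_smul, hα' j, smul_eq_mul]
    field_simp

/-- The number of sections needed to span a bundle over a compact set is bounded independently of
the set. -/
theorem exists_fin_spans [T2Space M] [SecondCountableTopology M] {K : Set M} (hK : IsCompact K) :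
    ∃ s : Fin (Module.finrank ℝ E + r + 1) → ι → M → Fin r → ℝ, (∀ i, C.IsSection (s i)) ∧
      ∀ y ∈ K, C.Spans s y := by
  obtain ⟨n, s, hs, h⟩ := exists_finset_spans (C := C) hK
  induction n with
  | zero => exact ⟨0, fun _ => isSection_zero, fun y hy => (h y hy).mono fun j => j.elim0⟩
  | succ n ih =>
    by_cases hn : Module.finrank ℝ E + r < n
    · obtain ⟨t, ht, h'⟩ := exists_spans_of_succ hn K s hs h
      exact ih t ht h'
    · let t : Fin (Module.finrank ℝ E + r + 1) → ι → M → Fin r → ℝ := fun j =>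
        if hj : (j : ℕ) < n + 1 then s ⟨j, hj⟩ else 0
      refine ⟨t, fun j => ?_, fun y hy => (h y hy).mono fun j => ⟨⟨j, by omega⟩, ?_⟩⟩
      · simp only [t]
        split_ifs
        · exact hs _
        · exact isSection_zero
      · simp only [t]
        rw [dif_pos j.2]

end Fine

variable (C)

/-- A vector bundle on a finite-dimensional manifold is spanned by finitely many global sections.
The annuli `K (m + 1) \ K m` of a compact exhaustion, with `m` in a fixed class modulo three, have
disjoint neighbourhoods; hence the sections that span over each of these annuli can be combined,
without increasing their number, which is bounded in terms of the dimension. -/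
theorem exists_spans [FiniteDimensional ℝ E] [IsManifold I ∞ M] [T2Space M]
    [SecondCountableTopology M] [SigmaCompactSpace M] :
    ∃ s : ℕ × Fin (Module.finrank ℝ E + r + 1) → ι → M → Fin r → ℝ, (∀ j, C.IsSection (s j)) ∧
      ∀ y, C.Spans (fun j : Fin 3 × Fin (Module.finrank ℝ E + r + 1) => s (j.1, j.2)) y := by
  have : LocallyCompactSpace M := Manifold.locallyCompact_of_finiteDimensional I
  let K₀ := CompactExhaustion.choice M
  let K := K₀.shiftr
  have hK0 : K 0 = ∅ := rfl
  let O : ℕ → Set M := fun m => interior (K (m + 2)) \ K (m - 1)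
  let L : ℕ → Set M := fun m => K (m + 1) \ interior (K m)
  have hLc : ∀ m, IsCompact (L m) := fun m => (K.isCompact _).diff isOpen_interior
  have hLO : ∀ m, L m ⊆ O m := by
    rintro m y ⟨h1, h2⟩
    refine ⟨K.subset_interior (Nat.lt_succ_self _) h1, fun h3 => ?_⟩
    rcases m with _ | m
    · exact h3
    · exact h2 (K.subset_interior (Nat.lt_succ_self m) h3)
  have hOo : ∀ m, IsOpen (O m) := fun m => isOpen_interior.sdiff (K.isCompact _).isClosed
  have hOd : ∀ {m m' y}, y ∈ O m → y ∈ O m' → m' < m + 3 := fun {m m' y} h h' => by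
    by_contra hlt
    exact h'.2 (K.subset (by omega : m + 2 ≤ m' - 1) (interior_subset h.1))
  choose b hb0 hb1 _ using fun m => exists_contMDiffMap_zero_one_of_isClosed I (n := ⊤)
    (hOo m).isClosed_compl (hLc m).isClosed
    (Set.disjoint_left.2 fun y hy hy' => hy (hLO m hy'))
  have hbO : ∀ {m y}, b m y ≠ 0 → y ∈ O m := fun {m y} h => by
    by_contra hy
    exact h (hb0 m hy)
  have hlf : LocallyFinite fun m => Function.support (b m) := fun x => by
    obtain ⟨n, hn⟩ := K.exists_mem_nhds x
    refine ⟨K n, hn, (Set.finite_le_nat n).subset ?_⟩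
    rintro m ⟨y, hy, hyn⟩
    by_contra hlt
    rw [Set.mem_ofPred_eq, not_le] at hlt
    exact (hbO hy).2 (K.subset (by omega : n ≤ m - 1) hyn)
  choose s hs hsp using fun m => exists_fin_spans (C := C) (hLc m)
  let w : ℕ → ℕ → M → ℝ := fun c m y => if m % 3 = c then b m y else 0
  have hw : ∀ {c m y}, w c m y ≠ 0 → b m y ≠ 0 := fun {c m y} h h' => h (by simp [w, h'])
  have hwsm : ∀ c m, ContMDiff I 𝓘(ℝ, ℝ) ∞ (w c m) := fun c m => by
    by_cases h : m % 3 = c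
    · simp only [w, if_pos h]
      exact (b m).contMDiff
    · simp only [w, if_neg h]
      exact contMDiff_const
  let t : ℕ × Fin (Module.finrank ℝ E + r + 1) → ι → M → Fin r → ℝ := fun j a y i =>
    ∑ᶠ m, w j.1 m y * s m j.2 a y i
  have htsum : ∀ y, ∃ F : Finset ℕ, ∀ j a i, t j a y i = ∑ m ∈ F, w j.1 m y * s m j.2 a y i :=
    fun y => ⟨(hlf.point_finite y).toFinset, fun j a i =>
      finsum_eq_sum_of_support_subset _ fun m hm => (hlf.point_finite y).mem_toFinset.2
        (hw (left_ne_zero_of_mul hm))⟩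
  refine ⟨t, fun j => ⟨fun a i => ?_, fun {a b' x} ha hb' => funext fun k => ?_⟩,
    fun y a ha α hα => ?_⟩
  · refine contMDiffOn_finsum (hlf.subset fun m y hy => hw (left_ne_zero_of_mul hy)) fun m => ?_
    exact (hwsm _ m).contMDiffOn.mul ((hs m j.2).smooth a i)
  · obtain ⟨F, hF⟩ := htsum x
    simp only [vecMul, dotProduct, hF, Finset.sum_mul]
    rw [Finset.sum_comm]
    refine Finset.sum_congr rfl fun m _ => ?_
    rw [(hs m j.2).trans ha hb', vecMul, dotProduct, Finset.mul_sum]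
    exact Finset.sum_congr rfl fun i _ => (mul_assoc _ _ _).symm
  · obtain ⟨m, hm⟩ : ∃ m, y ∈ L m := ⟨K₀.find y, (K₀.mem_sdiff_shiftr_find y).1,
      fun h => (K₀.mem_sdiff_shiftr_find y).2 (interior_subset h)⟩
    refine hsp m y hm a ha α fun j => ?_
    have h1 := hα (⟨m % 3, Nat.mod_lt _ (by norm_num)⟩, j)
    have h2 : t (m % 3, j) a y = s m j a y := funext fun i => by
      refine (finsum_eq_single _ m fun m' hm' => ?_).trans ?_
      · by_contra hne
        have h3 : w (m % 3) m' y ≠ 0 := left_ne_zero_of_mul hne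
        have h4 := hOd (hLO m hm) (hbO (hw h3))
        have h5 := hOd (hbO (hw h3)) (hLO m hm)
        have h6 : m' % 3 = m % 3 := by
          by_contra h7
          exact h3 (if_neg h7)
        omega
      · simp only [w, if_true]
        rw [hb1 m hm, Pi.one_apply, one_mul]
    rw [← h2]
    exact h1

variable {C}

/-- If the transition matrices are block diagonal, then the components of a section are sections. -/
theorem IsSection.component {d : Fin r → ℤ}
    (hd : ∀ {a b x i j}, x ∈ C.U a → x ∈ C.U b → d i ≠ d j → C.G a b x i j = 0)
    {s : ι → M → Fin r → ℝ} (hs : C.IsSection s) (k : ℤ) :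
    C.IsSection fun a x i => if d i = k then s a x i else 0 where
  smooth a i := by
    by_cases h : d i = k
    · simp only [if_pos h]
      exact hs.smooth a i
    · simp only [if_neg h]
      exact contMDiffOn_const
  trans {a b x} ha hb := funext fun j => by
    rw [hs.trans ha hb]
    simp only [vecMul, dotProduct, ite_mul, zero_mul]
    split_ifs with hj
    · refine Finset.sum_congr rfl fun i _ => ?_
      split_ifs with hi
      · rfl
      · rw [hd ha hb fun h => hi (h.trans hj), mul_zero]
    · refine (Finset.sum_eq_zero fun i _ => ?_).symm
      split_ifs with hi
      · rw [hd ha hb fun h => hj (h.symm.trans hi), mul_zero]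
      · rfl

/-- The homogeneous components of spanning sections span. -/
theorem Spans.component {κ : Type*} {s : κ → ι → M → Fin r → ℝ} {x : M} (h : C.Spans s x)
    (d : Fin r → ℤ) :
    C.Spans (fun (j : κ × Fin r) a x i => if d i = d j.2 then s j.1 a x i else 0) x := by
  classical
  intro a ha α hα
  refine h a ha α fun j => ?_
  rw [dotProduct, ← Finset.sum_fiberwise_of_maps_to (t := Finset.univ.image d) (g := d)
    (fun i _ => Finset.mem_image_of_mem d (Finset.mem_univ i))]
  refine Finset.sum_eq_zero fun k hk => ?_
  obtain ⟨i₀, -, rfl⟩ := Finset.mem_image.1 hk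
  have := hα (j, i₀)
  simp only [dotProduct, ite_mul, zero_mul] at this
  rwa [Finset.sum_filter]

theorem contMDiffOn_det {n : ℕ} {U : Set M} {A : M → Matrix (Fin n) (Fin n) ℝ}
    (h : ∀ i j, ContMDiffOn I 𝓘(ℝ, ℝ) ∞ (fun x => A x i j) U) :
    ContMDiffOn I 𝓘(ℝ, ℝ) ∞ (fun x => (A x).det) U := by
  simp only [Matrix.det_apply']
  exact contMDiffOn_finsetSum fun σ _ => contMDiffOn_const.mul
    (contMDiffOn_finsetProd fun i _ => h _ _)

theorem contMDiffOn_inv {n : ℕ} {U : Set M} {A : M → Matrix (Fin n) (Fin n) ℝ}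
    (h : ∀ i j, ContMDiffOn I 𝓘(ℝ, ℝ) ∞ (fun x => A x i j) U) (hU : ∀ x ∈ U, (A x).det ≠ 0)
    (i j : Fin n) : ContMDiffOn I 𝓘(ℝ, ℝ) ∞ (fun x => (A x)⁻¹ i j) U := by
  simp only [Matrix.inv_def, Matrix.smul_apply, Ring.inverse_eq_inv', smul_eq_mul,
    Matrix.adjugate_apply]
  refine ((contMDiffOn_det h).inv₀ hU).mul (contMDiffOn_det fun k l => ?_)
  by_cases hk : k = j
  · subst hk
    simp only [Matrix.updateRow_self]
    exact contMDiffOn_const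
  · simp only [Matrix.updateRow_ne hk]
    exact h k l

/-- The Gram matrix of spanning sections is invertible. -/
theorem Spans.det_ne_zero {κ : Type*} [Fintype κ] {s : κ → ι → M → Fin r → ℝ} {x : M}
    (h : C.Spans s x) {a : ι} (ha : x ∈ C.U a) :
    ((Matrix.of fun j i => s j a x i)ᵀ * (Matrix.of fun j i => s j a x i)).det ≠ 0 := by
  intro h0
  obtain ⟨α, hα, h1⟩ := Matrix.exists_mulVec_eq_zero_iff.2 h0
  refine hα (h a ha α fun j => ?_)
  have h2 := congrArg (α ⬝ᵥ ·) h1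
  rw [← mulVec_mulVec] at h2
  simp only [dotProduct_zero] at h2
  rw [dotProduct_mulVec, vecMul_transpose] at h2
  exact congrFun (dotProduct_self_eq_zero.1 h2) j

/-- A matrix `Y` with `B Y` and `B` block diagonal, `B` invertible, is block diagonal. -/
theorem eq_zero_of_mul_graded {n : ℕ} {κ : Type*} {d : Fin n → ℤ} {δ : κ → ℤ}
    {B : Matrix (Fin n) (Fin n) ℝ} {Y : Matrix (Fin n) κ ℝ} (hdet : B.det ≠ 0)
    (hB : ∀ i j, d i ≠ d j → B i j = 0) (hY : ∀ i k, d i ≠ δ k → (B * Y) i k = 0) (i : Fin n)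
    (k : κ) (hik : d i ≠ δ k) : Y i k = 0 := by
  let Z : Matrix (Fin n) κ ℝ := Matrix.of fun i k => if d i = δ k then Y i k else 0
  have hBZ : B * Z = B * Y := by
    ext i' k'
    by_cases h : d i' = δ k'
    · rw [Matrix.mul_apply, Matrix.mul_apply]
      refine Finset.sum_congr rfl fun l _ => ?_
      by_cases hl : d l = δ k'
      · simp [Z, hl]
      · rw [hB i' l fun h' => hl (h'.symm.trans h), zero_mul, zero_mul]
    · rw [hY i' k' h, Matrix.mul_apply]
      refine Finset.sum_eq_zero fun l _ => ?_
      by_cases hl : d l = δ k'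
      · rw [hB i' l fun h' => h (h'.trans hl), zero_mul]
      · simp [Z, hl]
  have hu : IsUnit B.det := isUnit_iff_ne_zero.2 hdet
  have := congrArg (B⁻¹ * ·) hBZ
  simp only [Matrix.nonsing_inv_mul_cancel_left _ _ hu] at this
  rw [← this]
  simp [Z, hik]

variable (C)

/-- A graded vector bundle on an ordinary manifold has finitely many homogeneous global sections
`s j`, of degree `δ j`, and homogeneous dual sections, given by the columns of the matrices `T`,
such that `u = ∑ j, T_j(u) s j` for all sections `u`. The matrix `T` is the pseudoinverse of the
matrix of coefficients of the sections: for this choice it transforms correctly. -/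
theorem exists_dualBasis [FiniteDimensional ℝ E] [IsManifold I ∞ M] [T2Space M]
    [SecondCountableTopology M] [SigmaCompactSpace M] {d : Fin r → ℤ}
    (hd : ∀ {a b x i j}, x ∈ C.U a → x ∈ C.U b → d i ≠ d j → C.G a b x i j = 0) :
    ∃ (n : ℕ) (s : Fin n → ι → M → Fin r → ℝ) (δ : Fin n → ℤ)
      (T : ι → M → Matrix (Fin r) (Fin n) ℝ), (∀ j, C.IsSection (s j)) ∧
      (∀ j a x i, d i ≠ δ j → s j a x i = 0) ∧
      (∀ a i j, ContMDiffOn I 𝓘(ℝ, ℝ) ∞ (fun x => T a x i j) (C.U a)) ∧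
      (∀ a x, x ∈ C.U a → T a x * Matrix.of (fun j i => s j a x i) = 1) ∧
      (∀ a b x, x ∈ C.U a → x ∈ C.U b → C.G a b x * T b x = T a x) ∧
      (∀ a x i j, x ∈ C.U a → d i ≠ δ j → T a x i j = 0) := by
  obtain ⟨s₀, hs₀, hsp₀⟩ := C.exists_spans
  let κ := (Fin 3 × Fin (Module.finrank ℝ E + r + 1)) × Fin r
  let e : Fin (Fintype.card κ) ≃ κ := (Fintype.equivFin κ).symm
  let δ : Fin (Fintype.card κ) → ℤ := fun j => d (e j).2
  let s : Fin (Fintype.card κ) → ι → M → Fin r → ℝ := fun j a x i =>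
    if d i = δ j then s₀ ((e j).1.1, (e j).1.2) a x i else 0
  have hs : ∀ j, C.IsSection (s j) := fun j => (hs₀ _).component hd _
  have hsp : ∀ x, C.Spans s x := fun x => ((hsp₀ x).component d).mono fun j =>
    ⟨e.symm j, by simp only [s, δ, Equiv.apply_symm_apply]⟩
  have hs0 : ∀ j a x i, d i ≠ δ j → s j a x i = 0 := fun j a x i h => if_neg h
  let S : ι → M → Matrix (Fin (Fintype.card κ)) (Fin r) ℝ := fun a x =>
    Matrix.of fun j i => s j a x i
  let B : ι → M → Matrix (Fin r) (Fin r) ℝ := fun a x => (S a x)ᵀ * S a x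
  have hB : ∀ {a x}, x ∈ C.U a → (B a x).det ≠ 0 := fun {a x} ha => (hsp x).det_ne_zero ha
  have hBu : ∀ {a x}, x ∈ C.U a → IsUnit (B a x).det := fun ha => isUnit_iff_ne_zero.2 (hB ha)
  have hBT : ∀ {a x}, x ∈ C.U a → B a x * ((B a x)⁻¹ * (S a x)ᵀ) = (S a x)ᵀ := fun ha =>
    Matrix.mul_nonsing_inv_cancel_left _ _ (hBu ha)
  have hSG : ∀ {a b x}, x ∈ C.U a → x ∈ C.U b → S b x = S a x * C.G a b x := fun {a b x} ha hb => by
    ext j i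
    exact congrFun ((hs j).trans ha hb) i
  have hBsm : ∀ a i j, ContMDiffOn I 𝓘(ℝ, ℝ) ∞ (fun x => B a x i j) (C.U a) := fun a i j => by
    simp only [B, S, Matrix.mul_apply, Matrix.transpose_apply, Matrix.of_apply]
    exact contMDiffOn_finsetSum fun k _ => ((hs k).smooth a i).mul ((hs k).smooth a j)
  refine ⟨_, s, δ, fun a x => (B a x)⁻¹ * (S a x)ᵀ, hs, hs0, fun a i j => ?_, fun a x ha => ?_,
    fun a b x ha hb => ?_, fun a x i j ha hij => ?_⟩
  · simp only [Matrix.mul_apply, S, Matrix.transpose_apply, Matrix.of_apply]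
    exact contMDiffOn_finsetSum fun k _ =>
      (contMDiffOn_inv (hBsm a) (fun x hx => hB hx) i k).mul ((hs j).smooth a k)
  · change (B a x)⁻¹ * (S a x)ᵀ * S a x = 1
    rw [Matrix.mul_assoc]
    exact Matrix.nonsing_inv_mul _ (hBu ha)
  · -- Both sides solve the same normal equation, once the invertible factor `Gᵀ` is cancelled.
    have h1 := hBT hb
    have h2 : (C.G b a x)ᵀ * (C.G a b x)ᵀ = 1 := by
      rw [← Matrix.transpose_mul, C.mul ha hb ha, C.self ha, Matrix.transpose_one]
    have h4 : B b x = (C.G a b x)ᵀ * (B a x * C.G a b x) := by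
      simp only [B]
      rw [hSG ha hb, Matrix.transpose_mul]
      simp only [Matrix.mul_assoc]
    change C.G a b x * ((B b x)⁻¹ * (S b x)ᵀ) = (B a x)⁻¹ * (S a x)ᵀ
    generalize (B b x)⁻¹ * (S b x)ᵀ = P at h1 ⊢
    have h5 : (C.G a b x)ᵀ * (B a x * (C.G a b x * P)) = (C.G a b x)ᵀ * (S a x)ᵀ := by
      rw [← Matrix.transpose_mul, ← hSG ha hb, ← h1, h4]
      simp only [Matrix.mul_assoc]
    have h3 : B a x * (C.G a b x * P) = (S a x)ᵀ := by
      have := congrArg ((C.G b a x)ᵀ * ·) h5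
      simpa only [← Matrix.mul_assoc, h2, Matrix.one_mul] using this
    have h6 := congrArg ((B a x)⁻¹ * ·) h3
    simp only [Matrix.nonsing_inv_mul_cancel_left _ _ (hBu ha)] at h6
    exact h6
  · refine eq_zero_of_mul_graded (d := d) (δ := δ) (hB ha) (fun i k hik => ?_)
      (fun i k hik => ?_) i j hij
    · simp only [B, S, Matrix.mul_apply, Matrix.transpose_apply, Matrix.of_apply]
      refine Finset.sum_eq_zero fun l _ => ?_
      by_cases h : d i = δ l
      · rw [hs0 l a x k fun h' => hik (h.trans h'.symm), mul_zero]
      · rw [hs0 l a x i h, zero_mul]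
    · rw [hBT ha]
      exact hs0 k a x i hik

end SmoothCocycle

end Cocycle

/-! ### Graded manifolds of positive amplitude -/

section SymPos

variable {n : ℕ} {d : Fin n → ℤ}

theorem Sym.eps_coord (i : Fin n) : Sym.eps d (Sym.coord d i) = 0 := by
  have : Sym.eps d (Sym.coord d i) = FreeAlgebra.lift ℝ (fun _ => (0 : ℝ)) (FreeAlgebra.ι ℝ i) :=
    RingQuot.liftAlgHom_mkAlgHom_apply _ _ _ _
  rw [this, FreeAlgebra.lift_ι_apply]

theorem Sym.eps_of_mem_gr {k : ℤ} (hk : k ≠ 0) {a : Sym d} (ha : a ∈ Sym.gr d k) :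
    Sym.eps d a = 0 := by
  induction ha using Submodule.span_induction with
  | mem x hx =>
    obtain ⟨l, hl, rfl⟩ := hx
    rcases l with _ | ⟨i, l⟩
    · exact absurd hl.symm (by simpa using hk)
    · rw [List.map_cons, List.prod_cons, map_mul, Sym.eps_coord, zero_mul]
  | zero => exact map_zero _
  | add x y _ _ hx hy => rw [map_add, hx, hy, add_zero]
  | smul r x _ hx => rw [map_smul, hx, smul_zero]

theorem Sym.sum_deg_nonpos (hd : ∀ i, 0 < d i) (l : List (Fin n)) :
    (l.map fun i => -d i).sum ≤ 0 ∧ ((l.map fun i => -d i).sum = 0 → l = []) := by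
  induction l with
  | nil => simp
  | cons i l ih =>
    have := hd i
    rw [List.map_cons, List.sum_cons]
    exact ⟨by linarith [ih.1], fun h => by linarith [ih.1]⟩

/-- In positive amplitude the generators have negative degrees, hence so have all their products. -/
theorem Sym.eq_zero_of_mem_gr (hd : ∀ i, 0 < d i) {k : ℤ} (hk : 0 < k) {a : Sym d}
    (ha : a ∈ Sym.gr d k) : a = 0 := by
  have : Sym.gr d k = ⊥ := by
    rw [Sym.gr, Submodule.span_eq_bot]
    rintro _ ⟨l, hl, rfl⟩
    have := (Sym.sum_deg_nonpos hd l).1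
    omega
  rwa [this, Submodule.mem_bot] at ha

/-- In positive amplitude, the elements of degree zero are constants. -/
theorem Sym.algebraMap_eps_of_mem_gr (hd : ∀ i, 0 < d i) {a : Sym d} (ha : a ∈ Sym.gr d 0) :
    algebraMap ℝ (Sym d) (Sym.eps d a) = a := by
  induction ha using Submodule.span_induction with
  | mem x hx =>
    obtain ⟨l, hl, rfl⟩ := hx
    obtain rfl := (Sym.sum_deg_nonpos hd l).2 hl
    simp
  | zero => simp
  | add x y _ _ hx hy => rw [map_add, map_add, hx, hy]
  | smul r x _ hx => rw [map_smul, smul_eq_mul, map_mul, hx, ← Algebra.smul_def]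

theorem Sym.iSup_gr : ⨆ k, Sym.gr d k = ⊤ := by
  refine eq_top_iff.2 fun a _ => ?_
  have hmul : ∀ {a b : Sym d}, a ∈ ⨆ k, Sym.gr d k → b ∈ ⨆ k, Sym.gr d k →
      a * b ∈ ⨆ k, Sym.gr d k := by
    intro a b ha hb
    have h : (⨆ k, Sym.gr d k) * (⨆ k, Sym.gr d k) ≤ ⨆ k, Sym.gr d k := by
      rw [Submodule.iSup_mul]
      refine iSup_le fun i => ?_
      rw [Submodule.mul_iSup]
      refine iSup_le fun j => Submodule.mul_le.2 fun x hx y hy => ?_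
      exact Submodule.mem_iSup_of_mem (i + j) (Sym.mul_mem_gr d hx hy)
    exact h (Submodule.mul_mem_mul ha hb)
  obtain ⟨b, rfl⟩ := RingQuot.mkAlgHom_surjective ℝ (SymRel d) a
  induction b using FreeAlgebra.induction with
  | grade0 r =>
    rw [AlgHom.commutes]
    exact Submodule.mem_iSup_of_mem 0 (Sym.algebraMap_mem_gr d r)
  | grade1 i =>
    refine Submodule.mem_iSup_of_mem (-d i) (Submodule.subset_span ⟨[i], by simp, ?_⟩)
    simp only [List.map_cons, List.map_nil, List.prod_cons, List.prod_nil, mul_one]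
    rfl
  | mul a b ha hb =>
    rw [map_mul]
    exact hmul (ha trivial) (hb trivial)
  | add a b ha hb =>
    rw [map_add]
    exact Submodule.add_mem _ (ha trivial) (hb trivial)

end SymPos

section Aug

variable {E : Type*} [NormedAddCommGroup E] [NormedSpace ℝ E] {H : Type*} [TopologicalSpace H]
  {I : ModelWithCorners ℝ E H} {M : Type u} [TopologicalSpace M] [ChartedSpace H M]

/-- Transition functions preserve the augmentation, because they preserve degrees and because in
positive amplitude all elements of degree zero are constants. -/
theorem LocalTriv.eps_trans {A : GradedAlgebraSheaf I M} {n : ℕ} {d : Fin n → ℤ}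
    (hd : ∀ i, 0 < d i) (τ τ' : LocalTriv A d) {x : M} (hx : x ∈ τ.U) (hx' : x ∈ τ'.U)
    (c : Sym d) : Sym.eps d (τ.trans τ' hx hx' c) = Sym.eps d c := by
  have hc : c ∈ ⨆ k, Sym.gr d k := Sym.iSup_gr (d := d) ▸ Submodule.mem_top
  induction hc using Submodule.iSup_induction' with
  | mem k c hc =>
    by_cases hk : k = 0
    · subst hk
      rw [← Sym.algebraMap_eps_of_mem_gr hd hc, τ.trans_algebraMap]
    · rw [Sym.eps_of_mem_gr hk hc, Sym.eps_of_mem_gr hk (τ.trans_mem_gr τ' hx hx' hc)]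
  | zero => rw [map_zero]
  | add c c' _ _ hc hc' => rw [map_add, map_add, map_add, hc, hc']

namespace GradedManifold

variable {X : GradedManifold I M}

/-- The value at a point of the base of a section of the structure sheaf; in positive amplitude, it
does not depend on the local trivialisation. -/
noncomputable def augAt (X : GradedManifold I M) {W : Opens M} {x : M} (hx : x ∈ W) :
    X.sec W →+* ℝ :=
  (Sym.eps X.deg : Sym X.deg →+* ℝ).comp
    ((X.exists_triv x).choose.val hx (X.exists_triv x).choose_spec)

theorem augAt_eq (hX : X.PositiveAmplitude) {W : Opens M} {x : M} (hx : x ∈ W) (τ : X.Triv)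
    (hτ : x ∈ τ.U) (a : X.sec W) : X.augAt hx a = Sym.eps X.deg (τ.val hx hτ a) := by
  refine (congrArg (Sym.eps X.deg) (τ.val_eq_trans (X.exists_triv x).choose hx hτ
    (X.exists_triv x).choose_spec a)).trans ?_
  exact LocalTriv.eps_trans hX _ _ _ _ _

theorem augAt_res {W W' : Opens M} (h : W' ≤ W) {x : M} (hx : x ∈ W')
    (a : X.sec W) : X.augAt hx (X.res h a) = X.augAt (h hx) a :=
  congrArg (Sym.eps X.deg) (LocalTriv.val_res _ h hx _ a)

theorem augAt_algebraMap {W : Opens M} {x : M} (hx : x ∈ W) (f : Smooth I W) :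
    X.augAt hx (algebraMap _ _ f) = f ⟨x, hx⟩ :=
  (congrArg (Sym.eps X.deg) (LocalTriv.val_algebraMap _ hx _ f)).trans (Sym.eps_algebraMap _ _)

theorem augAt_of_mem_gr {W : Opens M} {x : M} (hx : x ∈ W) {k : ℤ} (hk : k ≠ 0) {a : X.sec W}
    (ha : a ∈ X.gr k W) : X.augAt hx a = 0 :=
  Sym.eps_of_mem_gr hk (LocalTriv.val_mem_gr _ hx _ ha)

theorem eq_zero_of_mem_gr (hX : X.PositiveAmplitude) {W : Opens M} {k : ℤ} (hk : 0 < k)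
    {a : X.sec W} (ha : a ∈ X.gr k W) : a = 0 := by
  refine X.ext_val fun τ x hW hx => ?_
  rw [map_zero]
  exact Sym.eq_zero_of_mem_gr hX hk (τ.val_mem_gr hW hx ha)

/-- In degree zero, a section of the structure sheaf is determined by its values at the points. -/
theorem eq_zero_of_augAt (hX : X.PositiveAmplitude) {W : Opens M} {a : X.sec W}
    (ha : a ∈ X.gr 0 W) (h : ∀ x (hx : x ∈ W), X.augAt hx a = 0) : a = 0 := by
  refine X.ext_val fun τ x hW hx => ?_
  rw [map_zero, ← Sym.algebraMap_eps_of_mem_gr hX (τ.val_mem_gr hW hx ha),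
    ← augAt_eq hX hW τ hx, h, map_zero]

theorem contMDiff_augAt (hX : X.PositiveAmplitude) {W : Opens M} (a : X.sec W) :
    ContMDiff I 𝓘(ℝ, ℝ) ∞ fun x : W => X.augAt x.2 a := by
  refine contMDiff_of_locally fun x hx => ?_
  obtain ⟨τ, hτ⟩ := X.exists_triv x
  refine ⟨W ⊓ τ.U, inf_le_left, ⟨hx, hτ⟩, ?_⟩
  have := eps_contMDiff (τ.val_mem_stdSections a)
  simp only [← augAt_eq hX] at this
  exact this

/-- The augmentation, from sections of the structure sheaf to smooth functions on the base. -/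
noncomputable def aug (hX : X.PositiveAmplitude) (V : Opens M) : X.sec V →+* Smooth I V where
  toFun a := ⟨fun x => X.augAt x.2 a, contMDiff_augAt hX a⟩
  map_one' := ContMDiffMap.ext fun x => map_one (X.augAt x.2)
  map_zero' := ContMDiffMap.ext fun x => map_zero (X.augAt x.2)
  map_mul' a b := ContMDiffMap.ext fun x => map_mul (X.augAt x.2) a b
  map_add' a b := ContMDiffMap.ext fun x => map_add (X.augAt x.2) a b

theorem aug_mem_functionGr (hX : X.PositiveAmplitude) {k : ℤ} {V : Opens M} {a : X.sec V}
    (ha : a ∈ X.gr k V) : aug hX V a ∈ functionGr I k V := by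
  by_cases hk : k = 0
  · simp [functionGr, hk]
  · rw [functionGr, if_neg hk, Submodule.mem_bot]
    exact ContMDiffMap.ext fun x => augAt_of_mem_gr x.2 hk ha

/-- The inclusion of the base into a graded manifold of positive amplitude. -/
noncomputable def zeroHom (hX : X.PositiveAmplitude) : Hom (ofManifold I M) X where
  base := ContMDiffMap.id
  pull V := aug hX V
  pull_res h b := ContMDiffMap.ext fun x => augAt_res h x.2 b
  pull_algebraMap g := ContMDiffMap.ext fun x => augAt_algebraMap x.2 g
  pull_mem_gr hb := aug_mem_functionGr hX hb

theorem zeroHom_pullTo (hX : X.PositiveAmplitude) {V W : Opens M}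
    (h : W ≤ pre (zeroHom hX).base V) (b : X.sec V) :
    (zeroHom hX).pullTo h b = aug hX W (X.res (show W ≤ V from h) b) :=
  ContMDiffMap.ext fun x => (augAt_res (X := X) (show W ≤ V from h) x.2 b).symm

end GradedManifold

end Aug

/-! ### Locally finite sums of functions on a graded manifold -/

section Sum

variable {E : Type*} [NormedAddCommGroup E] [NormedSpace ℝ E] {H : Type*} [TopologicalSpace H]
  {I : ModelWithCorners ℝ E H} {M : Type u} [TopologicalSpace M] [ChartedSpace H M]

/-- The extension by zero of `ρ s` is smooth, for `s` defined over a neighbourhood of the support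
of `ρ`. -/
theorem LocalTriv.smul_extend_mem {A : GradedAlgebraSheaf I M} {n : ℕ} {d : Fin n → ℤ}
    (τ : LocalTriv A d) (ρ : C^∞⟮I, M; 𝓘(ℝ, ℝ), ℝ⟯) {U W : Opens M} (hU : tsupport ρ ⊆ U)
    (s : A.sec (W ⊓ U)) (v : M → Sym d)
    (hv : ∀ x (hW : x ∈ W) (hU : x ∈ U) (hx : x ∈ τ.U),
      v x = τ.val (Opens.mem_inf.2 ⟨hW, hU⟩) hx s) :
    (fun x : (W ⊓ τ.U : Opens M) => ρ x • v x) ∈ stdSections I d (W ⊓ τ.U) := by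
  refine mem_stdSections_of_locally fun x hx => ?_
  by_cases hxU : x ∈ U
  · refine ⟨(W ⊓ U) ⊓ τ.U, inf_le_inf_right _ inf_le_left, ⟨⟨hx.1, hxU⟩, hx.2⟩, ?_⟩
    have h1 : ContMDiff I 𝓘(ℝ, ℝ) ∞ fun y : (W ⊓ U ⊓ τ.U : Opens M) => ρ y :=
      ρ.contMDiff.comp contMDiff_subtype_val
    convert (stdSections I d _).mul_mem (algebraMap_mem_stdSections (d := d) ⟨_, h1⟩)
      (τ.val_mem_stdSections s) using 1
    funext y
    rw [Pi.mul_apply, ← hv y y.2.1.1 y.2.1.2 y.2.2, Algebra.smul_def]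
    rfl
  · refine ⟨(W ⊓ τ.U) ⊓ ⟨(tsupport ρ)ᶜ, (isClosed_tsupport _).isOpen_compl⟩, inf_le_left,
      ⟨hx, fun h => hxU (hU h)⟩, ?_⟩
    convert (stdSections I d
      ((W ⊓ τ.U) ⊓ ⟨(tsupport ρ)ᶜ, (isClosed_tsupport _).isOpen_compl⟩)).zero_mem using 1
    funext y
    exact (congrArg (· • v y) (image_eq_zero_of_notMem_tsupport y.2.2)).trans (zero_smul _ _)

/-- Locally finite sums `∑ₐ ρₐ sₐ`, with `sₐ` a section over an open set that contains the support
of the smooth function `ρₐ`. -/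
theorem GradedManifold.exists_sum_smul (X : GradedManifold I M) {ι : Type*}
    (ρ : ι → C^∞⟮I, M; 𝓘(ℝ, ℝ), ℝ⟯) (hρ : LocallyFinite fun a => Function.support (ρ a))
    (U : ι → Opens M) (hU : ∀ a, tsupport (ρ a) ⊆ U a) (W : Opens M)
    (s : ∀ a, X.sec (W ⊓ U a)) :
    ∃ b : X.sec W, ∀ (τ : X.Triv) (x : M) (hW : x ∈ W) (hx : x ∈ τ.U) (F : Finset ι)
      (v : ι → Sym X.deg), (∀ a ∉ F, ρ a x = 0) →
      (∀ a (h : x ∈ U a), v a = τ.val (Opens.mem_inf.2 ⟨hW, h⟩) hx (s a)) →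
      τ.val hW hx b = ∑ a ∈ F, ρ a x • v a := by
  classical
  let v : X.Triv → M → ι → Sym X.deg := fun τ x a =>
    if h : x ∈ W ∧ x ∈ U a ∧ x ∈ τ.U then τ.val (Opens.mem_inf.2 ⟨h.1, h.2.1⟩) h.2.2 (s a) else 0
  have hv : ∀ τ x a (h1 : x ∈ W) (h2 : x ∈ U a) (h3 : x ∈ τ.U),
      v τ x a = τ.val (Opens.mem_inf.2 ⟨h1, h2⟩) h3 (s a) :=
    fun τ x a h1 h2 h3 => dif_pos ⟨h1, h2, h3⟩
  have hρU : ∀ {a x}, x ∉ U a → ρ a x = 0 := fun {a x} h =>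
    image_eq_zero_of_notMem_tsupport fun h' => h (hU a h')
  let Fx : M → Finset ι := fun x => (hρ.point_finite x).toFinset
  have hFx : ∀ x a, ρ a x ≠ 0 → a ∈ Fx x := fun x a h => (hρ.point_finite x).mem_toFinset.2 h
  -- The value of the sum at a point can be computed with any large enough finite set of indices.
  have hsum : ∀ (x : M) (F : Finset ι) (w w' : ι → Sym X.deg), (∀ a ∉ F, ρ a x = 0) →
      (∀ a, x ∈ U a → w a = w' a) → ∑ a ∈ Fx x, ρ a x • w a = ∑ a ∈ F, ρ a x • w' a := by
    intro x F w w' hF hw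
    have h1 : ∀ (G G' : Finset ι) (w : ι → Sym X.deg), (∀ a ∉ G, ρ a x = 0) →
        ∑ a ∈ G ∪ G', ρ a x • w a = ∑ a ∈ G, ρ a x • w a := fun G G' w hG =>
      (Finset.sum_subset Finset.subset_union_left fun a _ ha => by rw [hG a ha, zero_smul]).symm
    rw [← h1 (Fx x) F w fun a ha => by_contra fun h => ha (hFx x a h), Finset.union_comm,
      h1 F (Fx x) w hF]
    refine Finset.sum_congr rfl fun a _ => ?_
    by_cases ha : x ∈ U a
    · rw [hw a ha]
    · rw [hρU ha, zero_smul, zero_smul]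
  obtain ⟨b, hb⟩ := X.exists_of_val (W := W)
    (fun τ => ⟨fun x => ∑ a ∈ Fx x, ρ a x • v τ x a, by
      refine mem_stdSections_of_locally fun x hx => ?_
      obtain ⟨t, ht, hfin⟩ := hρ x
      obtain ⟨t', ht', ht'o, hxt'⟩ := mem_nhds_iff.1 ht
      refine ⟨(W ⊓ τ.U) ⊓ ⟨t', ht'o⟩, inf_le_left, ⟨hx, hxt'⟩, ?_⟩
      have h1 : ∀ y : ((W ⊓ τ.U) ⊓ ⟨t', ht'o⟩ : Opens M), ∀ a ∉ hfin.toFinset, ρ a y = 0 :=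
        fun y a ha => by
          by_contra hne
          exact ha (hfin.mem_toFinset.2 ⟨y, hne, ht' y.2.2⟩)
      have h2 : (fun y : ((W ⊓ τ.U) ⊓ ⟨t', ht'o⟩ : Opens M) => ∑ a ∈ Fx y, ρ a y • v τ y a) =
          ∑ a ∈ hfin.toFinset, fun y : ((W ⊓ τ.U) ⊓ ⟨t', ht'o⟩ : Opens M) => ρ a y • v τ y a := by
        funext y
        rw [Finset.sum_apply]
        exact hsum y _ _ _ (h1 y) fun _ _ => rfl
      rw [h2]
      refine sum_mem fun a _ => ?_
      exact res_mem_stdSections inf_le_left (τ.smul_extend_mem (ρ a) (hU a) (s a)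
        (fun x => v τ x a) fun x hW hU hx => hv τ x a hW hU hx)⟩)
    (fun τ τ' x hW hx hx' => by
      change ∑ a ∈ Fx x, ρ a x • v τ' x a = τ.trans τ' hx hx' (∑ a ∈ Fx x, ρ a x • v τ x a)
      rw [map_sum]
      refine Finset.sum_congr rfl fun a _ => ?_
      rw [τ.trans_smul]
      by_cases ha : x ∈ U a
      · rw [hv τ x a hW ha hx, hv τ' x a hW ha hx',
          τ.val_eq_trans τ' (Opens.mem_inf.2 ⟨hW, ha⟩) hx hx']
      · rw [hρU ha, zero_smul, zero_smul])
  refine ⟨b, fun τ x hW hx F w hF hw => ?_⟩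
  rw [hb τ x hW hx]
  refine hsum x F _ w hF fun a ha => ?_
  rw [hw a ha]
  exact hv τ x a hW ha hx

end Sum

/-! ### Change of frame -/

section ChangeFrame

open Matrix

variable {E : Type*} [NormedAddCommGroup E] [NormedSpace ℝ E] {H : Type*} [TopologicalSpace H]
  {I : ModelWithCorners ℝ E H} {M : Type u} [TopologicalSpace M] [ChartedSpace H M]

/-- A matrix with entries in degrees `dᵢ - dⱼ`, i.e. a degree-preserving endomorphism of the free
graded module on a basis of degrees `d₁, …, dᵣ`. -/
def GradedAlgebraSheaf.IsGradedMatrix (A : GradedAlgebraSheaf I M) {r : ℕ} (d : Fin r → ℤ)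
    {W : Opens M} (K : Matrix (Fin r) (Fin r) (A.sec W)) : Prop :=
  ∀ i j, K i j ∈ A.gr (d i - d j) W

namespace GradedAlgebraSheaf.IsGradedMatrix

variable {A : GradedAlgebraSheaf I M} {r : ℕ} {d : Fin r → ℤ} {W : Opens M}
  {K L : Matrix (Fin r) (Fin r) (A.sec W)}

theorem one : A.IsGradedMatrix d (1 : Matrix (Fin r) (Fin r) (A.sec W)) := fun i j => by
  rcases eq_or_ne i j with rfl | h
  · rw [Matrix.one_apply_eq, sub_self]
    exact A.one_mem_gr W
  · rw [Matrix.one_apply_ne h]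
    exact Submodule.zero_mem _

theorem mul (hK : A.IsGradedMatrix d K) (hL : A.IsGradedMatrix d L) :
    A.IsGradedMatrix d (K * L) := fun i j => by
  rw [Matrix.mul_apply]
  refine Submodule.sum_mem _ fun k _ => ?_
  have := A.mul_mem_gr (hK i k) (hL k j)
  rwa [sub_add_sub_cancel] at this

theorem sub (hK : A.IsGradedMatrix d K) (hL : A.IsGradedMatrix d L) :
    A.IsGradedMatrix d (K - L) := fun i j => Submodule.sub_mem _ (hK i j) (hL i j)

theorem pow (hK : A.IsGradedMatrix d K) (m : ℕ) : A.IsGradedMatrix d (K ^ m) := by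
  induction m with
  | zero => rw [pow_zero]; exact one
  | succ m ih => rw [pow_succ]; exact ih.mul hK

theorem vecMul (hK : A.IsGradedMatrix d K) {k : ℤ} {c : Fin r → A.sec W}
    (hc : ∀ i, c i ∈ A.gr (k - d i) W) (j : Fin r) : (c ᵥ* K) j ∈ A.gr (k - d j) W := by
  change ∑ i, c i * K i j ∈ _
  refine Submodule.sum_mem _ fun i _ => ?_
  have := A.mul_mem_gr (hc i) (hK i j)
  rwa [sub_add_sub_cancel] at this

theorem res (hK : A.IsGradedMatrix d K) {W' : Opens M} (h : W' ≤ W) :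
    A.IsGradedMatrix d (K.map (A.res h)) := fun i j => A.res_mem_gr h (hK i j)

end GradedAlgebraSheaf.IsGradedMatrix

/-- A graded matrix whose degree zero part is the identity is invertible in positive amplitude: its
difference from the identity is strictly triangular with respect to the degrees. -/
theorem exists_inverse_of_unipotent {X : GradedManifold I M} (hX : X.PositiveAmplitude) {r : ℕ}
    {d : Fin r → ℤ} {W : Opens M} {K : Matrix (Fin r) (Fin r) (X.sec W)}
    (hK : X.IsGradedMatrix d K) (h1 : ∀ x (hx : x ∈ W) i j,
      X.augAt hx (K i j) = if i = j then 1 else 0) :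
    ∃ L, X.IsGradedMatrix d L ∧ K * L = 1 ∧ L * K = 1 := by
  set N : Matrix (Fin r) (Fin r) (X.sec W) := 1 - K with hN
  have hNg : X.IsGradedMatrix d N := GradedAlgebraSheaf.IsGradedMatrix.one.sub hK
  -- Entries of positive degree vanish, and so do those of degree zero by hypothesis.
  have hN0 : ∀ i j, d j ≤ d i → N i j = 0 := fun i j hij => by
    rcases hij.lt_or_eq with h | h
    · exact X.eq_zero_of_mem_gr hX (sub_pos.2 h) (hNg i j)
    · have h2 := hNg i j
      rw [h, sub_self] at h2
      refine X.eq_zero_of_augAt hX h2 fun x hx => ?_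
      rw [hN, Matrix.sub_apply, map_sub, h1, Matrix.one_apply]
      split_ifs <;> simp
  have hpow : ∀ (m : ℕ) i j, d j < d i + m → (N ^ m) i j = 0 := by
    intro m
    induction m with
    | zero =>
      intro i j hij
      rw [pow_zero, Matrix.one_apply_ne]
      rintro rfl
      simp at hij
    | succ m ih =>
      intro i j hij
      rw [pow_succ, Matrix.mul_apply]
      refine Finset.sum_eq_zero fun k _ => ?_
      rcases lt_or_ge (d k) (d i + m) with h | h
      · rw [ih i k h, zero_mul]
      · rw [hN0 k j (by push_cast at hij; omega), mul_zero]
  obtain ⟨m, hm⟩ : ∃ m : ℕ, N ^ m = 0 := by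
    -- This exponent exceeds all of the differences `d j - d i`.
    refine ⟨∑ i, 2 * (d i).natAbs + 1, Matrix.ext fun i j => hpow _ i j ?_⟩
    have h2 := Finset.single_le_sum (f := fun i => 2 * (d i).natAbs) (fun _ _ => Nat.zero_le _)
      (Finset.mem_univ i)
    have h3 := Finset.single_le_sum (f := fun i => 2 * (d i).natAbs) (fun _ _ => Nat.zero_le _)
      (Finset.mem_univ j)
    omega
  have hKN : K = 1 - N := by rw [hN, sub_sub_cancel]
  refine ⟨∑ k ∈ Finset.range m, N ^ k, fun i j => ?_, ?_, ?_⟩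
  · rw [Matrix.sum_apply]
    exact Submodule.sum_mem _ fun k _ => hNg.pow k i j
  · rw [hKN, mul_neg_geom_sum, hm, sub_zero]
  · rw [hKN, geom_sum_mul_neg, hm, sub_zero]

namespace LocalFrame

variable {A : GradedAlgebraSheaf I M} {F : GradedModuleSheaf A} {r : ℕ} {d : Fin r → ℤ}
  (φ : LocalFrame F d) {K L : Matrix (Fin r) (Fin r) (A.sec φ.U)}

/-- The rows of `K`, read as coefficients in the frame `φ`, are the vectors of a new frame; here is
the section with coefficients `c` in it. -/
theorem sum_smul_res_lin {W : Opens M} (h : W ≤ φ.U) (c : Fin r → A.sec W) :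
    ∑ i, c i • F.res h (φ.lin le_rfl (K i)) = φ.lin h (c ᵥ* K.map (A.res h)) := by
  simp only [res_lin, ← lin_smul]
  simp only [lin, Matrix.vecMul, dotProduct, Finset.sum_smul, Pi.smul_apply, smul_eq_mul]
  exact Finset.sum_comm

theorem map_res_mul_map_res {W W' : Opens M} (h : W' ≤ W)
    {K L : Matrix (Fin r) (Fin r) (A.sec W)} (hKL : K * L = 1) :
    K.map (A.res h) * L.map (A.res h) = 1 := by
  rw [← Matrix.map_mul, hKL, Matrix.map_one _ (map_zero _) (map_one _)]

/-- The frame `Kφ`, for an invertible matrix `K` of degree zero. -/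
noncomputable def changeBasis (hK : A.IsGradedMatrix d K) (hL : A.IsGradedMatrix d L)
    (hKL : K * L = 1) (hLK : L * K = 1) : LocalFrame F d where
  U := φ.U
  e i := φ.lin le_rfl (K i)
  existsUnique {W} h s := by
    simp only [sum_smul_res_lin]
    refine ⟨φ.coord h s ᵥ* L.map (A.res h), ?_, fun c hc => ?_⟩
    · change s = φ.lin h (_ ᵥ* _)
      rw [Matrix.vecMul_vecMul, map_res_mul_map_res h hLK, Matrix.vecMul_one, lin_coord]
    · change s = φ.lin h (_ ᵥ* _) at hc
      rw [hc, coord_lin, Matrix.vecMul_vecMul, map_res_mul_map_res h hKL, Matrix.vecMul_one]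
  mem_gr_iff {W} h k c := by
    rw [sum_smul_res_lin, mem_gr_iff_coord φ h, coord_lin]
    refine ⟨fun hc => ?_, fun hc => (hK.res h).vecMul hc⟩
    have := (hL.res h).vecMul hc
    rwa [Matrix.vecMul_vecMul, map_res_mul_map_res h hKL, Matrix.vecMul_one] at this

theorem changeBasis_lin (hK : A.IsGradedMatrix d K) (hL : A.IsGradedMatrix d L)
    (hKL : K * L = 1) (hLK : L * K = 1) {W : Opens M} (h : W ≤ φ.U) (c : Fin r → A.sec W) :
    (φ.changeBasis hK hL hKL hLK).lin h c = φ.lin h (c ᵥ* K.map (A.res h)) :=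
  φ.sum_smul_res_lin h c

end LocalFrame

end ChangeFrame

/-! ### Restriction to the base and adapted frames -/

section BaseCocycle

open Matrix

variable {E : Type*} [NormedAddCommGroup E] [NormedSpace ℝ E] {H : Type*} [TopologicalSpace H]
  {I : ModelWithCorners ℝ E H} {M : Type u} [TopologicalSpace M] [ChartedSpace H M]
  {X : GradedManifold I M}

open Classical in
theorem contMDiffOn_extend {U : Opens M} (f : Smooth I U) :
    ContMDiffOn I 𝓘(ℝ, ℝ) ∞ (fun x => if h : x ∈ U then f ⟨x, h⟩ else 0) U := by
  intro x hx
  refine ContMDiffAt.contMDiffWithinAt ((contMDiffAt_subtype_iff (x := (⟨x, hx⟩ : U))).1 ?_)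
  convert f.contMDiff ⟨x, hx⟩ using 1
  funext y
  exact dif_pos y.2

namespace GradedVectorBundle

variable (F : GradedVectorBundle X)

open Classical in
/-- The degree zero parts of the transition matrices of a bundle in positive amplitude; they are the
transition matrices of the restriction of the bundle to the base. -/
noncomputable def baseTrans (φ ψ : F.Frame) (x : M) : Matrix (Fin F.rank) (Fin F.rank) ℝ :=
  Matrix.of fun i j => if h : x ∈ φ.U ⊓ ψ.U then X.augAt h (φ.trans ψ i j) else 0

variable {F}

theorem baseTrans_apply {φ ψ : F.Frame} {x : M} {W : Opens M} (hx : x ∈ W) (h : W ≤ φ.U ⊓ ψ.U)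
    (i j : Fin F.rank) : F.baseTrans φ ψ x i j = X.augAt hx (X.res h (φ.trans ψ i j)) :=
  (dif_pos (h hx)).trans (X.augAt_res h hx _).symm

theorem baseTrans_eq_zero {φ ψ : F.Frame} {x : M} (hφ : x ∈ φ.U) (hψ : x ∈ ψ.U) {i j : Fin F.rank}
    (h : F.deg i ≠ F.deg j) : F.baseTrans φ ψ x i j = 0 := by
  rw [baseTrans_apply (W := φ.U ⊓ ψ.U) ⟨hφ, hψ⟩ le_rfl, X.res_refl]
  exact X.augAt_of_mem_gr _ (sub_ne_zero.2 h) (φ.trans_mem_gr ψ i j)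

theorem baseTrans_self {φ : F.Frame} {x : M} (hφ : x ∈ φ.U) : F.baseTrans φ φ x = 1 := by
  ext i j
  rw [baseTrans_apply (W := φ.U ⊓ φ.U) ⟨hφ, hφ⟩ le_rfl, X.res_refl, φ.trans_self,
    Matrix.one_apply]
  split_ifs <;> simp

theorem baseTrans_mul {φ ψ χ : F.Frame} {x : M} (hφ : x ∈ φ.U) (hψ : x ∈ ψ.U) (hχ : x ∈ χ.U) :
    F.baseTrans φ ψ x * F.baseTrans ψ χ x = F.baseTrans φ χ x := by
  ext i j
  have hx : x ∈ φ.U ⊓ ψ.U ⊓ χ.U := ⟨⟨hφ, hψ⟩, hχ⟩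
  have h1 : φ.U ⊓ ψ.U ⊓ χ.U ≤ φ.U ⊓ ψ.U := inf_le_left
  have h2 : φ.U ⊓ ψ.U ⊓ χ.U ≤ ψ.U ⊓ χ.U := inf_le_inf_right _ inf_le_right
  have h3 : φ.U ⊓ ψ.U ⊓ χ.U ≤ φ.U ⊓ χ.U := inf_le_inf_right _ inf_le_left
  rw [Matrix.mul_apply, baseTrans_apply hx h3, φ.trans_trans ψ χ h1 h2 h3, map_sum]
  refine Finset.sum_congr rfl fun k _ => ?_
  rw [map_mul, baseTrans_apply hx h1, baseTrans_apply hx h2]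

theorem contMDiffOn_baseTrans (hX : X.PositiveAmplitude) (φ ψ : F.Frame) (i j : Fin F.rank) :
    ContMDiffOn I 𝓘(ℝ, ℝ) ∞ (fun x => F.baseTrans φ ψ x i j) (φ.U ⊓ ψ.U : Opens M) :=
  contMDiffOn_extend (X.aug hX (φ.U ⊓ ψ.U) (φ.trans ψ i j))

variable (F) in
/-- The restriction to the base of a vector bundle over a graded manifold of positive amplitude. -/
noncomputable def baseCocycle (hX : X.PositiveAmplitude) : SmoothCocycle I M F.Frame F.rank where
  U φ := φ.U
  cover := F.exists_frame
  G := F.baseTrans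
  smooth := contMDiffOn_baseTrans hX
  self hx := baseTrans_self hx
  mul hφ hψ hχ := baseTrans_mul hφ hψ hχ

open Classical in
/-- The local expressions of the transition matrices, with value zero where these make no sense. -/
noncomputable def transVal (τ : X.Triv) (φ ψ : F.Frame) (x : M) :
    Matrix (Fin F.rank) (Fin F.rank) (Sym X.deg) :=
  Matrix.of fun i j =>
    if h : x ∈ φ.U ⊓ ψ.U ∧ x ∈ τ.U then τ.val h.1 h.2 (φ.trans ψ i j) else 0

theorem transVal_apply {τ : X.Triv} {φ ψ : F.Frame} {x : M} {W : Opens M} (hx : x ∈ W)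
    (h : W ≤ φ.U ⊓ ψ.U) (hτ : x ∈ τ.U) (i j : Fin F.rank) :
    transVal τ φ ψ x i j = τ.val hx hτ (X.res h (φ.trans ψ i j)) :=
  (dif_pos ⟨h hx, hτ⟩).trans (τ.val_res h hx hτ _).symm

theorem transVal_mul {τ : X.Triv} {φ ψ χ : F.Frame} {x : M} (hτ : x ∈ τ.U) (hφ : x ∈ φ.U)
    (hψ : x ∈ ψ.U) (hχ : x ∈ χ.U) :
    transVal τ φ ψ x * transVal τ ψ χ x = transVal τ φ χ x := by
  ext i j
  have hx : x ∈ φ.U ⊓ ψ.U ⊓ χ.U := ⟨⟨hφ, hψ⟩, hχ⟩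
  have h1 : φ.U ⊓ ψ.U ⊓ χ.U ≤ φ.U ⊓ ψ.U := inf_le_left
  have h2 : φ.U ⊓ ψ.U ⊓ χ.U ≤ ψ.U ⊓ χ.U := inf_le_inf_right _ inf_le_right
  have h3 : φ.U ⊓ ψ.U ⊓ χ.U ≤ φ.U ⊓ χ.U := inf_le_inf_right _ inf_le_left
  rw [Matrix.mul_apply, transVal_apply hx h3 hτ, φ.trans_trans ψ χ h1 h2 h3, map_sum]
  refine Finset.sum_congr rfl fun k _ => ?_
  rw [map_mul, transVal_apply hx h1 hτ, transVal_apply hx h2 hτ]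

theorem eps_transVal (hX : X.PositiveAmplitude) {τ : X.Triv} {φ ψ : F.Frame} {x : M} (hτ : x ∈ τ.U)
    (hφ : x ∈ φ.U) (hψ : x ∈ ψ.U) (i j : Fin F.rank) :
    Sym.eps X.deg (transVal τ φ ψ x i j) = F.baseTrans φ ψ x i j := by
  have hx : x ∈ φ.U ⊓ ψ.U := ⟨hφ, hψ⟩
  rw [transVal_apply hx le_rfl hτ, baseTrans_apply hx le_rfl, X.augAt_eq hX hx τ hτ]

theorem transVal_mem_gr {τ : X.Triv} {φ ψ : F.Frame} {x : M} (i j : Fin F.rank) :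
    transVal τ φ ψ x i j ∈ Sym.gr X.deg (F.deg i - F.deg j) := by
  by_cases h : x ∈ φ.U ⊓ ψ.U ∧ x ∈ τ.U
  · rw [transVal_apply h.1 le_rfl h.2]
    exact τ.val_mem_gr _ _ (X.res_mem_gr _ (φ.trans_mem_gr ψ i j))
  · have : transVal τ φ ψ x i j = 0 := dif_neg h
    rw [this]
    exact Submodule.zero_mem _

/-- The matrices of the restricted bundle, as matrices of smooth functions on an open set. -/
noncomputable def baseMatrix (hX : X.PositiveAmplitude) (φ ψ : F.Frame) {W : Opens M}
    (h : W ≤ φ.U ⊓ ψ.U) : Matrix (Fin F.rank) (Fin F.rank) (Smooth I W) :=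
  Matrix.of fun i j => X.aug hX W (X.res h (φ.trans ψ i j))

theorem baseMatrix_apply (hX : X.PositiveAmplitude) (φ ψ : F.Frame) {W : Opens M}
    (h : W ≤ φ.U ⊓ ψ.U) (i j : Fin F.rank) (x : W) :
    baseMatrix hX φ ψ h i j x = F.baseTrans φ ψ x i j :=
  (baseTrans_apply x.2 h i j).symm

/-- The averages `∑ₐ ρₐ G_{φa} g_{aφ}` of the transition matrices `g` against their degree zero
parts `G`. -/
theorem exists_average (hX : X.PositiveAmplitude)
    (ρ : SmoothPartitionOfUnity F.Frame I M Set.univ)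
    (hρ : ρ.IsSubordinate fun φ => (φ.U : Set M)) (φ : F.Frame) :
    ∃ K : Matrix (Fin F.rank) (Fin F.rank) (X.sec φ.U), ∀ (τ : X.Triv) (x : M) (hx : x ∈ φ.U)
      (hτ : x ∈ τ.U) (S : Finset F.Frame), (∀ a ∉ S, ρ a x = 0) →
      K.map (τ.val hx hτ) = ∑ a ∈ S, ρ a x •
        ((F.baseTrans φ a x).map (algebraMap ℝ (Sym X.deg)) * transVal τ a φ x) := by
  have key : ∀ i j, ∃ b : X.sec φ.U, ∀ (τ : X.Triv) (x : M) (hx : x ∈ φ.U)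
      (hτ : x ∈ τ.U) (S : Finset F.Frame), (∀ a ∉ S, ρ a x = 0) →
      τ.val hx hτ b = ∑ a ∈ S, ρ a x •
        ((F.baseTrans φ a x).map (algebraMap ℝ (Sym X.deg)) * transVal τ a φ x) i j := by
    intro i j
    obtain ⟨b, hb⟩ := X.exists_sum_smul (fun a => ρ a) ρ.locallyFinite (fun a => a.U) hρ φ.U
      (fun a => ∑ k, algebraMap _ _ (baseMatrix hX φ a (le_refl (φ.U ⊓ a.U)) i k) *
        X.res (le_of_eq (inf_comm φ.U a.U)) (a.trans φ k j))
    refine ⟨b, fun τ x hx hτ S hS => hb τ x hx hτ S _ hS fun a ha => ?_⟩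
    rw [Matrix.mul_apply, map_sum]
    refine Finset.sum_congr rfl fun k _ => ?_
    have hxa : x ∈ φ.U ⊓ a.U := ⟨hx, ha⟩
    rw [map_mul, τ.val_algebraMap, transVal_apply hxa (le_of_eq (inf_comm φ.U a.U)) hτ,
      Matrix.map_apply, baseMatrix_apply]
  choose K hK using key
  refine ⟨Matrix.of K, fun τ x hx hτ S hS => Matrix.ext fun i j => ?_⟩
  rw [Matrix.sum_apply]
  exact hK i j τ x hx hτ S hS

variable (F) in
/-- A bundle over a graded manifold of positive amplitude has frames whose transition matrices are
matrices of smooth functions on the base. -/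
theorem exists_adaptedFrames [FiniteDimensional ℝ E] [IsManifold I ∞ M] [T2Space M]
    [SigmaCompactSpace M] (hX : X.PositiveAmplitude) :
    ∃ (fr : F.Frame → LocalFrame F.toGradedModuleSheaf F.deg) (hfr : ∀ φ, φ.U ≤ (fr φ).U),
      ∀ (φ ψ : F.Frame) (W : Opens M) (hφ : W ≤ φ.U) (hψ : W ≤ ψ.U) (c c' : Fin F.rank → X.sec W),
        (fr φ).lin (hφ.trans (hfr φ)) c = (fr ψ).lin (hψ.trans (hfr ψ)) c' ↔
          c' = c ᵥ* (baseMatrix hX φ ψ (le_inf hφ hψ)).map (algebraMap _ (X.sec W)) := by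
  obtain ⟨ρ, hρ⟩ := SmoothPartitionOfUnity.exists_isSubordinate I isClosed_univ
    (fun φ : F.Frame => (φ.U : Set M)) (fun φ => φ.U.isOpen) fun x _ => by
      obtain ⟨φ, hφ⟩ := F.exists_frame x
      exact Set.mem_iUnion.2 ⟨φ, hφ⟩
  have hρ0 : ∀ {a : F.Frame} {x}, x ∉ a.U → ρ a x = 0 := fun {a x} h =>
    image_eq_zero_of_notMem_tsupport fun h' => h (hρ a h')
  let S : M → Finset F.Frame := fun x => (ρ.locallyFinite.point_finite x).toFinset
  have hS : ∀ x, ∀ a ∉ S x, ρ a x = 0 := fun x a ha => by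
    by_contra h
    exact ha ((ρ.locallyFinite.point_finite x).mem_toFinset.2 h)
  have hS1 : ∀ x, ∑ a ∈ S x, ρ a x = 1 := fun x => by
    rw [← ρ.sum_eq_one (Set.mem_univ x)]
    refine (finsum_eq_sum_of_support_subset _ fun a ha => ?_).symm
    by_contra h
    exact ha (hS x a h)
  choose K hK using exists_average (F := F) hX ρ hρ
  have hK' := fun φ τ x hx hτ => hK φ τ x hx hτ (S x) (hS x)
  -- `G` is block diagonal and `g` is of degree zero.
  have hKg : ∀ φ, X.IsGradedMatrix F.deg (K φ) := fun φ i j => by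
    refine X.mem_gr_of_val fun τ x hx hτ => ?_
    have h1 := congrFun (congrFun (hK' φ τ x hx hτ) i) j
    rw [Matrix.map_apply] at h1
    rw [h1, Matrix.sum_apply]
    refine Submodule.sum_mem _ fun a _ => ?_
    rw [Matrix.smul_apply]
    by_cases ha : x ∈ a.U
    · refine Submodule.smul_mem _ _ ?_
      rw [Matrix.mul_apply]
      refine Submodule.sum_mem _ fun k _ => ?_
      rw [Matrix.map_apply, ← Algebra.smul_def]
      by_cases hik : F.deg i = F.deg k
      · rw [hik]
        exact Submodule.smul_mem _ _ (transVal_mem_gr k j)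
      · rw [baseTrans_eq_zero hx ha hik, zero_smul]
        exact Submodule.zero_mem _
    · rw [hρ0 ha, zero_smul]
      exact Submodule.zero_mem _
  -- The degree zero part of `K φ` is `∑ₐ ρₐ G_{φa} G_{aφ} = 1`.
  have hK1 : ∀ φ x (hx : x ∈ φ.U) i j, X.augAt hx (K φ i j) = if i = j then 1 else 0 := by
    intro φ x hx i j
    obtain ⟨τ, hτ⟩ := X.exists_triv x
    have h1 := congrFun (congrFun (hK' φ τ x hx hτ) i) j
    rw [Matrix.map_apply] at h1
    rw [X.augAt_eq hX hx τ hτ, h1, Matrix.sum_apply, map_sum, ← Matrix.one_apply,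
      ← one_mul ((1 : Matrix (Fin F.rank) (Fin F.rank) ℝ) i j), ← hS1 x, Finset.sum_mul]
    refine Finset.sum_congr rfl fun a _ => ?_
    rw [Matrix.smul_apply, map_smul, smul_eq_mul]
    by_cases ha : x ∈ a.U
    · rw [← baseTrans_self hx, ← baseTrans_mul hx ha hx, Matrix.mul_apply, Matrix.mul_apply,
        map_sum]
      congr 1
      refine Finset.sum_congr rfl fun k _ => ?_
      rw [map_mul, Matrix.map_apply, Sym.eps_algebraMap, eps_transVal hX hτ ha hx]
    · rw [hρ0 ha, zero_mul, zero_mul]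
  -- `K_φ g_{φψ} = G_{φψ} K_ψ`, from `g_{aφ} g_{φψ} = g_{aψ}` and `G_{φψ} G_{ψa} = G_{φa}`.
  have hKtrans : ∀ (φ ψ : F.Frame) (W : Opens M) (hφ : W ≤ φ.U) (hψ : W ≤ ψ.U),
      (K φ).map (X.res hφ) * Matrix.of (fun i j => X.res (le_inf hφ hψ) (φ.trans ψ i j)) =
        (baseMatrix hX φ ψ (le_inf hφ hψ)).map (algebraMap _ (X.sec W)) * (K ψ).map (X.res hψ) := by
    intro φ ψ W hφ hψ
    refine Matrix.ext fun i j => X.ext_val fun τ x hx hτ => ?_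
    rw [← Matrix.map_apply (f := τ.val hx hτ), ← Matrix.map_apply (f := τ.val hx hτ),
      Matrix.map_mul, Matrix.map_mul, Matrix.map_map, Matrix.map_map, Matrix.map_map]
    have h1 : ∀ (χ : F.Frame) (h : W ≤ χ.U), (K χ).map (τ.val hx hτ ∘ X.res h) =
        ∑ a ∈ S x, ρ a x •
          ((F.baseTrans χ a x).map (algebraMap ℝ (Sym X.deg)) * transVal τ a χ x) :=
      fun χ h => (Matrix.ext fun i j => τ.val_res h hx hτ _).trans (hK' χ τ x (h hx) hτ)
    have h2 : (Matrix.of fun i j => X.res (le_inf hφ hψ) (φ.trans ψ i j)).map (τ.val hx hτ) =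
        transVal τ φ ψ x := Matrix.ext fun i j => (transVal_apply hx (le_inf hφ hψ) hτ i j).symm
    have h3 : (baseMatrix hX φ ψ (le_inf hφ hψ)).map (τ.val hx hτ ∘ algebraMap _ (X.sec W)) =
        (F.baseTrans φ ψ x).map (algebraMap ℝ (Sym X.deg)) := Matrix.ext fun i j =>
      (τ.val_algebraMap hx hτ _).trans
        (congrArg (algebraMap ℝ (Sym X.deg)) (baseMatrix_apply hX φ ψ (le_inf hφ hψ) i j ⟨x, hx⟩))
    rw [h1 φ hφ, h1 ψ hψ, h2, h3, Finset.sum_mul, Finset.mul_sum]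
    refine congrFun (congrFun (Finset.sum_congr rfl fun a _ => ?_) i) j
    by_cases ha : x ∈ a.U
    · rw [Matrix.smul_mul, Matrix.mul_smul, Matrix.mul_assoc, transVal_mul hτ ha (hφ hx) (hψ hx),
        ← Matrix.mul_assoc, ← Matrix.map_mul, baseTrans_mul (hφ hx) (hψ hx) ha]
    · rw [hρ0 ha, zero_smul, zero_smul, zero_mul, mul_zero]
  choose L hLg hKL hLK using fun φ => exists_inverse_of_unipotent hX (hKg φ) (hK1 φ)
  refine ⟨fun φ => φ.changeBasis (hKg φ) (hLg φ) (hKL φ) (hLK φ), fun φ => le_rfl,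
    fun φ ψ W hφ hψ c c' => ?_⟩
  rw [LocalFrame.changeBasis_lin _ _ _ _ _ hφ, LocalFrame.changeBasis_lin _ _ _ _ _ hψ]
  refine (φ.lin_eq_lin_iff ψ (le_inf hφ hψ) _ _).trans ?_
  have h1 : (∀ j, (c' ᵥ* (K ψ).map (X.res hψ)) j = ∑ i, (c ᵥ* (K φ).map (X.res hφ)) i *
      X.res (le_inf hφ hψ) (φ.trans ψ i j)) ↔ c' ᵥ* (K ψ).map (X.res hψ) =
        (c ᵥ* (K φ).map (X.res hφ)) ᵥ*
          Matrix.of (fun i j => X.res (le_inf hφ hψ) (φ.trans ψ i j)) := funext_iff.symm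
  refine h1.trans ?_
  rw [Matrix.vecMul_vecMul, hKtrans, ← Matrix.vecMul_vecMul]
  refine ⟨fun h => ?_, fun h => by rw [h]⟩
  have h2 := congrArg (· ᵥ* (L ψ).map (X.res hψ)) h
  simp only [Matrix.vecMul_vecMul, Matrix.mul_assoc,
    LocalFrame.map_res_mul_map_res hψ (hKL ψ), Matrix.mul_one] at h2
  exact (Matrix.vecMul_one c').symm.trans h2

end GradedVectorBundle

end BaseCocycle

/-! ### Bundles over graded manifolds of positive amplitude come from the base -/

section FromBase

open Matrix

variable {E : Type*} [NormedAddCommGroup E] [NormedSpace ℝ E] {H : Type*} [TopologicalSpace H]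
  {I : ModelWithCorners ℝ E H} {M : Type u} [TopologicalSpace M] [ChartedSpace H M]

/-- The transition functions of the frames of `f^*F` are the pullbacks of those of `F`. -/
theorem res_trans_pbFrame {E' : Type*} [NormedAddCommGroup E'] [NormedSpace ℝ E'] {H' : Type*}
    [TopologicalSpace H'] {J : ModelWithCorners ℝ E' H'} {N : Type u} [TopologicalSpace N]
    [ChartedSpace H' N] {X : GradedManifold I M} {Y : GradedManifold J N} (f : Hom X Y)
    (F : GradedVectorBundle Y) (φ ψ : F.Frame) {W : Opens M}
    (h : W ≤ pre f.base (φ.U ⊓ ψ.U)) (i j : Fin F.rank) :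
    X.res (show W ≤ (pbFrame f F φ).U ⊓ (pbFrame f F ψ).U from h)
      ((pbFrame f F φ).trans (pbFrame f F ψ) i j) = f.pullTo h (φ.trans ψ i j) := by
  classical
  have h1 := (pbLin_eq_iff f F φ ψ (h.trans (pre_mono _ inf_le_left))
    (h.trans (pre_mono _ inf_le_right)) h (Pi.single i 1)
    (fun j => f.pullTo h (φ.trans ψ i j))).2 fun j => by
      rw [Finset.sum_eq_single i (fun k _ hk => by rw [Pi.single_eq_of_ne hk, zero_mul])
        (fun hi => absurd (Finset.mem_univ i) hi), Pi.single_eq_same, one_mul]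
  have h2 := ((pbFrame f F φ).lin_eq_lin_iff (pbFrame f F ψ) h (Pi.single i 1)
    (fun j => f.pullTo h (φ.trans ψ i j))).1 h1 j
  rw [Finset.sum_eq_single i (fun k _ hk => by rw [Pi.single_eq_of_ne hk, zero_mul])
    (fun hi => absurd (Finset.mem_univ i) hi), Pi.single_eq_same, one_mul] at h2
  exact h2.symm

theorem proj_pullTo (X : GradedManifold I M) {V W : Opens M} (h : W ≤ V) (b : Smooth I V) :
    (proj X).pullTo (V := V) (W := W) h b = algebraMap _ (X.sec W) (Smooth.res I h b) :=
  X.res_algebraMap h b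

/-- In positive amplitude, `F` is the pullback along the projection of its restriction to the base:
the adapted frames of `F` have the transition matrices of the restriction. -/
theorem nonempty_iso_pullback_proj {X : GradedManifold I M} (hX : X.PositiveAmplitude)
    [FiniteDimensional ℝ E] [IsManifold I ∞ M] [T2Space M] [SigmaCompactSpace M]
    (F : GradedVectorBundle X) :
    Nonempty (GradedVectorBundle.Iso F (pullback (proj X) (pullback (X.zeroHom hX) F))) := by
  obtain ⟨fr, hfr, hrel⟩ := F.exists_adaptedFrames hX
  let F₀ := pullback (X.zeroHom hX) F
  let fr₀ : F.Frame → F₀.Frame := fun φ => pbFrame (X.zeroHom hX) F φ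
  obtain ⟨T, -⟩ := GradedVectorBundle.exists_iso (F := F) (G := pullback (proj X) F₀) fr
    (fun φ => pbFrame (proj X) F₀ (fr₀ φ)) (fun φ => φ.U) hfr (fun φ => le_rfl) F.exists_frame
    (fun φ ψ W hφ hψ c c' => by
      refine (hrel φ ψ W hφ hψ c c').trans ((pbLin_eq_iff (proj X) F₀ (fr₀ φ) (fr₀ ψ) hφ hψ
        (le_inf hφ hψ) c c').trans ?_).symm
      have key : ∀ i j, (proj X).pullTo (show W ≤ pre (proj X).base ((fr₀ φ).U ⊓ (fr₀ ψ).U) from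
          le_inf hφ hψ) ((fr₀ φ).trans (fr₀ ψ) i j) = algebraMap _ (X.sec W)
            (GradedVectorBundle.baseMatrix hX φ ψ (le_inf hφ hψ) i j) := fun i j => by
        have hW : W ≤ pre (X.zeroHom hX).base (φ.U ⊓ ψ.U) := le_inf hφ hψ
        refine (proj_pullTo X _ _).trans (congrArg (algebraMap _ (X.sec W)) ?_)
        exact (res_trans_pbFrame (X.zeroHom hX) F φ ψ hW i j).trans
          (GradedManifold.zeroHom_pullTo hX hW _)
      simp only [funext_iff]
      refine forall_congr' fun j => ?_
      refine Eq.congr rfl ?_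
      exact Finset.sum_congr rfl fun i _ => congrArg (c i * ·) (key i j))
  exact ⟨T⟩

end FromBase

/-! ### Modules with a finite dual basis -/

section TensorEquiv

variable {C A P Q : Type*} [CommRing C] [Ring A] [Algebra C A] [AddCommGroup P] [Module C P]
  [AddCommGroup Q] [Module A Q]

/-- A criterion for `Q` to be the base change of the `C`-module `P` along `C → A`: a finite family
in `P`, with dual coordinates on `Q` that take values in `C` on `P`. -/
theorem exists_tensorEquiv (ι : P →+ Q) (hι : ∀ (c : C) p, ι (c • p) = algebraMap C A c • ι p)
    {n : ℕ} (s : Fin n → P) (θ : Fin n → Q →ₗ[A] A) (h1 : ∀ q, ∑ j, θ j q • ι (s j) = q)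
    (h2 : ∀ p, ∃ c : Fin n → C, ∑ j, c j • s j = p ∧ ∀ j, θ j (ι p) = algebraMap C A (c j)) :
    ∃ e : A ⊗[C] P ≃ₗ[A] Q, (∀ a p, e (a ⊗ₜ p) = a • ι p) ∧
      ∀ z, z = ∑ j, θ j (e z) ⊗ₜ s j := by
  let _ : Module C Q := Module.compHom Q (algebraMap C A)
  have _ : IsScalarTower C A Q := ⟨fun c a q => by
    rw [Algebra.smul_def, mul_smul]; rfl⟩
  let ι' : P →ₗ[C] Q := { ι with map_smul' := hι }
  let L : A ⊗[C] P →ₗ[A] Q := TensorProduct.AlgebraTensorModule.lift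
    (LinearMap.toSpanSingleton A (P →ₗ[C] Q) ι')
  have hL : ∀ a p, L (a ⊗ₜ p) = a • ι p := fun a p => rfl
  let R : Q →ₗ[A] A ⊗[C] P :=
    { toFun := fun q => ∑ j, θ j q ⊗ₜ s j
      map_add' := fun q q' => by
        simp only [map_add, TensorProduct.add_tmul, Finset.sum_add_distrib]
      map_smul' := fun a q => by
        simp only [map_smul, RingHom.id_apply, Finset.smul_sum, TensorProduct.smul_tmul'] }
  have hR : ∀ q, R q = ∑ j, θ j q ⊗ₜ s j := fun q => rfl
  have hLR : ∀ q, L (R q) = q := fun q => by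
    rw [hR, map_sum]
    simp only [hL, h1]
  have hRL : ∀ z, R (L z) = z := fun z => by
    induction z using TensorProduct.induction_on with
    | zero => rw [map_zero, map_zero]
    | add z z' hz hz' => rw [map_add, map_add, hz, hz']
    | tmul a p =>
      obtain ⟨c, hc, hθ⟩ := h2 p
      rw [hL, map_smul, hR]
      conv_rhs => rw [← hc]
      rw [TensorProduct.tmul_sum, Finset.smul_sum]
      refine Finset.sum_congr rfl fun j _ => ?_
      rw [hθ, TensorProduct.smul_tmul', smul_eq_mul, ← Algebra.commutes, ← Algebra.smul_def,
        TensorProduct.smul_tmul]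
  exact ⟨LinearEquiv.ofLinearMap L R (LinearMap.ext hLR) (LinearMap.ext hRL), hL,
    fun z => (hRL z).symm⟩

end TensorEquiv

/-! ### Pullback of global sections -/

section GlobalCoord

open Matrix

variable {E : Type*} [NormedAddCommGroup E] [NormedSpace ℝ E] {H : Type*} [TopologicalSpace H]
  {I : ModelWithCorners ℝ E H} {M : Type u} [TopologicalSpace M] [ChartedSpace H M]
  {E' : Type*} [NormedAddCommGroup E'] [NormedSpace ℝ E'] {H' : Type*}
  [TopologicalSpace H'] {J : ModelWithCorners ℝ E' H'} {N : Type u} [TopologicalSpace N]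
  [ChartedSpace H' N] {X : GradedManifold I M} {Y : GradedManifold J N}

/-- The coefficients of a global section in a local frame. -/
noncomputable def globalCoord {F : GradedVectorBundle Y} (φ : F.Frame) (p : F.sec ⊤) :
    Fin F.rank → Y.sec φ.U :=
  φ.coord le_rfl (F.res le_top p)

theorem lin_globalCoord {F : GradedVectorBundle Y} (φ : F.Frame) (p : F.sec ⊤) {W : Opens N}
    (h : W ≤ φ.U) : φ.lin h (fun i => Y.res h (globalCoord φ p i)) = F.res le_top p := by
  have h1 := φ.res_lin le_rfl h (globalCoord φ p)
  rw [globalCoord, φ.lin_coord, F.res_res] at h1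
  exact h1.symm

theorem res_globalCoord {F : GradedVectorBundle Y} (φ ψ : F.Frame) (p : F.sec ⊤) {W : Opens N}
    (h : W ≤ φ.U ⊓ ψ.U) (j : Fin F.rank) :
    Y.res (h.trans inf_le_right) (globalCoord ψ p j) =
      ∑ i, Y.res (h.trans inf_le_left) (globalCoord φ p i) * Y.res h (φ.trans ψ i j) :=
  (φ.lin_eq_lin_iff ψ h _ _).1
    ((lin_globalCoord φ p (h.trans inf_le_left)).trans
      (lin_globalCoord ψ p (h.trans inf_le_right)).symm) j

theorem globalCoord_add {F : GradedVectorBundle Y} (φ : F.Frame) (p q : F.sec ⊤) :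
    globalCoord φ (p + q) = globalCoord φ p + globalCoord φ q := by
  rw [globalCoord, map_add, φ.coord_add]
  rfl

theorem globalCoord_smul {F : GradedVectorBundle Y} (φ : F.Frame) (b : Y.sec ⊤) (p : F.sec ⊤)
    (i : Fin F.rank) : globalCoord φ (b • p) i = Y.res le_top b * globalCoord φ p i := by
  rw [globalCoord, F.res_smul, φ.coord_smul]
  rfl

theorem globalCoord_mem_gr {F : GradedVectorBundle Y} (φ : F.Frame) {k : ℤ} {p : F.sec ⊤}
    (hp : p ∈ F.gr k ⊤) (i : Fin F.rank) : globalCoord φ p i ∈ Y.gr (k - F.deg i) φ.U :=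
  (φ.mem_gr_iff_coord le_rfl k _).1 (F.res_mem_gr le_top hp) i

theorem globalCoord_ext {F : GradedVectorBundle Y} {p q : F.sec ⊤}
    (h : ∀ φ : F.Frame, globalCoord φ p = globalCoord φ q) : p = q := by
  refine F.eq_of_locally _ _ fun x _ => ?_
  obtain ⟨φ, hφ⟩ := F.exists_frame x
  refine ⟨φ.U, le_top, hφ, ?_⟩
  rw [← φ.lin_coord le_rfl (F.res le_top p), ← φ.lin_coord le_rfl (F.res le_top q)]
  exact congrArg _ (h φ)

/-- The pullback of global sections. -/
noncomputable def pullSection (f : Hom X Y) (F : GradedVectorBundle Y) :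
    F.sec ⊤ →+ PBSec f F ⊤ where
  toFun p := ⟨fun φ i => f.pullTo inf_le_right (globalCoord φ p i), fun φ ψ j => by
    have h := congrArg (f.pullTo (inf_le_right :
      ⊤ ⊓ pre f.base (φ.U ⊓ ψ.U) ≤ pre f.base (φ.U ⊓ ψ.U))) (res_globalCoord φ ψ p le_rfl j)
    simp only [map_sum, map_mul, f.pullTo_res] at h
    simp only [f.res_pullTo]
    exact h⟩
  map_zero' := by
    refine Subtype.ext (funext fun φ => funext fun i => ?_)
    have h : globalCoord φ (0 : F.sec ⊤) = 0 := by
      simpa using globalCoord_add φ (0 : F.sec ⊤) 0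
    change f.pullTo _ _ = 0
    rw [h, Pi.zero_apply, map_zero]
  map_add' p q := by
    refine Subtype.ext (funext fun φ => funext fun i => ?_)
    change f.pullTo _ _ = f.pullTo _ _ + f.pullTo _ _
    rw [globalCoord_add, Pi.add_apply, map_add]

theorem pbCoef_pullSection (f : Hom X Y) {F : GradedVectorBundle Y} (φ : F.Frame) {W : Opens M}
    (hφ : W ≤ pre f.base φ.U) (i : Fin F.rank) (p : F.sec ⊤) :
    pbCoef φ le_top hφ i (pullSection f F p) = f.pullTo hφ (globalCoord φ p i) :=
  f.res_pullTo _ _ _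

theorem pbCoef_ext_top {f : Hom X Y} {F : GradedVectorBundle Y} {a b : PBSec f F ⊤}
    (H : ∀ (φ : F.Frame) (i : Fin F.rank), pbCoef φ le_top (le_refl (pre f.base φ.U)) i a =
      pbCoef φ le_top (le_refl (pre f.base φ.U)) i b) : a = b := by
  refine pbCoef_ext fun φ i => ?_
  have := congrArg (X.res (inf_le_right : ⊤ ⊓ pre f.base φ.U ≤ _)) (H φ i)
  rwa [res_pbCoef, res_pbCoef] at this

theorem top_le_pre_top (f : C^∞⟮I, M; J, N⟯) : (⊤ : Opens M) ≤ pre f ⊤ := fun _ _ => trivial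

theorem pullSection_smul (f : Hom X Y) {F : GradedVectorBundle Y} (b : Y.sec ⊤) (p : F.sec ⊤) :
    pullSection f F (b • p) =
      f.pullTo (top_le_pre_top f.base) b • pullSection f F p := by
  refine pbCoef_ext_top fun φ i => ?_
  rw [pbCoef_smul, pbCoef_pullSection, pbCoef_pullSection, globalCoord_smul, map_mul, f.pullTo_res,
    f.res_pullTo]

theorem pullSection_mem_gr (f : Hom X Y) {F : GradedVectorBundle Y} {k : ℤ} {p : F.sec ⊤}
    (hp : p ∈ F.gr k ⊤) : pullSection f F p ∈ pbGr f F k ⊤ := fun φ i => by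
  rw [pbCoef_pullSection]
  exact f.pullTo_mem_gr _ (globalCoord_mem_gr φ hp i)

end GlobalCoord

/-! ### Global sections of a bundle pulled back from the base -/

section Sections

open Matrix

variable {E : Type*} [NormedAddCommGroup E] [NormedSpace ℝ E] {H : Type*} [TopologicalSpace H]
  {I : ModelWithCorners ℝ E H} {M : Type u} [TopologicalSpace M] [ChartedSpace H M]
  {X : GradedManifold I M} {F : GradedVectorBundle (ofManifold I M)}

/-- An ordinary manifold has no graded coordinates at all; hence the notions for positive amplitude,
in particular `baseTrans`, apply to vector bundles on it. -/
theorem ofManifold_positiveAmplitude : (ofManifold I M).PositiveAmplitude := fun i => i.elim0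

theorem augAt_ofManifold {W : Opens M} {x : M} (hx : x ∈ W) (f : Smooth I W) :
    (ofManifold I M).augAt hx f = f ⟨x, hx⟩ :=
  GradedManifold.augAt_algebraMap (X := ofManifold I M) hx f

theorem ofManifold_ext {W : Opens M} {a b : (ofManifold I M).sec W}
    (h : ∀ x (hx : x ∈ W), (ofManifold I M).augAt hx a = (ofManifold I M).augAt hx b) : a = b :=
  ContMDiffMap.ext fun x =>
    (augAt_ofManifold x.2 a).symm.trans ((h x x.2).trans (augAt_ofManifold x.2 b))

theorem mem_ofManifold_gr_zero {W : Opens M} (a : (ofManifold I M).sec W) :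
    a ∈ (ofManifold I M).gr 0 W := by
  have h : functionGr I 0 W = ⊤ := if_pos rfl
  exact (h.symm ▸ Submodule.mem_top : (show Smooth I W from a) ∈ functionGr I 0 W)

/-- The restriction to `U` of a function on `M` which is smooth on `U`. -/
def Smooth.ofContMDiffOn {U : Opens M} (f : M → ℝ) (hf : ContMDiffOn I 𝓘(ℝ, ℝ) ∞ f U) :
    Smooth I U :=
  ⟨fun x => f x, fun x => contMDiffAt_subtype_iff.2 (hf.contMDiffAt (U.isOpen.mem_nhds x.2))⟩

theorem augAt_ofContMDiffOn {U : Opens M} {f : M → ℝ} (hf : ContMDiffOn I 𝓘(ℝ, ℝ) ∞ f U) {x : M}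
    (hx : x ∈ U) : (ofManifold I M).augAt hx (Smooth.ofContMDiffOn f hf) = f x :=
  augAt_ofManifold hx _

/-- The coefficients of a global section of a bundle on an ordinary manifold, as smooth
functions. -/
noncomputable def smoothCoord (φ : F.Frame) (i : Fin F.rank) : F.sec ⊤ →+ Smooth I φ.U :=
  AddMonoidHom.mk' (fun p => (globalCoord φ p i : (ofManifold I M).sec φ.U)) fun p q =>
    congrFun (globalCoord_add φ p q) i

theorem smoothCoord_smul (φ : F.Frame) (i : Fin F.rank) (c : Smooth I (⊤ : Opens M))
    (p : F.sec ⊤) :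
    smoothCoord φ i (c • p) = Smooth.res I le_top c * smoothCoord φ i p :=
  globalCoord_smul (Y := ofManifold I M) φ c p i

theorem smoothCoord_ext {p q : F.sec ⊤}
    (h : ∀ (φ : F.Frame) i, smoothCoord φ i p = smoothCoord φ i q) : p = q :=
  globalCoord_ext fun φ => funext fun i => h φ i

/-- Coefficients which transform by the cocycle of `F` glue to a global section of `F`. -/
theorem exists_section_of_isSection {s : F.Frame → M → Fin F.rank → ℝ}
    (hs : (F.baseCocycle ofManifold_positiveAmplitude).IsSection s) :
    ∃ p : F.sec ⊤, ∀ (φ : F.Frame) (i : Fin F.rank),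
      smoothCoord φ i p = Smooth.ofContMDiffOn (fun x => s φ x i) (hs.smooth φ i) := by
  let c : ∀ φ : F.Frame, Fin F.rank → (ofManifold I M).sec φ.U := fun φ i =>
    Smooth.ofContMDiffOn (fun x => s φ x i) (hs.smooth φ i)
  have hc : ∀ (φ : F.Frame) x (hx : x ∈ φ.U) i, (ofManifold I M).augAt hx (c φ i) = s φ x i :=
    fun φ x hx i => augAt_ofContMDiffOn _ hx
  obtain ⟨p, hp⟩ := F.exists_glue (fun φ : F.Frame => φ.U) (fun φ => le_top)
    (fun x _ => by
      obtain ⟨φ, hφ⟩ := F.exists_frame x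
      exact Opens.mem_iSup.2 ⟨φ, hφ⟩)
    (fun φ => φ.lin le_rfl (c φ)) (fun φ ψ => by
      rw [LocalFrame.res_lin, LocalFrame.res_lin]
      refine (φ.lin_eq_lin_iff ψ le_rfl _ _).2 fun j => ofManifold_ext fun x hx => ?_
      rw [GradedManifold.augAt_res, hc, map_sum, hs.trans hx.1 hx.2]
      change ∑ i, s φ x i * F.baseTrans φ ψ x i j = _
      refine Finset.sum_congr rfl fun i _ => ?_
      rw [map_mul, GradedManifold.augAt_res, hc]
      exact congrArg _ (GradedVectorBundle.baseTrans_apply hx le_rfl i j))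
  refine ⟨p, fun φ i => ?_⟩
  have h1 : globalCoord φ p = c φ := by rw [globalCoord, hp φ, φ.coord_lin]
  exact congrFun h1 i

theorem mem_gr_of_smoothCoord {k : ℤ} {p : F.sec ⊤}
    (h : ∀ (φ : F.Frame) i, k ≠ F.deg i → smoothCoord φ i p = 0) : p ∈ F.gr k ⊤ := by
  refine F.gr_of_locally _ fun x _ => ?_
  obtain ⟨φ, hφ⟩ := F.exists_frame x
  refine ⟨φ.U, le_top, hφ, (φ.mem_gr_iff_coord le_rfl k _).2 fun i => ?_⟩
  by_cases hk : k = F.deg i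
  · rw [hk, sub_self]
    exact mem_ofManifold_gr_zero _
  · have h1 : φ.coord le_rfl (F.res le_top p) i = 0 := h φ i hk
    rw [h1]
    exact Submodule.zero_mem _

/-- The coefficients of a global section of the pullback `π^*F` in the frame induced by a local
frame of `F`. -/
noncomputable def projCoef (φ : F.Frame) (i : Fin F.rank) : PBSec (proj X) F ⊤ →+ X.sec φ.U :=
  pbCoef φ le_top (show φ.U ≤ pre (proj X).base φ.U from le_rfl) i

theorem projCoef_smul (φ : F.Frame) (i : Fin F.rank) (a : X.sec ⊤) (t : PBSec (proj X) F ⊤) :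
    projCoef φ i (a • t) = X.res le_top a * projCoef φ i t :=
  pbCoef_smul φ _ _ i a t

theorem projCoef_ext {t t' : PBSec (proj X) F ⊤}
    (h : ∀ (φ : F.Frame) i, projCoef φ i t = projCoef φ i t') : t = t' :=
  pbCoef_ext_top h

theorem projCoef_mem_gr {k : ℤ} {t : PBSec (proj X) F ⊤} (ht : t ∈ pbGr (proj X) F k ⊤)
    (φ : F.Frame) (i : Fin F.rank) : projCoef φ i t ∈ X.gr (k - F.deg i) φ.U :=
  pbCoef_mem_gr ht φ _ _ i

theorem projCoef_pullSection (φ : F.Frame) (i : Fin F.rank) (q : F.sec ⊤) :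
    projCoef φ i (pullSection (proj X) F q) =
      algebraMap (Smooth I φ.U) (X.sec φ.U) (smoothCoord φ i q) :=
  (pbCoef_pullSection (proj X) φ _ i q).trans ((proj_pullTo X le_rfl _).trans
    (congrArg _ ((ofManifold I M).res_refl (globalCoord φ q i))))

theorem projCoef_trans (φ ψ : F.Frame) {W : Opens M} (h : W ≤ φ.U ⊓ ψ.U) (k : Fin F.rank)
    (t : PBSec (proj X) F ⊤) : X.res (h.trans inf_le_right) (projCoef ψ k t) =
      ∑ i, X.res (h.trans inf_le_left) (projCoef φ i t) *
        algebraMap (Smooth I W) (X.sec W) (Smooth.res I h (φ.trans ψ i k)) := by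
  have h1 : W ≤ pre (proj X).base (φ.U ⊓ ψ.U) := h
  refine (res_pbCoef ψ _ _ _ k t).trans ((pbCoef_trans φ ψ le_top (h.trans inf_le_left)
    (h.trans inf_le_right) h1 k t).trans (Finset.sum_congr rfl fun i _ => congrArg₂ (· * ·) ?_ ?_))
  · exact (res_pbCoef φ _ _ _ i t).symm
  · exact proj_pullTo X h _

theorem eq_of_forall_frame {Y : GradedManifold I M} (F : GradedVectorBundle Y) {a b : X.sec ⊤}
    (h : ∀ φ : F.Frame, X.res (le_top : φ.U ≤ ⊤) a = X.res le_top b) : a = b := by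
  refine X.eq_of_locally _ _ fun x _ => ?_
  obtain ⟨φ, hφ⟩ := F.exists_frame x
  exact ⟨φ.U, le_top, hφ, h φ⟩

theorem exists_glue_frame (F : GradedVectorBundle (ofManifold I M)) (b : ∀ φ : F.Frame, X.sec φ.U)
    (hb : ∀ φ ψ : F.Frame, X.res (inf_le_left : φ.U ⊓ ψ.U ≤ φ.U) (b φ) =
      X.res (inf_le_right : φ.U ⊓ ψ.U ≤ ψ.U) (b ψ)) :
    ∃ a : X.sec ⊤, ∀ φ, X.res le_top a = b φ :=
  X.exists_glue (fun φ : F.Frame => φ.U) (fun φ => le_top) (fun x _ => by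
    obtain ⟨φ, hφ⟩ := F.exists_frame x
    exact Opens.mem_iSup.2 ⟨φ, hφ⟩) b hb

/-- Functions `Tᵢ` with `T_φ = G_{φψ} T_ψ` define a section of the dual of `F`, and hence an
`A`-linear form on the global sections of the pullback. -/
theorem exists_linearForm {T : ∀ φ : F.Frame, Fin F.rank → Smooth I φ.U}
    (hT : ∀ (φ ψ : F.Frame) x (hφ : x ∈ φ.U) (hψ : x ∈ ψ.U) i,
      ∑ k, F.baseTrans φ ψ x i k * T ψ k ⟨x, hψ⟩ = T φ i ⟨x, hφ⟩) :
    ∃ θ : PBSec (proj X) F ⊤ →ₗ[X.sec ⊤] X.sec ⊤, ∀ t (φ : F.Frame),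
      X.res le_top (θ t) =
        ∑ i, projCoef φ i t * algebraMap (Smooth I φ.U) (X.sec φ.U) (T φ i) := by
  choose θ hθ using fun t : PBSec (proj X) F ⊤ => exists_glue_frame (X := X) F
    (fun φ => ∑ i, projCoef φ i t * algebraMap (Smooth I φ.U) (X.sec φ.U) (T φ i)) (fun φ ψ => by
      simp only [map_sum, map_mul, X.res_algebraMap, projCoef_trans φ ψ le_rfl, Finset.sum_mul]
      rw [Finset.sum_comm]
      refine Finset.sum_congr rfl fun i _ => ?_
      simp only [mul_assoc, ← map_mul]
      rw [← Finset.mul_sum, ← map_sum]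
      refine congrArg (fun g : Smooth I (φ.U ⊓ ψ.U) => _ * algebraMap _ (X.sec _) g) ?_
      refine ofManifold_ext fun x hx => ?_
      refine (augAt_ofManifold hx _).trans ((hT φ ψ x hx.1 hx.2 i).symm.trans ?_)
      refine Eq.symm ((map_sum ((ofManifold I M).augAt hx) _ _).trans
        (Finset.sum_congr rfl fun k _ => ?_))
      refine (map_mul ((ofManifold I M).augAt hx) _ _).trans (congrArg₂ (· * ·) ?_ ?_)
      · exact (GradedVectorBundle.baseTrans_apply hx le_rfl i k).symm
      · exact augAt_ofManifold hx _)
  exact ⟨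
    { toFun := θ
      map_add' := fun t t' => eq_of_forall_frame F fun φ => by
        simp only [map_add, hθ, add_mul, Finset.sum_add_distrib]
      map_smul' := fun a t => eq_of_forall_frame F fun φ => by
        simp only [RingHom.id_apply, smul_eq_mul, map_mul, hθ, projCoef_smul, mul_assoc,
          Finset.mul_sum] }, hθ⟩

variable (X F) in
/-- The projection formula `Γ(π^*F) = C^∞(X) ⊗ Γ(F)` for global sections. -/
theorem exists_tensorEquiv_pullback_proj [FiniteDimensional ℝ E] [IsManifold I ∞ M] [T2Space M]
    [SecondCountableTopology M] [SigmaCompactSpace M] :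
    ∃ e : (X.sec ⊤ ⊗[Smooth I (⊤ : Opens M)] F.sec ⊤) ≃ₗ[X.sec ⊤] PBSec (proj X) F ⊤,
      ∀ (k : ℤ) (z : X.sec ⊤ ⊗[Smooth I (⊤ : Opens M)] F.sec ⊤),
        e z ∈ pbGr (proj X) F k ⊤ ↔
          z ∈ AddSubgroup.closure {w | ∃ (i j : ℤ) (a : X.sec ⊤) (s : F.sec ⊤),
            i + j = k ∧ a ∈ X.gr i ⊤ ∧ s ∈ F.gr j ⊤ ∧ w = a ⊗ₜ s} := by
  obtain ⟨n, s, δ, T, hs, hsδ, hT, hTS, hGT, hTδ⟩ :=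
    (F.baseCocycle ofManifold_positiveAmplitude).exists_dualBasis (d := F.deg)
      fun ha hb h => GradedVectorBundle.baseTrans_eq_zero ha hb h
  choose p hp using fun j => exists_section_of_isSection (hs j)
  let T' : Fin n → ∀ φ : F.Frame, Fin F.rank → Smooth I φ.U := fun j φ i =>
    Smooth.ofContMDiffOn _ (hT φ i j)
  have hT' : ∀ j (φ ψ : F.Frame) x (hφ : x ∈ φ.U) (hψ : x ∈ ψ.U) i,
      ∑ k, F.baseTrans φ ψ x i k * T' j ψ k ⟨x, hψ⟩ = T' j φ i ⟨x, hφ⟩ := fun j φ ψ x hφ hψ i =>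
    congrFun (congrFun (hGT φ ψ x hφ hψ) i) j
  choose θ hθ using fun j => exists_linearForm (X := X) (hT' j)
  have hTS' : ∀ (φ : F.Frame) i k, ∑ j, T' j φ i * smoothCoord φ k (p j) =
      if i = k then 1 else 0 := by
    intro φ i k
    simp only [hp]
    refine ofManifold_ext fun x hx => ?_
    have h1 := congrFun (congrFun (hTS φ x hx) i) k
    rw [Matrix.mul_apply, Matrix.one_apply] at h1
    refine (map_sum ((ofManifold I M).augAt hx) _ _).trans (Eq.trans (Finset.sum_congr rfl
      fun j _ => ?_) (h1.trans ?_))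
    · exact (map_mul ((ofManifold I M).augAt hx) _ _).trans
        (congrArg₂ (· * ·) (augAt_ofContMDiffOn _ hx) (augAt_ofContMDiffOn _ hx))
    · split_ifs
      · exact (map_one ((ofManifold I M).augAt hx)).symm
      · exact (map_zero ((ofManifold I M).augAt hx)).symm
  -- In each frame, `T` is inverse to the matrix of the coefficients of the sections `p j`.
  have hsum : ∀ t, ∑ j, θ j t • pullSection (proj X) F (p j) = t := fun t => by
    refine projCoef_ext fun φ k => ?_
    simp only [map_sum, projCoef_smul, hθ, projCoef_pullSection, Finset.sum_mul, mul_assoc,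
      ← map_mul]
    rw [Finset.sum_comm]
    simp only [← Finset.mul_sum]
    simp only [← map_sum, hTS']
    simp [apply_ite]
  -- The form `θ j` takes smooth functions as values on the sections of `F`.
  have hfun : ∀ q : F.sec ⊤, ∃ c : Fin n → Smooth I (⊤ : Opens M), ∑ j, c j • p j = q ∧
      ∀ j, θ j (pullSection (proj X) F q) = algebraMap _ (X.sec ⊤) (c j) := fun q => by
    choose θ₀ hθ₀ using fun j => exists_linearForm (X := ofManifold I M) (hT' j)
    let c : Fin n → Smooth I (⊤ : Opens M) := fun j =>
      θ₀ j (pullSection (proj (ofManifold I M)) F q)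
    have hc : ∀ j (φ : F.Frame), Smooth.res I (le_top : φ.U ≤ ⊤) (c j) =
        ∑ i, smoothCoord φ i q * T' j φ i := fun j φ =>
      (hθ₀ j _ φ).trans (Finset.sum_congr rfl fun i _ => congrArg (· * _)
        (projCoef_pullSection φ i q))
    refine ⟨c, smoothCoord_ext fun φ k => ?_, fun j => eq_of_forall_frame F fun φ => ?_⟩
    · simp only [map_sum, smoothCoord_smul, hc, Finset.sum_mul, mul_assoc]
      rw [Finset.sum_comm]
      simp only [← Finset.mul_sum, hTS']
      simp
    · simp only [hθ, projCoef_pullSection, X.res_algebraMap, hc, map_sum, map_mul]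
  obtain ⟨e, he, hes⟩ := exists_tensorEquiv (C := Smooth I (⊤ : Opens M)) (A := X.sec ⊤)
    (P := F.sec ⊤) (Q := PBSec (proj X) F ⊤) (pullSection (proj X) F)
    (fun c q => by
      refine (pullSection_smul (proj X) (Y := ofManifold I M) c q).trans
        (congrArg (· • pullSection (proj X) F q) ?_)
      exact (proj_pullTo X le_rfl c).trans (congrArg _ ((ofManifold I M).res_refl c)))
    p θ hsum hfun
  refine ⟨e, fun k z => ⟨fun hz => ?_, fun hz => ?_⟩⟩
  · rw [hes z]
    refine sum_mem fun j _ => AddSubgroup.subset_closure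
      ⟨k - δ j, δ j, θ j (e z), p j, sub_add_cancel _ _, ?_, ?_, rfl⟩
    · refine X.gr_of_locally _ fun x _ => ?_
      obtain ⟨φ, hφ⟩ := F.exists_frame x
      refine ⟨φ.U, le_top, hφ, ?_⟩
      rw [hθ]
      refine Submodule.sum_mem _ fun i _ => ?_
      by_cases hi : F.deg i = δ j
      · have h1 := X.mul_mem_gr (projCoef_mem_gr hz φ i)
          (algebraMap_mem_gr X (mem_ofManifold_gr_zero (T' j φ i)))
        rwa [add_zero, hi] at h1
      · have h1 : T' j φ i = 0 := ContMDiffMap.ext fun x => hTδ φ x i j x.2 hi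
        rw [h1, map_zero, mul_zero]
        exact Submodule.zero_mem _
    · refine mem_gr_of_smoothCoord fun φ i hi => ?_
      rw [hp]
      exact ContMDiffMap.ext fun x => hsδ j φ x i hi.symm
  · induction hz using AddSubgroup.closure_induction with
    | mem w hw =>
      obtain ⟨i, j, a, q, rfl, ha, hq, rfl⟩ := hw
      rw [he]
      exact (pullback (proj X) F).smul_mem_gr ha (pullSection_mem_gr (proj X) hq)
    | zero => rw [map_zero]; exact AddSubgroup.zero_mem _
    | add z z' _ _ hz hz' => rw [map_add]; exact AddSubgroup.add_mem _ hz hz'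
    | neg z _ hz => rw [map_neg]; exact AddSubgroup.neg_mem _ hz

end Sections

end GradedGeometry

theorem theoremA4
    {E : Type*} [NormedAddCommGroup E] [NormedSpace ℝ E] [FiniteDimensional ℝ E]
    {H : Type*} [TopologicalSpace H] {I : ModelWithCorners ℝ E H}
    {M : Type u} [TopologicalSpace M] [ChartedSpace H M] [IsManifold I ∞ M]
    [T2Space M] [SecondCountableTopology M]
    {E' : Type*} [NormedAddCommGroup E'] [NormedSpace ℝ E'] [FiniteDimensional ℝ E']
    {H' : Type*} [TopologicalSpace H'] {J : ModelWithCorners ℝ E' H'}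
    {N : Type u} [TopologicalSpace N] [ChartedSpace H' N] [IsManifold J ∞ N]
    [T2Space N] [SecondCountableTopology N]
    (X : GradedGeometry.GradedManifold I M) (Y : GradedGeometry.GradedManifold J N) :
    -- homotopy invariance of pullbacks
    (∀ (f : GradedGeometry.Hom X.prodInterval Y) (F : GradedGeometry.GradedVectorBundle Y),
      Nonempty (GradedGeometry.GradedVectorBundle.Iso
        (GradedGeometry.pullback (f.comp (GradedGeometry.incl X 0)) F)
        (GradedGeometry.pullback (f.comp (GradedGeometry.incl X 1)) F))) ∧
    -- bundles over a graded manifold of positive amplitude come from the base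
    (X.PositiveAmplitude → ∀ F : GradedGeometry.GradedVectorBundle X,
      ∃ F₀ : GradedGeometry.GradedVectorBundle (GradedGeometry.ofManifold I M),
        Nonempty (GradedGeometry.GradedVectorBundle.Iso F
          (GradedGeometry.pullback (GradedGeometry.proj X) F₀)) ∧
        ∃ e : (X.sec ⊤ ⊗[GradedGeometry.Smooth I (⊤ : Opens M)] F₀.sec ⊤) ≃ₗ[X.sec ⊤] F.sec ⊤,
          ∀ (k : ℤ) (z : X.sec ⊤ ⊗[GradedGeometry.Smooth I (⊤ : Opens M)] F₀.sec ⊤),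
            e z ∈ F.gr k ⊤ ↔
              z ∈ AddSubgroup.closure {w | ∃ (i j : ℤ) (a : X.sec ⊤) (s : F₀.sec ⊤),
                i + j = k ∧ a ∈ X.gr i ⊤ ∧ s ∈ F₀.gr j ⊤ ∧ w = a ⊗ₜ s}) := by
  refine ⟨fun f F => ?_, fun hX F => ?_⟩
  · have : LocallyCompactSpace M := Manifold.locallyCompact_of_finiteDimensional I
    exact GradedGeometry.nonempty_iso_pullback_incl f F
  · have : LocallyCompactSpace M := Manifold.locallyCompact_of_finiteDimensional I
    obtain ⟨S⟩ := GradedGeometry.nonempty_iso_pullback_proj hX F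
    refine ⟨GradedGeometry.pullback (X.zeroHom hX) F, ⟨S⟩, ?_⟩
    obtain ⟨e, he⟩ := GradedGeometry.exists_tensorEquiv_pullback_proj X
      (GradedGeometry.pullback (X.zeroHom hX) F)
    let e' : (X.sec ⊤ ⊗[GradedGeometry.Smooth I (⊤ : Opens M)]
        (GradedGeometry.pullback (X.zeroHom hX) F).sec ⊤) ≃ₗ[X.sec ⊤]
        (GradedGeometry.pullback (GradedGeometry.proj X)
          (GradedGeometry.pullback (X.zeroHom hX) F)).sec ⊤ := e
    refine ⟨e'.trans (S.equiv ⊤).symm, fun k z => ?_⟩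
    rw [← S.mem_gr_iff, LinearEquiv.trans_apply, LinearEquiv.apply_symm_apply]
    exact he k z
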